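/- Let $(E,\|\cdot\|)$ be a separable real Banach space with its Borel $\sigma$-algebra, and let $\{X^x_t\}_{t\ge0}$, $x\in E$, be a family of (jointly measurable in $(t,\omega)$) $E$-valued time-homogeneous Markov processes on a filtered probability space $(\Omega,\mathcal F,\{\mathcal F_t\}_{t\ge0},\mathbb P)$ with $X^x_0=x$. Write $P_tf(x)=\mathbb E[f(X^x_t)]$ and $\nu(f)=\int_E f\,\mathrm d\nu$. Assume the following. (i) There are constants $r\ge2$, $\tilde r\ge1$, $L_1>0$ such that for all $x\in E$, $\sup_{t\ge0}\mathbb E[\|X^x_t\|^r]\le L_1(1+\|x\|^{\tilde r r})$. (ii) There are constants $\gamma_1\in(0,1]$, $\beta\in[0,r-1]$, $L_2>0$ and a continuous function $\rho:[0,\infty)\to[0,\infty)$ with $\int_0^\infty\rho^{\gamma_1}(t)\,\mathrm dt<\infty$ such that for all $x,y\in E$ and $t\ge0$, $$\big(\mathbb E[\|X^x_t-X^y_t\|^2]\big)^{1/2}\le L_2\|x-y\|\,(1+\|x\|^\beta+\|y\|^\beta)\,\rho(t).$$ For $p\ge1$ and $\gamma\in(0,1]$ let $\mathcal C_{p,\gamma}$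 be the set of continuous $f:E\to\mathbb R$ with $$\sup_{u\in E}\frac{|f(u)|}{1+\|u\|^{p/2}}+\sup_{u_1\ne u_2}\frac{|f(u_1)-f(u_2)|}{(1\wedge\|u_1-u_2\|^\gamma)(1+\|u_1\|^p+\|u_2\|^p)^{1/2}}<\infty.$$ Let $\gamma\in[\gamma_1,1]$ and let $p\ge1$ satisfy $2\tilde r\big(p\tilde r+(2+3\beta)\gamma\big)\le r$. Then $\{X^x_t\}_{t\ge0}$ admits a unique invariant probability measure $\mu$ on $E$. Moreover, for every $f\in\mathcal C_{p,\gamma}$ and every $x\in E$, the strong law of large numbers and the central limit theorem hold: $$\frac1T\int_0^Tf(X^x_t)\,\mathrm dt\to\mu(f)\ \text{ almost surely},\qquad \frac1{\sqrt T}\int_0^T\big(f(X^x_t)-\mu(f)\big)\,\mathrm dt\to\mathscr N(0,v^2)\ \text{ in distribution},\qquad\text{as }T\to\infty,$$ where $$v^2=2\mu\Big((f-\mu(f))\int_0^\infty(P_tf-\mu(f))\,\mathrm dt\Big)\ge0,$$ all the integrals above being absolutely convergent (those along the paths of $X^x$ almost surely), and where $\mathscr N(0,0)$ is the Dirac mass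 at $0$. -/

import Mathlib

open MeasureTheory ProbabilityTheory Filter Set Topology
open scoped NNReal ENNReal

namespace MarkovLimit

section TestFunctions

variable {E : Type*} [NormedAddCommGroup E]

/-- The quasi-metric `d_{p,γ}(u₁,u₂) = (1 ∧ ‖u₁ - u₂‖^γ) (1 + ‖u₁‖^p + ‖u₂‖^p)^{1/2}`. -/
noncomputable def quasiDist (p γ : ℝ) (u₁ u₂ : E) : ℝ :=
  min 1 (‖u₁ - u₂‖ ^ γ) * Real.sqrt (1 + ‖u₁‖ ^ p + ‖u₂‖ ^ p)

/-- The norm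
`‖f‖_{p,γ} = sup_u |f u| / (1 + ‖u‖^{p/2}) + sup_{u₁ ≠ u₂} |f u₁ - f u₂| / d_{p,γ}(u₁,u₂)`,
with value `∞` when a supremum is infinite. -/
noncomputable def testNorm (p γ : ℝ) (f : E → ℝ) : ℝ≥0∞ :=
  (⨆ u : E, ENNReal.ofReal (|f u| / (1 + ‖u‖ ^ (p / 2)))) +
    ⨆ (u₁ : E) (u₂ : E) (_ : u₁ ≠ u₂), ENNReal.ofReal (|f u₁ - f u₂| / quasiDist p γ u₁ u₂)

/-- The space `C_{p,γ}` of continuous functions `f` with `‖f‖_{p,γ} < ∞`. -/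
def testSpace (E : Type*) [NormedAddCommGroup E] (p γ : ℝ) : Set (E → ℝ) :=
  {f | Continuous f ∧ testNorm p γ f < ∞}

end TestFunctions

section Markov

variable {E Ω : Type*} [NormedAddCommGroup E] [MeasurableSpace E] [mΩ : MeasurableSpace Ω]

/-- `P_t f (x) = 𝔼 f(X^x_t)`. The process started at `x`, at time `t`, is `X t x`. -/
noncomputable def semigroup (P : Measure Ω) (X : ℝ≥0 → E → Ω → E) (t : ℝ≥0) (f : E → ℝ) (x : E) :
    ℝ :=
  ∫ ω, f (X t x ω) ∂P

/-- `X` is a family of (jointly measurable) time-homogeneous Markov processes with respect to the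
filtration `ℱ`, the process `X · x` starting at `x`. -/
structure IsTimeHomogeneousMarkov (P : Measure Ω) (ℱ : Filtration ℝ≥0 mΩ)
    (X : ℝ≥0 → E → Ω → E) : Prop where
  adapted : ∀ x, Adapted ℱ (fun t => X t x)
  measurable_process : ∀ x, Measurable (fun q : ℝ≥0 × Ω => X q.1 x q.2)
  initial : ∀ x, ∀ᵐ ω ∂P, X 0 x ω = x
  measurable_law : ∀ t, Measurable (fun x => P.map (X t x))
  markov : ∀ (x : E) (s t : ℝ≥0) (φ : E → ℝ), Measurable φ → (∃ C, ∀ u, |φ u| ≤ C) →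
    P[fun ω => φ (X (s + t) x ω) | ℱ s] =ᵐ[P] fun ω => semigroup P X t φ (X s x ω)

/-- The transition kernel `x ↦ μ_t^x`, where `μ_t^x` is the law of `X^x_t`. -/
noncomputable def transitionKernel {P : Measure Ω} {ℱ : Filtration ℝ≥0 mΩ} {X : ℝ≥0 → E → Ω → E}
    (hX : IsTimeHomogeneousMarkov P ℱ X) (t : ℝ≥0) : Kernel E E :=
  ⟨fun x => P.map (X t x), hX.measurable_law t⟩

/-- Invariance of a measure under all transition kernels. -/
def IsInvariant {P : Measure Ω} {ℱ : Filtration ℝ≥0 mΩ} {X : ℝ≥0 → E → Ω → E}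
    (hX : IsTimeHomogeneousMarkov P ℱ X) (μ : Measure E) : Prop :=
  ∀ t : ℝ≥0, (transitionKernel hX t).Invariant μ

/-- Uniform moment bound: `sup_{t ≥ 0} 𝔼 ‖X^x_t‖^r ≤ L₁ (1 + ‖x‖^{r' r})`. -/
structure MomentBound (P : Measure Ω) (X : ℝ≥0 → E → Ω → E) (r r' L₁ : ℝ) : Prop where
  two_le : 2 ≤ r
  one_le : 1 ≤ r'
  pos : 0 < L₁
  bound : ∀ (x : E) (t : ℝ≥0),
    ∫⁻ ω, ‖X t x ω‖ₑ ^ r ∂P ≤ ENNReal.ofReal (L₁ * (1 + ‖x‖ ^ (r' * r)))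

/-- Mean-square contraction:
`(𝔼 ‖X^x_t - X^y_t‖²)^{1/2} ≤ L₂ ‖x - y‖ (1 + ‖x‖^β + ‖y‖^β) ρ(t)` with `∫₀^∞ ρ^{γ₁} < ∞`. -/
structure Contraction (P : Measure Ω) (X : ℝ≥0 → E → Ω → E) (r γ₁ β L₂ : ℝ) (ρ : ℝ → ℝ) :
    Prop where
  exponent_mem : γ₁ ∈ Ioc (0 : ℝ) 1
  beta_mem : β ∈ Icc (0 : ℝ) (r - 1)
  pos : 0 < L₂
  rate_continuous : ContinuousOn ρ (Ici 0)
  rate_nonneg : ∀ t, 0 ≤ t → 0 ≤ ρ t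
  rate_integrable : IntegrableOn (fun t => ρ t ^ γ₁) (Ioi 0)
  bound : ∀ (x y : E) (t : ℝ≥0),
    (∫⁻ ω, ‖X t x ω - X t y ω‖ₑ ^ (2 : ℝ) ∂P) ^ (1 / 2 : ℝ) ≤
      ENNReal.ofReal (L₂ * ‖x - y‖ * (1 + ‖x‖ ^ β + ‖y‖ ^ β) * ρ t)

/-- The function `u ↦ ∫₀^∞ (P_t f(u) - μ(f)) dt`. -/
noncomputable def corrector (P : Measure Ω) (X : ℝ≥0 → E → Ω → E) (μ : Measure E) (f : E → ℝ)
    (u : E) : ℝ :=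
  ∫ t in Ioi (0 : ℝ), (semigroup P X t.toNNReal f u - ∫ y, f y ∂μ)

/-- `v² = 2 μ((f - μ(f)) ∫₀^∞ (P_t f - μ(f)) dt)`. -/
noncomputable def asymptoticVariance (P : Measure Ω) (X : ℝ≥0 → E → Ω → E) (μ : Measure E)
    (f : E → ℝ) : ℝ :=
  2 * ∫ u, (f u - ∫ y, f y ∂μ) * corrector P X μ f u ∂μ

end Markov

end MarkovLimit

set_option linter.unusedSectionVars false

/-! The engine is a smoothing estimate. If `F` is locally `γ₁`-Hölder with a polynomial weight of
order `m`, then so is `P_t F`, with weight of order `β γ₁ + r' m` and a constant multiplied by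
`ρ(t)^γ₁` (`exists_semigroup_isLocHolder`). It follows from the coupling bound on `X^x_t - X^y_t`
and the uniform moments.

Applied to bounded Lipschitz functions, it shows that the laws of `X^0` along times with `ρ → 0` are
uniformly Cauchy. In a complete separable space this forces tightness, and a weak limit along an
ultrafilter is invariant and inherits the moment of order `r` (`exists_isInvariant`). Integrating
the same estimate against `μ` gives `P_t F → μ(F)` at the integrable rate `ρ^γ₁`
(`exists_semigroup_sub_integral_le`), which yields uniqueness and makes the corrector `g = ∫₀^∞ (P_t
f - μ(f)) dt` a convergent integral, again locally Hölder.

By the Markov property, `g(X_t) + ∫₀ᵗ (f(X_u) - μ(f)) du` is a martingale, so the path integral is a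
martingale up to boundary terms with bounded moments. The squared martingale increment over `[s, e]`
has conditional drift `2 (f - μ(f)) g` along the path. This product is again locally Hölder, so its
conditional mean approaches `v²` at an integrable rate. Hence the conditional second moment of the
increment is `v² (e - s) + O(1)`, uniformly in `s` and `e` (`abs_integral_mul_increment_sq_sub_le`).
`ApproxMartingale` isolates exactly these facts, always tested against random variables of the past,
and `exists_approxMartingale` supplies them.

Both limit theorems use only that structure. For the strong law, second moments of order `T` give
convergence along `T = n²`, and fourth moments fill the gaps. For the central limit theorem, `[0,
T]` is cut into blocks of length about `T^(1/8)`, and each block multiplies the characteristic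
function by a Gaussian factor up to a small error. The sum of the errors is `O(T^(-1/8))`
(`exists_norm_charFun_average_sub_le`). -/

namespace MarkovLimit

/-! ### Elementary inequalities for powers. -/

section Elementary

/-- For `0 ≤ s ≤ r` and `z ≥ 0`, the power `z ^ s` is dominated by `1 + z ^ r`. -/
lemma rpow_le_one_add_rpow {z s r : ℝ} (hz : 0 ≤ z) (hs : 0 ≤ s) (hsr : s ≤ r) :
    z ^ s ≤ 1 + z ^ r := by
  rcases le_total z 1 with h | h
  · have := Real.rpow_le_one hz h hs
    have := Real.rpow_nonneg hz r
    linarith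
  · have := Real.rpow_le_rpow_of_exponent_le h hsr
    linarith

lemma one_add_add_rpow_le {a b r : ℝ} (ha : 0 ≤ a) (hb : 0 ≤ b) (hr : 0 ≤ r) :
    (1 + a + b) ^ r ≤ 3 ^ r * (1 + a ^ r + b ^ r) := by
  have hM : 1 + a + b ≤ 3 * max 1 (max a b) := by
    have h1 := le_max_left 1 (max a b)
    have h2 := (le_max_left a b).trans (le_max_right 1 (max a b))
    have h3 := (le_max_right a b).trans (le_max_right 1 (max a b))
    linarith
  have ha' := Real.rpow_nonneg ha r
  have hb' := Real.rpow_nonneg hb r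
  calc (1 + a + b) ^ r ≤ (3 * max 1 (max a b)) ^ r := by gcongr
    _ = 3 ^ r * (max 1 (max a b)) ^ r := Real.mul_rpow (by norm_num) (by positivity)
    _ ≤ 3 ^ r * (1 + a ^ r + b ^ r) := by
        gcongr
        rcases max_choice 1 (max a b) with h | h
        · rw [h, Real.one_rpow]; linarith
        · rw [h]
          rcases max_choice a b with h' | h' <;> rw [h'] <;> linarith

lemma one_add_rpow_add_rpow_le {a b s : ℝ} (ha : 0 ≤ a) (hb : 0 ≤ b) (hs : 0 ≤ s) :
    1 + a ^ s + b ^ s ≤ 3 * (1 + a + b) ^ s := by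
  have h1 : (1 : ℝ) ^ s ≤ (1 + a + b) ^ s := by gcongr; linarith
  have h2 : a ^ s ≤ (1 + a + b) ^ s := by gcongr; linarith
  have h3 : b ^ s ≤ (1 + a + b) ^ s := by gcongr; linarith
  rw [Real.one_rpow] at h1
  linarith

/-- A pointwise substitute for the Cauchy–Schwarz inequality: once both factors are normalised to
have bounded second moments, losing a constant here is harmless. -/
lemma mul_le_of_sq_le {a b A B : ℝ} (ha : a ^ 2 ≤ A) (hb : b ^ 2 ≤ B) : a * b ≤ A + B := by
  nlinarith [sq_nonneg (a - b), sq_nonneg a, sq_nonneg b]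

end Elementary

/-! ### Locally Hölder functions with polynomial weights. -/

section Holder

variable {E : Type*} [NormedAddCommGroup E]

/-- Local Hölder continuity of order `γ` with a constant that grows polynomially of order `m`. -/
def IsLocHolder (γ m c : ℝ) (F : E → ℝ) : Prop :=
  ∀ x y, |F x - F y| ≤ c * ‖x - y‖ ^ γ * (1 + ‖x‖ + ‖y‖) ^ m

/-- Polynomial growth of order `s`. -/
def HasGrowth (s c : ℝ) (F : E → ℝ) : Prop :=
  ∀ x, |F x| ≤ c * (1 + ‖x‖) ^ s

variable {γ m c : ℝ} {F G : E → ℝ}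

lemma IsLocHolder.continuous (hF : IsLocHolder γ m c F) (hγ : 0 < γ) (hm : 0 ≤ m) :
    Continuous F := by
  rw [continuous_iff_continuousAt]
  intro x
  rw [ContinuousAt, tendsto_iff_norm_sub_tendsto_zero]
  have h : Tendsto (fun y => c * ‖y - x‖ ^ γ * (1 + ‖y‖ + ‖x‖) ^ m) (𝓝 x)
      (𝓝 (c * ‖x - x‖ ^ γ * (1 + ‖x‖ + ‖x‖) ^ m)) := by
    have : Continuous (fun y => c * ‖y - x‖ ^ γ * (1 + ‖y‖ + ‖x‖) ^ m) := by
      refine (continuous_const.mul ?_).mul ?_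
      · exact (by fun_prop : Continuous fun y => ‖y - x‖).rpow_const fun _ => Or.inr hγ.le
      · exact (by fun_prop : Continuous fun y => 1 + ‖y‖ + ‖x‖).rpow_const fun _ => Or.inr hm
    exact this.tendsto x
  rw [sub_self, norm_zero, Real.zero_rpow hγ.ne', mul_zero, zero_mul] at h
  exact squeeze_zero (fun _ => norm_nonneg _) (fun y => hF y x) h

lemma IsLocHolder.mono (hF : IsLocHolder γ m c F) {m' c' : ℝ} (hm : m ≤ m') (hc : c ≤ c')
    (hc' : 0 ≤ c') : IsLocHolder γ m' c' F := fun x y => by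
  refine (hF x y).trans ?_
  have := norm_nonneg x
  have := norm_nonneg y
  gcongr
  linarith

lemma norm_sub_rpow_le (hγ : 0 ≤ γ) (x y : E) : ‖x - y‖ ^ γ ≤ (1 + ‖x‖ + ‖y‖) ^ γ := by
  gcongr
  linarith [norm_sub_le x y]

/-- Comparison with the value at the origin; the factor `‖x‖ ^ γ` raises the order from `m` to `m +
γ`. -/
lemma IsLocHolder.hasGrowth (hF : IsLocHolder γ m c F) (hγ : 0 ≤ γ) (hm : 0 ≤ m) (hc : 0 ≤ c) :
    HasGrowth (m + γ) (|F 0| + c) F := fun x => by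
  have h := hF x 0
  have hx := norm_nonneg x
  have h1 := norm_sub_rpow_le hγ x 0
  rw [norm_zero, add_zero] at h h1
  have h2 : |F x| ≤ |F 0| + |F x - F 0| := by
    have := abs_add_le (F 0) (F x - F 0); simpa using this
  have h3 : c * ‖x - 0‖ ^ γ * (1 + ‖x‖) ^ m ≤ c * (1 + ‖x‖) ^ (m + γ) := by
    rw [add_comm m, Real.rpow_add (by positivity), ← mul_assoc]
    gcongr
  have h4 : (1 : ℝ) ≤ (1 + ‖x‖) ^ (m + γ) :=
    Real.one_le_rpow (by linarith) (by positivity)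
  nlinarith [abs_nonneg (F 0)]

lemma IsLocHolder.sub_const (hF : IsLocHolder γ m c F) (a : ℝ) :
    IsLocHolder γ m c (fun x => F x - a) := fun x y => by simpa using hF x y

lemma IsLocHolder.const_mul (hF : IsLocHolder γ m c F) (a : ℝ) :
    IsLocHolder γ m (|a| * c) (fun x => a * F x) := fun x y => by
  rw [← mul_sub, abs_mul, mul_assoc |a|, mul_assoc |a|]
  gcongr
  exact hF x y

lemma HasGrowth.const_nonneg {s : ℝ} (hF : HasGrowth s c F) : 0 ≤ c := by
  have := (abs_nonneg _).trans (hF 0)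
  simpa using this

lemma HasGrowth.mono {s s' c' : ℝ} (hF : HasGrowth s c F) (hs : s ≤ s') (hc : c ≤ c') :
    HasGrowth s' c' F := fun x => by
  have := hF.const_nonneg
  have := norm_nonneg x
  refine (hF x).trans ?_
  gcongr
  all_goals linarith

lemma HasGrowth.mul {s s' c' : ℝ} (hF : HasGrowth s c F) (hG : HasGrowth s' c' G) :
    HasGrowth (s + s') (c * c') (fun x => F x * G x) := fun x => by
  have h1 := hF x
  have h2 := hG x
  rw [abs_mul, Real.rpow_add (by positivity)]
  calc |F x| * |G x| ≤ (c * (1 + ‖x‖) ^ s) * (c' * (1 + ‖x‖) ^ s') := by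
        gcongr
        exact (abs_nonneg _).trans h1
    _ = _ := by ring

/-- Leibniz splitting, with one factor estimated by its growth; that growth accounts for the extra
`γ` in the order. It is needed for the product of `f - μ(f)` and its corrector. -/
lemma IsLocHolder.mul {m' c' : ℝ} (hF : IsLocHolder γ m c F) (hG : IsLocHolder γ m' c' G)
    (hγ : 0 ≤ γ) (hm : 0 ≤ m) (hm' : 0 ≤ m') (hc : 0 ≤ c) (hc' : 0 ≤ c') :
    IsLocHolder γ (m + m' + γ) ((|F 0| + c) * c' + (|G 0| + c') * c)
      (fun x => F x * G x) := fun x y => by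
  have hx := norm_nonneg x
  have hy := norm_nonneg y
  set U := 1 + ‖x‖ + ‖y‖ with hU
  have hU0 : 0 < U := by positivity
  have g1 : |F x| ≤ (|F 0| + c) * U ^ (m + γ) := (hF.hasGrowth hγ hm hc x).trans (by
    gcongr; linarith)
  have g2 : |G y| ≤ (|G 0| + c') * U ^ (m' + γ) := (hG.hasGrowth hγ hm' hc' y).trans (by
    gcongr; linarith)
  have d1 := hF x y
  have d2 := hG x y
  have hD : 0 ≤ ‖x - y‖ ^ γ := by positivity
  calc |F x * G x - F y * G y| = |F x * (G x - G y) + G y * (F x - F y)| := by ring_nf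
    _ ≤ |F x| * |G x - G y| + |G y| * |F x - F y| := by
        rw [← abs_mul, ← abs_mul]; exact abs_add_le _ _
    _ ≤ ((|F 0| + c) * U ^ (m + γ)) * (c' * ‖x - y‖ ^ γ * U ^ m') +
        ((|G 0| + c') * U ^ (m' + γ)) * (c * ‖x - y‖ ^ γ * U ^ m) := by
        gcongr
    _ = _ := by
        have e1 : U ^ (m + m' + γ) = U ^ (m + γ) * U ^ m' := by
          rw [← Real.rpow_add hU0]; ring_nf
        have e2 : U ^ (m + γ) * U ^ m' = U ^ (m' + γ) * U ^ m := by
          rw [← Real.rpow_add hU0, ← Real.rpow_add hU0]; ring_nf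
        rw [e1]
        linear_combination (-(c * (|G 0| + c') * ‖x - y‖ ^ γ)) * e2

end Holder

/-! ### Moments along the process. -/

section Moments

lemma integrable_and_integral_le_of_lintegral_le {Ω : Type*} {mΩ : MeasurableSpace Ω}
    {P : Measure Ω} {h : Ω → ℝ} (hm : AEStronglyMeasurable h P) (h0 : 0 ≤ h) {A : ℝ} (hA : 0 ≤ A)
    (hle : ∫⁻ ω, ENNReal.ofReal (h ω) ∂P ≤ ENNReal.ofReal A) :
    Integrable h P ∧ ∫ ω, h ω ∂P ≤ A := by
  refine ⟨⟨hm, ?_⟩, ?_⟩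
  · rw [hasFiniteIntegral_iff_ofReal (ae_of_all _ h0)]
    exact hle.trans_lt ENNReal.ofReal_lt_top
  · rw [integral_eq_lintegral_of_nonneg_ae (ae_of_all _ h0) hm]
    exact ENNReal.toReal_le_of_le_ofReal hA hle

variable {E Ω : Type*} [NormedAddCommGroup E] [MeasurableSpace E] [BorelSpace E]
  [TopologicalSpace.SeparableSpace E] [mΩ : MeasurableSpace Ω] {P : Measure Ω}
  [IsProbabilityMeasure P] {ℱ : Filtration ℝ≥0 mΩ} {X : ℝ≥0 → E → Ω → E}
  {r r' L₁ γ₁ β L₂ : ℝ} {ρ : ℝ → ℝ}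

lemma IsTimeHomogeneousMarkov.measurable (hX : IsTimeHomogeneousMarkov P ℱ X) (t : ℝ≥0) (x : E) :
    Measurable (X t x) := (hX.adapted x t).mono (ℱ.le t) le_rfl

lemma MomentBound.integrable_and_le (hM : MomentBound P X r r' L₁)
    (hX : IsTimeHomogeneousMarkov P ℱ X) (t : ℝ≥0) (x : E) :
    Integrable (fun ω => ‖X t x ω‖ ^ r) P ∧
      ∫ ω, ‖X t x ω‖ ^ r ∂P ≤ L₁ * (1 + ‖x‖ ^ (r' * r)) := by
  have hL := hM.pos
  have hr := hM.two_le
  refine integrable_and_integral_le_of_lintegral_le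
    ((hX.measurable t x).norm.pow_const r).aestronglyMeasurable
    (fun ω => by positivity) (by positivity) ?_
  refine (le_of_eq (lintegral_congr fun ω => ?_)).trans (hM.bound x t)
  rw [← ENNReal.ofReal_rpow_of_nonneg (norm_nonneg _) (by linarith), ofReal_norm]

/-- The weight `1 + ‖X_t^x‖ + ‖X_t^y‖` has moments up to order `r`, uniformly in time. -/
lemma MomentBound.exists_weight_le (hM : MomentBound P X r r' L₁)
    (hX : IsTimeHomogeneousMarkov P ℱ X) :
    ∃ C, 0 ≤ C ∧ ∀ (s : ℝ), 0 ≤ s → s ≤ r → ∀ (t : ℝ≥0) (x y : E),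
      Integrable (fun ω => (1 + ‖X t x ω‖ + ‖X t y ω‖) ^ s) P ∧
      ∫ ω, (1 + ‖X t x ω‖ + ‖X t y ω‖) ^ s ∂P ≤ C * (1 + ‖x‖ + ‖y‖) ^ (r' * s) ∧
      ∫ ω, ((1 + ‖X t x ω‖ + ‖X t y ω‖) / (1 + ‖x‖ + ‖y‖) ^ r') ^ s ∂P ≤ C := by
  have hL := hM.pos
  have hr := hM.two_le
  have hr' := hM.one_le
  have hr0 : 0 ≤ r := by linarith
  set C₀ : ℝ := 3 ^ r * (1 + 2 * L₁ + 2 * L₁) with hC₀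
  have hC₀' : 0 ≤ C₀ := by positivity
  refine ⟨1 + C₀, by positivity, fun s hs hsr t x y => ?_⟩
  set W := 1 + ‖x‖ + ‖y‖ with hW
  have hx := norm_nonneg x
  have hy := norm_nonneg y
  have hW1 : 1 ≤ W := by linarith
  have hW0 : 0 < W := by linarith
  set U : Ω → ℝ := fun ω => 1 + ‖X t x ω‖ + ‖X t y ω‖ with hU
  have hU0 : ∀ ω, 0 ≤ U ω := fun ω => by positivity
  have hUm : Measurable U := by
    have := (hX.measurable t x).norm
    have := (hX.measurable t y).norm
    fun_prop
  obtain ⟨ix, bx⟩ := hM.integrable_and_le hX t x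
  obtain ⟨iy, byy⟩ := hM.integrable_and_le hX t y
  have hle : ∀ ω, U ω ^ r ≤ 3 ^ r * (1 + ‖X t x ω‖ ^ r + ‖X t y ω‖ ^ r) := fun ω =>
    one_add_add_rpow_le (norm_nonneg _) (norm_nonneg _) hr0
  have idom : Integrable (fun ω => 3 ^ r * (1 + ‖X t x ω‖ ^ r + ‖X t y ω‖ ^ r)) P :=
    (((integrable_const 1).add ix).add iy).const_mul _
  have iUr : Integrable (fun ω => U ω ^ r) P := by
    refine idom.mono' (hUm.pow_const r).aestronglyMeasurable (ae_of_all _ fun ω => ?_)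
    rw [Real.norm_of_nonneg (Real.rpow_nonneg (hU0 ω) _)]
    exact hle ω
  have hWr : 1 ≤ W ^ (r' * r) := Real.one_le_rpow hW1 (by positivity)
  have hxW : ‖x‖ ^ (r' * r) ≤ W ^ (r' * r) := by gcongr; linarith
  have hyW : ‖y‖ ^ (r' * r) ≤ W ^ (r' * r) := by gcongr; linarith
  have bUr : ∫ ω, U ω ^ r ∂P ≤ C₀ * W ^ (r' * r) := by
    calc ∫ ω, U ω ^ r ∂P ≤ ∫ ω, 3 ^ r * (1 + ‖X t x ω‖ ^ r + ‖X t y ω‖ ^ r) ∂P :=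
          integral_mono iUr idom hle
      _ = 3 ^ r * (1 + ∫ ω, ‖X t x ω‖ ^ r ∂P + ∫ ω, ‖X t y ω‖ ^ r ∂P) := by
          have i1 : Integrable (fun ω => 1 + ‖X t x ω‖ ^ r) P := (integrable_const 1).add ix
          rw [integral_const_mul, integral_add i1 iy, integral_add (integrable_const 1) ix]
          simp
      _ ≤ 3 ^ r * (W ^ (r' * r) + 2 * L₁ * W ^ (r' * r) + 2 * L₁ * W ^ (r' * r)) := by
          gcongr
          · exact bx.trans (by nlinarith)
          · exact byy.trans (by nlinarith)
      _ = C₀ * W ^ (r' * r) := by rw [hC₀]; ring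
  have hWr' : 0 < W ^ r' := by positivity
  -- After normalisation by `W ^ r'` the moment of order `r` is bounded independently of the
  -- starting points, so every lower moment is bounded by one common constant, with no appeal to
  -- Jensen.
  have key : ∀ ω, (U ω / W ^ r') ^ s ≤ 1 + U ω ^ r / W ^ (r' * r) := fun ω => by
    have := rpow_le_one_add_rpow (div_nonneg (hU0 ω) hWr'.le) hs hsr
    rwa [Real.div_rpow (hU0 ω) hWr'.le r, ← Real.rpow_mul hW0.le] at this
  have iq : Integrable (fun ω => 1 + U ω ^ r / W ^ (r' * r)) P :=
    (integrable_const 1).add (iUr.div_const _)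
  have iz : Integrable (fun ω => (U ω / W ^ r') ^ s) P := by
    refine iq.mono' ((hUm.div_const _).pow_const s).aestronglyMeasurable (ae_of_all _ fun ω => ?_)
    rw [Real.norm_of_nonneg (Real.rpow_nonneg (div_nonneg (hU0 ω) hWr'.le) _)]
    exact key ω
  have bz : ∫ ω, (U ω / W ^ r') ^ s ∂P ≤ 1 + C₀ := by
    refine (integral_mono iz iq key).trans ?_
    rw [integral_add (integrable_const 1) (iUr.div_const _), integral_div]
    simp only [integral_const, probReal_univ, smul_eq_mul, one_mul]
    gcongr
    rw [div_le_iff₀ (by positivity)]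
    exact bUr
  have eqz : ∀ ω, U ω ^ s = W ^ (r' * s) * (U ω / W ^ r') ^ s := fun ω => by
    rw [Real.div_rpow (hU0 ω) hWr'.le, ← Real.rpow_mul hW0.le]
    field_simp
  refine ⟨?_, ?_, bz⟩
  · exact (iz.const_mul (W ^ (r' * s))).congr (ae_of_all _ fun ω => (eqz ω).symm)
  · calc ∫ ω, U ω ^ s ∂P = W ^ (r' * s) * ∫ ω, (U ω / W ^ r') ^ s ∂P := by
          rw [← integral_const_mul]; exact integral_congr_ae (ae_of_all _ eqz)
      _ ≤ W ^ (r' * s) * (1 + C₀) := by gcongr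
      _ = _ := by ring

/-- Functions of polynomial growth have moments along the process. -/
lemma MomentBound.exists_growth_le (hM : MomentBound P X r r' L₁)
    (hX : IsTimeHomogeneousMarkov P ℱ X) :
    ∃ C, 0 ≤ C ∧ ∀ (s c : ℝ) (F : E → ℝ), 0 ≤ s → s ≤ r → Measurable F → HasGrowth s c F →
      ∀ (t : ℝ≥0) (x : E), Integrable (fun ω => F (X t x ω)) P ∧
        ∫ ω, |F (X t x ω)| ∂P ≤ C * c * (1 + ‖x‖) ^ (r' * s) := by
  obtain ⟨C, hC, h⟩ := hM.exists_weight_le hX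
  have hr' := hM.one_le
  refine ⟨C * 2 ^ (r' * r), by positivity, fun s c F hs hsr hF hg t x => ?_⟩
  -- The two-point weight is used with equal starting points; this costs only the factor `2 ^ (r' *
  -- r)`.
  obtain ⟨i1, b1, -⟩ := h s hs hsr t x x
  have hc := hg.const_nonneg
  have hle : ∀ ω, |F (X t x ω)| ≤ c * (1 + ‖X t x ω‖ + ‖X t x ω‖) ^ s := fun ω =>
    (hg _).trans (by gcongr; linarith [norm_nonneg (X t x ω)])
  have iF : Integrable (fun ω => F (X t x ω)) P :=
    (i1.const_mul c).mono' (hF.comp (hX.measurable t x)).aestronglyMeasurable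
      (ae_of_all _ hle)
  refine ⟨iF, (integral_mono iF.abs (i1.const_mul c) hle).trans ?_⟩
  rw [integral_const_mul]
  have hx := norm_nonneg x
  calc c * ∫ ω, (1 + ‖X t x ω‖ + ‖X t x ω‖) ^ s ∂P
      ≤ c * (C * (1 + ‖x‖ + ‖x‖) ^ (r' * s)) := by gcongr
    _ ≤ c * (C * (2 * (1 + ‖x‖)) ^ (r' * s)) := by gcongr; linarith
    _ = c * (C * (2 ^ (r' * s) * (1 + ‖x‖) ^ (r' * s))) := by
        rw [Real.mul_rpow (by norm_num) (by positivity)]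
    _ ≤ c * (C * (2 ^ (r' * r) * (1 + ‖x‖) ^ (r' * s))) := by
        gcongr; norm_num
    _ = _ := by ring

end Moments

/-! ### The semigroup contracts Hölder constants. -/

section Smoothing

variable {E Ω : Type*} [NormedAddCommGroup E] [MeasurableSpace E] [BorelSpace E]
  [TopologicalSpace.SeparableSpace E] [mΩ : MeasurableSpace Ω] {P : Measure Ω}
  [IsProbabilityMeasure P] {ℱ : Filtration ℝ≥0 mΩ} {X : ℝ≥0 → E → Ω → E}
  {r r' L₁ γ₁ β L₂ : ℝ} {ρ : ℝ → ℝ}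

lemma Contraction.integrable_and_le (hK : Contraction P X r γ₁ β L₂ ρ)
    (hX : IsTimeHomogeneousMarkov P ℱ X) (t : ℝ≥0) (x y : E) :
    Integrable (fun ω => ‖X t x ω - X t y ω‖ ^ 2) P ∧
      ∫ ω, ‖X t x ω - X t y ω‖ ^ 2 ∂P ≤
        (L₂ * ‖x - y‖ * (1 + ‖x‖ ^ β + ‖y‖ ^ β) * ρ t) ^ 2 := by
  have h0 : 0 ≤ L₂ * ‖x - y‖ * (1 + ‖x‖ ^ β + ‖y‖ ^ β) * ρ t := by
    have := hK.pos
    have := hK.rate_nonneg t t.2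
    positivity
  have hm : Measurable fun ω => X t x ω - X t y ω :=
    (hX.measurable t x).sub (hX.measurable t y)
  refine integrable_and_integral_le_of_lintegral_le
    (hm.norm.pow_const 2).aestronglyMeasurable
    (fun ω => by positivity) (by positivity) ?_
  have h := ENNReal.rpow_le_rpow (hK.bound x y t) (zero_le_two (α := ℝ))
  rw [← ENNReal.rpow_mul, ENNReal.ofReal_rpow_of_nonneg h0 zero_le_two] at h
  norm_num at h
  convert h using 3 with ω
  rw [ENNReal.ofReal_pow (norm_nonneg _), ofReal_norm]

/-- The transition semigroup maps locally Hölder functions to locally Hölder functions, with a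
constant that decays in time. -/
lemma exists_semigroup_isLocHolder (hX : IsTimeHomogeneousMarkov P ℱ X)
    (hM : MomentBound P X r r' L₁) (hK : Contraction P X r γ₁ β L₂ ρ) :
    ∃ C, 0 ≤ C ∧ ∀ (m c : ℝ) (F : E → ℝ), 0 ≤ m → 2 * m ≤ r → m + γ₁ ≤ r → 0 ≤ c →
      IsLocHolder γ₁ m c F → ∀ t : ℝ≥0,
      IsLocHolder γ₁ (β * γ₁ + r' * m) (C * c * ρ t ^ γ₁) (semigroup P X t F) := by
  obtain ⟨C₀, hC₀, hw⟩ := hM.exists_weight_le hX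
  obtain ⟨C₁, hC₁, hg⟩ := hM.exists_growth_le hX
  have hL := hK.pos
  have hβ := hK.beta_mem.1
  obtain ⟨hγ0, hγ1⟩ := hK.exponent_mem
  have hr' := hM.one_le
  refine ⟨(3 + C₀) * (3 * L₂) ^ γ₁, by positivity, fun m c F hm hmr hmr' hc hF t x y => ?_⟩
  have hρ := hK.rate_nonneg t t.2
  have hFm : Measurable F := (hF.continuous hγ0 hm).measurable
  have hFg := hF.hasGrowth hγ0.le hm hc
  obtain ⟨ix, -⟩ := hg _ _ F (by positivity) hmr' hFm hFg t x
  obtain ⟨iy, -⟩ := hg _ _ F (by positivity) hmr' hFm hFg t y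
  obtain ⟨iD, bD⟩ := hK.integrable_and_le hX t x y
  set W := 1 + ‖x‖ + ‖y‖ with hW
  have hx := norm_nonneg x
  have hy := norm_nonneg y
  have hW1 : 1 ≤ W := by linarith
  have hW0 : 0 < W := by linarith
  set D : Ω → ℝ := fun ω => ‖X t x ω - X t y ω‖ with hD
  have hD0 : ∀ ω, 0 ≤ D ω := fun ω => norm_nonneg _
  set U : Ω → ℝ := fun ω => 1 + ‖X t x ω‖ + ‖X t y ω‖ with hU
  have hU0 : ∀ ω, 0 ≤ U ω := fun ω => by positivity
  have hdiff : |semigroup P X t F x - semigroup P X t F y| ≤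
      ∫ ω, |F (X t x ω) - F (X t y ω)| ∂P := by
    rw [semigroup, semigroup, ← integral_sub ix iy]
    exact abs_integral_le_integral_abs
  have ptw : ∀ ω, |F (X t x ω) - F (X t y ω)| ≤ c * D ω ^ γ₁ * U ω ^ m := fun ω => hF _ _
  set δ := L₂ * ‖x - y‖ * (1 + ‖x‖ ^ β + ‖y‖ ^ β) * ρ t with hδ
  have hδ0 : 0 ≤ δ := by positivity
  have main : ∫ ω, |F (X t x ω) - F (X t y ω)| ∂P ≤ c * (3 + C₀) * δ ^ γ₁ * W ^ (r' * m) := by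
    -- When `δ = 0` the two processes agree almost surely at time `t` and the left side vanishes;
    -- otherwise `D` may be normalised by `δ`.
    rcases hδ0.eq_or_lt with hz | hpos
    · have hD2 : ∫ ω, D ω ^ 2 ∂P = 0 := by
        refine le_antisymm ?_ (integral_nonneg fun ω => by positivity)
        rw [← hz] at bD
        simpa using bD
      have hDae : ∀ᵐ ω ∂P, D ω = 0 := by
        filter_upwards [(integral_eq_zero_iff_of_nonneg (fun ω => by positivity) iD).1 hD2]
          with ω hω
        exact pow_eq_zero_iff two_ne_zero |>.1 hω
      have : ∫ ω, |F (X t x ω) - F (X t y ω)| ∂P = 0 := by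
        refine integral_eq_zero_of_ae ?_
        filter_upwards [hDae] with ω hω
        have := ptw ω
        rw [hω, Real.zero_rpow hγ0.ne', mul_zero, zero_mul] at this
        exact le_antisymm this (abs_nonneg _)
      rw [this]
      positivity
    · have hWr' : 0 < W ^ r' := by positivity
      obtain ⟨-, -, bU⟩ := hw (2 * m) (by positivity) hmr t x y
      have iU : Integrable (fun ω => (U ω / W ^ r') ^ (2 * m)) P := by
        have := (hw (2 * m) (by positivity) hmr t x y).1.div_const ((W ^ r') ^ (2 * m))
        refine this.congr (ae_of_all _ fun ω => ?_)
        exact (Real.div_rpow (hU0 ω) hWr'.le _).symm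
      -- Both `D / δ` and `U / W ^ r'` are now of unit size. Separating the factors squares them, so
      -- the weight needs a moment of order `2 * m`, whereas `2 * γ₁ ≤ 2` keeps `D` within its
      -- second moment.
      have ptw2 : ∀ ω, |F (X t x ω) - F (X t y ω)| ≤
          c * δ ^ γ₁ * W ^ (r' * m) *
            (1 + D ω ^ 2 / δ ^ 2 + (U ω / W ^ r') ^ (2 * m)) := fun ω => by
        refine (ptw ω).trans ?_
        have hd : 0 ≤ D ω / δ := div_nonneg (hD0 ω) hδ0
        have hu : 0 ≤ U ω / W ^ r' := div_nonneg (hU0 ω) hWr'.le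
        have e1 : D ω ^ γ₁ = δ ^ γ₁ * (D ω / δ) ^ γ₁ := by
          rw [Real.div_rpow (hD0 ω) hδ0]
          have := Real.rpow_pos_of_pos hpos γ₁
          field_simp
        have e2 : U ω ^ m = W ^ (r' * m) * (U ω / W ^ r') ^ m := by
          rw [Real.div_rpow (hU0 ω) hWr'.le, ← Real.rpow_mul hW0.le]
          field_simp
        have k1 : ((D ω / δ) ^ γ₁) ^ 2 ≤ 1 + D ω ^ 2 / δ ^ 2 := by
          rw [← div_pow, ← Real.rpow_natCast, ← Real.rpow_mul hd, ← Real.rpow_natCast (D ω / δ) 2]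
          exact rpow_le_one_add_rpow hd (by positivity) (by push_cast; linarith)
        have k2 : ((U ω / W ^ r') ^ m) ^ 2 ≤ (U ω / W ^ r') ^ (2 * m) := by
          rw [← Real.rpow_natCast, ← Real.rpow_mul hu, mul_comm m]
          norm_num
        rw [e1, e2]
        calc c * (δ ^ γ₁ * (D ω / δ) ^ γ₁) * (W ^ (r' * m) * (U ω / W ^ r') ^ m)
            = c * δ ^ γ₁ * W ^ (r' * m) * ((D ω / δ) ^ γ₁ * (U ω / W ^ r') ^ m) := by ring
          _ ≤ _ := by
              gcongr
              exact mul_le_of_sq_le k1 k2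
      have iR : Integrable (fun ω => c * δ ^ γ₁ * W ^ (r' * m) *
          (1 + D ω ^ 2 / δ ^ 2 + (U ω / W ^ r') ^ (2 * m))) P :=
        (((integrable_const 1).add (iD.div_const _)).add iU).const_mul _
      refine (integral_mono (ix.sub iy).abs iR ptw2).trans ?_
      have i1 : Integrable (fun ω => 1 + D ω ^ 2 / δ ^ 2) P :=
        (integrable_const 1).add (iD.div_const _)
      rw [integral_const_mul, integral_add i1 iU,
        integral_add (integrable_const 1) (iD.div_const _), integral_div]
      have hq : (∫ ω, D ω ^ 2 ∂P) / δ ^ 2 ≤ 1 := by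
        rw [div_le_one (by positivity)]; exact bD
      simp only [integral_const, probReal_univ, smul_eq_mul, one_mul]
      calc c * δ ^ γ₁ * W ^ (r' * m) * (1 + (∫ ω, D ω ^ 2 ∂P) / δ ^ 2 +
            ∫ ω, (U ω / W ^ r') ^ (2 * m) ∂P)
          ≤ c * δ ^ γ₁ * W ^ (r' * m) * (3 + C₀) := by
            gcongr
            linarith
        _ = _ := by ring
  refine (hdiff.trans main).trans ?_
  have hδle : δ ≤ 3 * L₂ * ‖x - y‖ * W ^ β * ρ t := by
    calc δ ≤ L₂ * ‖x - y‖ * (3 * W ^ β) * ρ t := by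
          rw [hδ]; gcongr; exact one_add_rpow_add_rpow_le hx hy hβ
      _ = _ := by ring
  have hδγ : δ ^ γ₁ ≤ (3 * L₂) ^ γ₁ * ‖x - y‖ ^ γ₁ * W ^ (β * γ₁) * ρ t ^ γ₁ := by
    calc δ ^ γ₁ ≤ (3 * L₂ * ‖x - y‖ * W ^ β * ρ t) ^ γ₁ := by gcongr
      _ = _ := by
        rw [Real.mul_rpow (by positivity) hρ, Real.mul_rpow (by positivity) (by positivity),
          Real.mul_rpow (by positivity) (by positivity), ← Real.rpow_mul hW0.le]
  calc c * (3 + C₀) * δ ^ γ₁ * W ^ (r' * m)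
      ≤ c * (3 + C₀) * ((3 * L₂) ^ γ₁ * ‖x - y‖ ^ γ₁ * W ^ (β * γ₁) * ρ t ^ γ₁) *
          W ^ (r' * m) := by gcongr
    _ = _ := by rw [Real.rpow_add hW0]; ring

end Smoothing

end MarkovLimit

namespace MarkovLimit

/-! ### The Markov property for functions of polynomial growth. -/

section MarkovProperty

variable {E Ω : Type*} [NormedAddCommGroup E] [MeasurableSpace E] [BorelSpace E]
  [TopologicalSpace.SeparableSpace E] [mΩ : MeasurableSpace Ω] {P : Measure Ω}
  [IsProbabilityMeasure P] {ℱ : Filtration ℝ≥0 mΩ} {X : ℝ≥0 → E → Ω → E}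
  {r r' L₁ γ₁ β L₂ : ℝ} {ρ : ℝ → ℝ}

instance (hX : IsTimeHomogeneousMarkov P ℱ X) (t : ℝ≥0) :
    IsMarkovKernel (transitionKernel hX t) :=
  ⟨fun x => Measure.isProbabilityMeasure_map (hX.measurable t x).aemeasurable⟩

lemma semigroup_eq_integral_transitionKernel (hX : IsTimeHomogeneousMarkov P ℱ X) (t : ℝ≥0)
    {F : E → ℝ} (hF : Measurable F) (x : E) :
    semigroup P X t F x = ∫ y, F y ∂(transitionKernel hX t x) := by
  change _ = ∫ y, F y ∂(P.map (X t x))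
  rw [integral_map (hX.measurable t x).aemeasurable hF.aestronglyMeasurable, semigroup]

lemma measurable_semigroup (hX : IsTimeHomogeneousMarkov P ℱ X) (t : ℝ≥0)
    {F : E → ℝ} (hF : Measurable F) : Measurable (semigroup P X t F) := by
  have h : semigroup P X t F = fun x => ∫ y, F y ∂(transitionKernel hX t x) :=
    funext fun x => semigroup_eq_integral_transitionKernel hX t hF x
  rw [h]
  exact hF.stronglyMeasurable.integral_kernel.measurable

lemma abs_semigroup_le (t : ℝ≥0) (F : E → ℝ) (x : E) :
    |semigroup P X t F x| ≤ ∫ ω, |F (X t x ω)| ∂P := abs_integral_le_integral_abs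

/-- The Markov property for functions of polynomial growth. -/
lemma condExp_comp_ae_eq (hX : IsTimeHomogeneousMarkov P ℱ X) (hM : MomentBound P X r r' L₁)
    {s c : ℝ} {F : E → ℝ} (hs : 0 ≤ s) (hsr : r' * s ≤ r) (hF : Measurable F)
    (hg : HasGrowth s c F) (x : E) (τ t : ℝ≥0) :
    P[fun ω => F (X (τ + t) x ω) | ℱ τ] =ᵐ[P] fun ω => semigroup P X t F (X τ x ω) := by
  obtain ⟨C, hC, hgr⟩ := hM.exists_growth_le hX
  have hr' := hM.one_le
  have hsr1 : s ≤ r := by nlinarith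
  have hc := hg.const_nonneg
  -- The Markov property is given for bounded functions only, so `F` is truncated at levels `±n`.
  set φ : ℕ → E → ℝ := fun n u => max (-n) (min n (F u)) with hφ
  have hφm : ∀ n, Measurable (φ n) := fun n => by
    exact measurable_const.max (measurable_const.min hF)
  have hφb : ∀ n u, |φ n u| ≤ n := fun n u => by
    have : (0 : ℝ) ≤ n := n.cast_nonneg
    rw [abs_le]
    exact ⟨le_max_left _ _, max_le (by linarith) (min_le_left _ _)⟩
  have hφF : ∀ n u, |φ n u| ≤ |F u| := fun n u => by
    have h0 : (0 : ℝ) ≤ n := n.cast_nonneg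
    have := neg_abs_le (F u)
    have := le_abs_self (F u)
    have := abs_nonneg (F u)
    rw [abs_le]
    refine ⟨?_, max_le (by linarith) ((min_le_right _ _).trans (by linarith))⟩
    exact le_max_of_le_right (le_min (by linarith) (by linarith))
  have hφt : ∀ u, Tendsto (fun n => φ n u) atTop (𝓝 (F u)) := fun u => by
    refine tendsto_const_nhds.congr' ?_
    obtain ⟨N, hN⟩ := exists_nat_ge |F u|
    filter_upwards [eventually_ge_atTop N] with n hn
    have : (N : ℝ) ≤ n := by exact_mod_cast hn
    obtain ⟨h1, h2⟩ := abs_le.1 (hN.trans this)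
    simp only [hφ]
    rw [min_eq_right h2, max_eq_right h1]
  have iF : ∀ t x, Integrable (fun ω => F (X t x ω)) P := fun t x =>
    (hgr s c F hs hsr1 hF hg t x).1
  have iφ : ∀ n t x, Integrable (fun ω => φ n (X t x ω)) P := fun n t x =>
    (iF t x).mono ((hφm n).comp (hX.measurable t x)).aestronglyMeasurable
      (ae_of_all _ fun ω => hφF n _)
  have hPφ : ∀ n, Measurable[ℱ τ] fun ω => semigroup P X t (φ n) (X τ x ω) := fun n =>
    (measurable_semigroup hX t (hφm n)).comp (hX.adapted x τ)
  have hPF : Measurable[ℱ τ] fun ω => semigroup P X t F (X τ x ω) :=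
    (measurable_semigroup hX t hF).comp (hX.adapted x τ)
  have hPg : HasGrowth (r' * s) (C * c) (semigroup P X t F) := fun u =>
    (abs_semigroup_le t F u).trans (hgr s c F hs hsr1 hF hg t u).2
  -- The dominating function `P_t |F|` has growth of order `r' * s`; its integrability along the
  -- process is what requires `r' * s ≤ r`.
  have hbd : ∀ n u, |semigroup P X t (φ n) u| ≤ ∫ ω, |F (X t u ω)| ∂P := fun n u =>
    (abs_semigroup_le t _ u).trans
      (integral_mono (iφ n t u).abs (iF t u).abs fun ω => hφF n _)
  have hPbm : Measurable (fun u => ∫ ω, |F (X t u ω)| ∂P) :=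
    measurable_semigroup hX t (F := fun y => |F y|) hF.abs
  have hPbg : HasGrowth (r' * s) (C * c) (fun u => ∫ ω, |F (X t u ω)| ∂P) := fun u => by
    rw [abs_of_nonneg (integral_nonneg fun ω => abs_nonneg _)]
    exact (hgr s c F hs hsr1 hF hg t u).2
  have iPb : Integrable (fun ω => ∫ ω', |F (X t (X τ x ω) ω')| ∂P) P :=
    (hgr _ _ (fun u => ∫ ω, |F (X t u ω)| ∂P) (by positivity) hsr hPbm hPbg τ x).1
  have iPφ : ∀ n, Integrable (fun ω => semigroup P X t (φ n) (X τ x ω)) P := fun n =>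
    iPb.mono' ((hPφ n).mono (ℱ.le τ) le_rfl).aestronglyMeasurable
      (ae_of_all _ fun ω => hbd n _)
  have iPF : Integrable (fun ω => semigroup P X t F (X τ x ω)) P :=
    (hgr _ _ _ (by positivity) hsr (measurable_semigroup hX t hF) hPg τ x).1
  have key : P[fun ω => F (X (τ + t) x ω) | ℱ τ] =ᵐ[P]
      P[fun ω => semigroup P X t F (X τ x ω) | ℱ τ] := by
    refine tendsto_condExp_unique (fun n ω => φ n (X (τ + t) x ω))
      (fun n ω => semigroup P X t (φ n) (X τ x ω)) _ _ (fun n => iφ n _ _) iPφ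
      (ae_of_all _ fun ω => hφt _) (ae_of_all _ fun ω => ?_)
      (fun ω => |F (X (τ + t) x ω)|) (iF _ _).abs _ iPb
      (fun n => ae_of_all _ fun ω => hφF n _) (fun n => ae_of_all _ fun ω => hbd n _)
      (fun n => ?_)
    · exact tendsto_integral_of_dominated_convergence (fun ω' => |F (X t (X τ x ω) ω')|)
        (fun n => (iφ n _ _).aestronglyMeasurable) (iF _ _).abs
        (fun n => ae_of_all _ fun ω' => hφF n _) (ae_of_all _ fun ω' => hφt _)
    · refine (hX.markov x τ t (φ n) (hφm n) ⟨n, hφb n⟩).trans ?_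
      rw [condExp_of_stronglyMeasurable (ℱ.le τ) (hPφ n).stronglyMeasurable (iPφ n)]
  refine key.trans ?_
  rw [condExp_of_stronglyMeasurable (ℱ.le τ) hPF.stronglyMeasurable iPF]

/-- The Chapman–Kolmogorov relation. -/
lemma semigroup_add (hX : IsTimeHomogeneousMarkov P ℱ X) (hM : MomentBound P X r r' L₁)
    {s c : ℝ} {F : E → ℝ} (hs : 0 ≤ s) (hsr : r' * s ≤ r) (hF : Measurable F)
    (hg : HasGrowth s c F) (x : E) (τ t : ℝ≥0) :
    semigroup P X (τ + t) F x = semigroup P X τ (semigroup P X t F) x := by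
  rw [semigroup, ← integral_condExp (ℱ.le τ), semigroup]
  exact integral_congr_ae (condExp_comp_ae_eq hX hM hs hsr hF hg x τ t)

/-- The Markov property tested against a random variable depending on the past. -/
lemma integral_mul_comp_eq (hX : IsTimeHomogeneousMarkov P ℱ X) (hM : MomentBound P X r r' L₁)
    {s c : ℝ} {F : E → ℝ} (hs : 0 ≤ s) (hsr : r' * s ≤ r) (hF : Measurable F)
    (hg : HasGrowth s c F) (x : E) (τ t : ℝ≥0) {Y : Ω → ℝ} (hY : AEStronglyMeasurable[ℱ τ] Y P)
    (hYF : Integrable (fun ω => Y ω * F (X (τ + t) x ω)) P) :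
    ∫ ω, Y ω * F (X (τ + t) x ω) ∂P = ∫ ω, Y ω * semigroup P X t F (X τ x ω) ∂P := by
  obtain ⟨C, hC, hgr⟩ := hM.exists_growth_le hX
  have hr' := hM.one_le
  have hsr1 : s ≤ r := by nlinarith
  have h1 := condExp_mul_of_aestronglyMeasurable_left (m := ℱ τ) hY hYF
    (hgr s c F hs hsr1 hF hg (τ + t) x).1
  rw [← integral_condExp (ℱ.le τ)]
  refine integral_congr_ae (h1.trans ?_)
  filter_upwards [condExp_comp_ae_eq hX hM hs hsr hF hg x τ t] with ω hω
  rw [Pi.mul_apply, hω]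

end MarkovProperty

end MarkovLimit

namespace MarkovLimit

/-! ### From uniform Cauchy estimates to tightness. -/

section Tightness

variable {E : Type*} [MetricSpace E] [CompleteSpace E] [SecondCountableTopology E]
  [MeasurableSpace E] [BorelSpace E]

/-- The measures are uniformly Cauchy on bounded Lipschitz functions with given constants. -/
def LipschitzCauchy (μ : ℕ → Measure E) : Prop :=
  ∀ (Λ : ℝ≥0) (ε : ℝ), 0 < ε → ∃ n₀, ∀ n ≥ n₀, ∀ F : E → ℝ, LipschitzWith Λ F →
    (∀ x, |F x| ≤ 1) → |∫ x, F x ∂(μ n) - ∫ x, F x ∂(μ n₀)| ≤ ε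

/-- The measures up to index `n₀` are tight one by one, hence share a compact set. For later indices
the thickened indicator of that set, which is `1/δ`-Lipschitz, transfers the estimate from `μ n₀`.
This spends half of `η` on tightness and half on the Cauchy bound. -/
lemma LipschitzCauchy.exists_cthickening {μ : ℕ → Measure E} [∀ n, IsProbabilityMeasure (μ n)]
    (h : LipschitzCauchy μ) {δ η : ℝ} (hδ : 0 < δ) (hη : 0 < η) :
    ∃ K : Set E, IsCompact K ∧ ∀ n, (μ n) (Metric.cthickening δ K)ᶜ ≤ ENNReal.ofReal η := by
  obtain ⟨n₀, hn₀⟩ := h δ.toNNReal⁻¹ (η / 2) (by positivity)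
  have hK : ∀ n, ∃ K : Set E, IsCompact K ∧ (μ n) Kᶜ ≤ ENNReal.ofReal (η / 2) := fun n => by
    obtain ⟨K, hK, hK'⟩ := isTightMeasureSet_iff_exists_isCompact_measure_compl_le.1
      (isTightMeasureSet_singleton (μ := μ n)) (ENNReal.ofReal (η / 2)) (by simpa using hη)
    exact ⟨K, hK, hK' _ rfl⟩
  choose K hKc hKμ using hK
  set K' : Set E := ⋃ n ∈ Finset.range (n₀ + 1), K n with hK'
  have hK'c : IsCompact K' := (Finset.range (n₀ + 1)).isCompact_biUnion fun n _ => hKc n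
  have hK'μ : ∀ n ≤ n₀, (μ n) K'ᶜ ≤ ENNReal.ofReal (η / 2) := fun n hn => by
    refine (measure_mono (compl_subset_compl.2 ?_)).trans (hKμ n)
    exact subset_biUnion_of_mem (u := fun n => K n) (by simpa using Nat.lt_succ_of_le hn)
  refine ⟨K', hK'c, fun n => ?_⟩
  rcases le_total n n₀ with hn | hn
  · refine (measure_mono (compl_subset_compl.2 (Metric.self_subset_cthickening K'))).trans
      ((hK'μ n hn).trans (ENNReal.ofReal_le_ofReal (by linarith)))
  · set F : E → ℝ := fun x => thickenedIndicator hδ K' x with hF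
    have hFL : LipschitzWith δ.toNNReal⁻¹ F := lipschitzWith_thickenedIndicator hδ K'
    have hF0 : ∀ x, 0 ≤ F x := fun x => NNReal.coe_nonneg _
    have hF1 : ∀ x, F x ≤ 1 := fun x => by
      exact_mod_cast thickenedIndicator_le_one hδ K' x
    have hFi : ∀ n, Integrable F (μ n) := fun n =>
      Integrable.of_bound hFL.continuous.aestronglyMeasurable 1
        (ae_of_all _ fun x => by rw [Real.norm_of_nonneg (hF0 x)]; exact hF1 x)
    have h1 := hn₀ n hn F hFL fun x => by rw [abs_of_nonneg (hF0 x)]; exact hF1 x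
    have h2 : 1 - ∫ x, F x ∂(μ n₀) ≤ η / 2 := by
      have hm : MeasurableSet (closure K')ᶜ := isClosed_closure.measurableSet.compl
      calc 1 - ∫ x, F x ∂(μ n₀) = ∫ x, (1 - F x) ∂(μ n₀) := by
            rw [integral_sub (integrable_const 1) (hFi n₀)]; simp
        _ ≤ ∫ x, (closure K')ᶜ.indicator (fun _ => (1 : ℝ)) x ∂(μ n₀) := by
            refine integral_mono ((integrable_const 1).sub (hFi n₀))
              ((integrable_const 1).indicator hm) fun x => ?_
            by_cases hx : x ∈ closure K'
            · have : F x = 1 := by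
                simp only [hF, thickenedIndicator_one_of_mem_closure hδ K' hx, NNReal.coe_one]
              simp [this, hx]
            · simp [hx, hF0 x]
        _ = (μ n₀).real (closure K')ᶜ := by rw [integral_indicator_const _ hm]; simp
        _ ≤ (μ n₀).real K'ᶜ := measureReal_mono (compl_subset_compl.2 subset_closure)
        _ ≤ η / 2 := ENNReal.toReal_le_of_le_ofReal (by positivity) (hK'μ n₀ le_rfl)
    have h3 : (μ n).real (Metric.cthickening δ K')ᶜ ≤ 1 - ∫ x, F x ∂(μ n) := by
      have hm : MeasurableSet (Metric.cthickening δ K')ᶜ :=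
        Metric.isClosed_cthickening.measurableSet.compl
      calc (μ n).real (Metric.cthickening δ K')ᶜ
          = ∫ x, (Metric.cthickening δ K')ᶜ.indicator (fun _ => (1 : ℝ)) x ∂(μ n) := by
            rw [integral_indicator_const _ hm]; simp
        _ ≤ ∫ x, (1 - F x) ∂(μ n) := by
            refine integral_mono ((integrable_const 1).indicator hm)
              ((integrable_const 1).sub (hFi n)) fun x => ?_
            by_cases hx : x ∈ Metric.cthickening δ K'
            · simp [hx, hF1 x]
            · have hx' : x ∉ Metric.thickening δ K' := fun h' =>
                hx (Metric.thickening_subset_cthickening _ _ h')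
              have : F x = 0 := by
                simp only [hF, thickenedIndicator_zero hδ K' hx', NNReal.coe_zero]
              simp [hx, this]
        _ = 1 - ∫ x, F x ∂(μ n) := by
            rw [integral_sub (integrable_const 1) (hFi n)]; simp
    rw [← ofReal_measureReal]
    refine ENNReal.ofReal_le_ofReal ?_
    have := (abs_le.1 h1).1
    linarith

/-- An intersection of closed thickenings of compact sets, with radii `1/(j+1)`, is closed and
totally bounded, hence compact by completeness. Summable exceptional masses control its complement.
-/
lemma LipschitzCauchy.isTightMeasureSet {μ : ℕ → Measure E} [∀ n, IsProbabilityMeasure (μ n)]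
    (h : LipschitzCauchy μ) : IsTightMeasureSet (range μ) := by
  rw [isTightMeasureSet_iff_exists_isCompact_measure_compl_le]
  intro ε hε
  obtain ⟨ε', hε', hsum⟩ := ENNReal.exists_pos_sum_of_countable hε.ne' ℕ
  have hK : ∀ j : ℕ, ∃ K : Set E, IsCompact K ∧
      ∀ n, (μ n) (Metric.cthickening (1 / (j + 1) : ℝ) K)ᶜ ≤ ENNReal.ofReal (ε' j) := fun j =>
    h.exists_cthickening (by positivity) (by exact_mod_cast hε' j)
  choose K hKc hKμ using hK
  refine ⟨⋂ j : ℕ, Metric.cthickening (1 / (j + 1) : ℝ) (K j), ?_, ?_⟩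
  · refine TotallyBounded.isCompact_of_isClosed ?_
      (isClosed_iInter fun j => Metric.isClosed_cthickening)
    rw [Metric.totallyBounded_iff]
    intro η hη
    obtain ⟨j, hj⟩ := exists_nat_one_div_lt (half_pos hη)
    obtain ⟨N, hN, hcov⟩ := Metric.totallyBounded_iff.1 (hKc j).totallyBounded (η / 2)
      (half_pos hη)
    refine ⟨N, hN, fun x hx => ?_⟩
    have hx' := mem_iInter.1 hx j
    have hx2 := Metric.cthickening_subset_thickening' (half_pos hη) hj (K j) hx'
    obtain ⟨z, hz, hxz⟩ := Metric.mem_thickening_iff.1 hx2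
    obtain ⟨y, hy, hzy⟩ := mem_iUnion₂.1 (hcov hz)
    refine mem_iUnion₂.2 ⟨y, hy, ?_⟩
    rw [Metric.mem_ball] at hzy ⊢
    linarith [dist_triangle x z y]
  · rintro _ ⟨n, rfl⟩
    rw [compl_iInter]
    refine (measure_iUnion_le _).trans ((ENNReal.tsum_le_tsum fun j => hKμ j n).trans ?_)
    simpa using hsum.le

/-- A sequence that is uniformly Cauchy on Lipschitz functions converges weakly along an
ultrafilter. -/
lemma LipschitzCauchy.exists_tendsto_hyperfilter {μ : ℕ → Measure E}
    [hμ : ∀ n, IsProbabilityMeasure (μ n)] (h : LipschitzCauchy μ) :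
    ∃ ν : ProbabilityMeasure E,
      Tendsto (β := ProbabilityMeasure E) (fun n => ⟨μ n, hμ n⟩) (hyperfilter ℕ : Filter ℕ)
        (𝓝 ν) := by
  set S : Set (ProbabilityMeasure E) := range fun n => (⟨μ n, hμ n⟩ : ProbabilityMeasure E)
  have hS : IsTightMeasureSet {((μ : ProbabilityMeasure E) : Measure E) | μ ∈ S} := by
    refine h.isTightMeasureSet.subset ?_
    rintro _ ⟨_, ⟨n, rfl⟩, rfl⟩
    exact ⟨n, rfl⟩
  have hc := isCompact_closure_of_isTightMeasureSet hS
  -- An ultrafilter on a compact set converges, so no subsequence has to be extracted.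
  obtain ⟨ν, -, hν⟩ := hc.ultrafilter_le_nhds
    ((hyperfilter ℕ).map fun n => (⟨μ n, hμ n⟩ : ProbabilityMeasure E)) (by
      rw [le_principal_iff]
      exact mem_map.2 (univ_mem' fun n => subset_closure ⟨n, rfl⟩))
  exact ⟨ν, hν⟩

/-- Bounded Lipschitz functions determine probability measures. -/
lemma eq_of_forall_lipschitz_integral_eq {μ ν : Measure E} [hμ : IsProbabilityMeasure μ]
    [hν : IsProbabilityMeasure ν]
    (h : ∀ F : E → ℝ, (∃ C, ∀ x, |F x| ≤ C) → (∃ Λ, LipschitzWith Λ F) →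
      ∫ x, F x ∂μ = ∫ x, F x ∂ν) : μ = ν := by
  let μ' : ProbabilityMeasure E := ⟨μ, hμ⟩
  let ν' : ProbabilityMeasure E := ⟨ν, hν⟩
  -- The constant sequence `μ` converges weakly to `ν`, and weak limits of probability measures are
  -- unique.
  have ht : Tendsto (fun _ : ℕ => μ') atTop (𝓝 ν') := by
    refine tendsto_iff_forall_lipschitz_integral_tendsto.2 ?_
    rintro F ⟨C, hC⟩ hL
    have hb : ∃ C, ∀ x, |F x| ≤ C := by
      rcases isEmpty_or_nonempty E with hE | ⟨⟨x₀⟩⟩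
      · exact ⟨0, fun x => hE.elim x⟩
      · refine ⟨|F x₀| + C, fun x => ?_⟩
        have h1 := hC x x₀
        rw [Real.dist_eq] at h1
        have h2 := abs_add_le (F x₀) (F x - F x₀)
        rw [add_sub_cancel] at h2
        linarith
    simp only [μ', ν', ProbabilityMeasure.coe_mk, h F hb hL]
    exact tendsto_const_nhds
  have := tendsto_nhds_unique ht tendsto_const_nhds
  exact (congrArg (fun m : ProbabilityMeasure E => (m : Measure E)) this).symm

end Tightness

/-! ### Comparing integrals of `P_t F` against different measures. -/

section Semigroup

variable {E Ω : Type*} [NormedAddCommGroup E] [MeasurableSpace E] [BorelSpace E]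
  [TopologicalSpace.SeparableSpace E] [mΩ : MeasurableSpace Ω] {P : Measure Ω}
  [IsProbabilityMeasure P] {ℱ : Filtration ℝ≥0 mΩ} {X : ℝ≥0 → E → Ω → E}
  {r r' L₁ γ₁ β L₂ : ℝ} {ρ : ℝ → ℝ}

/-- At distances below one the Lipschitz bound suffices since `γ ≤ 1`, and beyond one the
oscillation `2 * C` does. The constant depends only on `Λ` and `C`, which keeps the Cauchy estimate
uniform. -/
lemma isLocHolder_of_lipschitz {F : E → ℝ} {Λ : ℝ≥0} {C γ : ℝ} (hL : LipschitzWith Λ F)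
    (hC : ∀ x, |F x| ≤ C) (hγ0 : 0 < γ) (hγ1 : γ ≤ 1) : IsLocHolder γ 0 (Λ + 2 * C) F := by
  intro x y
  have hC0 : 0 ≤ C := (abs_nonneg _).trans (hC x)
  rw [Real.rpow_zero, mul_one]
  have hn := norm_nonneg (x - y)
  rcases le_total ‖x - y‖ 1 with h | h
  · have h1 : |F x - F y| ≤ Λ * ‖x - y‖ := by
      have := hL.dist_le_mul x y
      rwa [Real.dist_eq, dist_eq_norm] at this
    have h2 : ‖x - y‖ ≤ ‖x - y‖ ^ γ := by
      rcases hn.eq_or_lt with h0 | h0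
      · rw [← h0, Real.zero_rpow hγ0.ne']
      · simpa using Real.rpow_le_rpow_of_exponent_ge h0 h hγ1
    have h3 : 0 ≤ ‖x - y‖ ^ γ := by positivity
    calc |F x - F y| ≤ Λ * ‖x - y‖ ^ γ := h1.trans (by gcongr)
      _ ≤ (Λ + 2 * C) * ‖x - y‖ ^ γ := by gcongr; linarith
  · have h1 : |F x - F y| ≤ 2 * C := (abs_sub _ _).trans (by linarith [hC x, hC y])
    have h2 : 1 ≤ ‖x - y‖ ^ γ := Real.one_le_rpow h hγ0.le
    calc |F x - F y| ≤ (Λ + 2 * C) * 1 := h1.trans (by linarith [Λ.coe_nonneg])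
      _ ≤ _ := by gcongr

/-- The weight is split into a product so that `x` can be integrated out while `y` stays fixed. -/
lemma IsLocHolder.abs_sub_le_mul {γ m c : ℝ} {F : E → ℝ} (hF : IsLocHolder γ m c F)
    (hγ : 0 ≤ γ) (hm : 0 ≤ m) (hc : 0 ≤ c) (x y : E) :
    |F x - F y| ≤ c * (1 + ‖x‖) ^ (m + γ) * (1 + ‖y‖) ^ (m + γ) := by
  have hx := norm_nonneg x
  have hy := norm_nonneg y
  calc |F x - F y| ≤ c * ‖x - y‖ ^ γ * (1 + ‖x‖ + ‖y‖) ^ m := hF x y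
    _ ≤ c * (1 + ‖x‖ + ‖y‖) ^ γ * (1 + ‖x‖ + ‖y‖) ^ m := by
        gcongr; linarith [norm_sub_le x y]
    _ = c * (1 + ‖x‖ + ‖y‖) ^ (m + γ) := by
        rw [mul_assoc, ← Real.rpow_add (by positivity), add_comm γ]
    _ ≤ c * ((1 + ‖x‖) * (1 + ‖y‖)) ^ (m + γ) := by
        gcongr; nlinarith
    _ = _ := by rw [Real.mul_rpow (by positivity) (by positivity), mul_assoc]

/-- Integrability of `ρ ^ γ₁` does not force `ρ → 0`, but it prevents `ρ ^ γ₁` from staying above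
`ε` on a half-line. -/
lemma Contraction.exists_rate_le (hK : Contraction P X r γ₁ β L₂ ρ) (T : ℝ≥0) {ε : ℝ}
    (hε : 0 < ε) : ∃ t : ℝ≥0, T ≤ t ∧ ρ t ^ γ₁ ≤ ε := by
  by_contra! h
  have h1 : IntegrableOn (fun t => ρ t ^ γ₁) (Ioi (T : ℝ)) :=
    hK.rate_integrable.mono_set (Ioi_subset_Ioi T.2)
  have h2 : IntegrableOn (fun _ => ε) (Ioi (T : ℝ)) := by
    refine h1.mono' aestronglyMeasurable_const ?_
    filter_upwards [ae_restrict_mem measurableSet_Ioi] with t ht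
    have h3 : (T : ℝ) ≤ t := (mem_Ioi.1 ht).le
    have h0 : 0 ≤ t := T.2.trans h3
    rw [Real.norm_of_nonneg hε.le]
    have := h ⟨t, h0⟩ (by exact_mod_cast h3)
    exact this.le
  rw [integrableOn_const_iff] at h2
  simp [hε.ne'] at h2

lemma Contraction.rate_rpow_nonneg (hK : Contraction P X r γ₁ β L₂ ρ) (t : ℝ≥0) :
    0 ≤ ρ t ^ γ₁ := Real.rpow_nonneg (hK.rate_nonneg t t.2) _

/-- Integrals of `P_t F` against measures with enough moments are close to each other. -/
lemma exists_semigroup_integral_sub_le (hX : IsTimeHomogeneousMarkov P ℱ X)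
    (hM : MomentBound P X r r' L₁) (hK : Contraction P X r γ₁ β L₂ ρ) :
    ∃ C, 0 ≤ C ∧ ∀ (m c : ℝ) (F : E → ℝ), 0 ≤ m → 2 * m ≤ r → m + γ₁ ≤ r → 0 ≤ c →
      IsLocHolder γ₁ m c F → ∀ (t : ℝ≥0) (ν : Measure E) [IsProbabilityMeasure ν],
      Integrable (fun x => (1 + ‖x‖) ^ (β * γ₁ + r' * m + γ₁)) ν → ∀ y,
      |∫ x, semigroup P X t F x ∂ν - semigroup P X t F y| ≤
        C * c * ρ t ^ γ₁ * (1 + ‖y‖) ^ (β * γ₁ + r' * m + γ₁) *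
          ∫ x, (1 + ‖x‖) ^ (β * γ₁ + r' * m + γ₁) ∂ν := by
  obtain ⟨C, hC, h⟩ := exists_semigroup_isLocHolder hX hM hK
  have hβ := hK.beta_mem.1
  obtain ⟨hγ0, hγ1⟩ := hK.exponent_mem
  have hr' := hM.one_le
  refine ⟨C, hC, fun m c F hm hmr hmr' hc hF t ν _ hν y => ?_⟩
  have hb : 0 ≤ β * γ₁ + r' * m := by positivity
  have hc' : 0 ≤ C * c * ρ t ^ γ₁ := mul_nonneg (by positivity) (hK.rate_rpow_nonneg t)
  have hH := h m c F hm hmr hmr' hc hF t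
  have hm' : Measurable (semigroup P X t F) := (hH.continuous hγ0 hb).measurable
  have hG := hH.hasGrowth hγ0.le hb hc'
  have hi : Integrable (semigroup P X t F) ν :=
    (hν.const_mul _).mono' hm'.aestronglyMeasurable (ae_of_all _ hG)
  calc |∫ x, semigroup P X t F x ∂ν - semigroup P X t F y|
      = |∫ x, (semigroup P X t F x - semigroup P X t F y) ∂ν| := by
        rw [integral_sub hi (integrable_const _)]; simp
    _ ≤ ∫ x, |semigroup P X t F x - semigroup P X t F y| ∂ν := abs_integral_le_integral_abs
    _ ≤ ∫ x, (C * c * ρ t ^ γ₁ * (1 + ‖y‖) ^ (β * γ₁ + r' * m + γ₁)) *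
          (1 + ‖x‖) ^ (β * γ₁ + r' * m + γ₁) ∂ν := by
        refine integral_mono (hi.sub (integrable_const _)).abs (hν.const_mul _) fun x => ?_
        refine (hH.abs_sub_le_mul hγ0.le hb hc' x y).trans (le_of_eq ?_)
        ring
    _ = _ := integral_const_mul _ _

end Semigroup

end MarkovLimit

namespace MarkovLimit

lemma integral_bind_kernel {α β : Type*} {mα : MeasurableSpace α} {mβ : MeasurableSpace β}
    (κ : Kernel α β) (μ : Measure α) {f : β → ℝ} (hf : Integrable f (μ.bind κ)) :
    ∫ y, f y ∂(μ.bind κ) = ∫ x, ∫ y, f y ∂(κ x) ∂μ := by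
  rw [Measure.comp_eq_comp_const_apply] at hf ⊢
  rw [Kernel.integral_comp hf, Kernel.const_apply]

/-! ### Existence, uniqueness and attraction of the invariant measure. -/

section Invariant

variable {E Ω : Type*} [NormedAddCommGroup E] [CompleteSpace E] [MeasurableSpace E] [BorelSpace E]
  [TopologicalSpace.SeparableSpace E] [mΩ : MeasurableSpace Ω] {P : Measure Ω}
  [IsProbabilityMeasure P] {ℱ : Filtration ℝ≥0 mΩ} {X : ℝ≥0 → E → Ω → E}
  {r r' L₁ γ₁ β L₂ : ℝ} {ρ : ℝ → ℝ}

lemma IsInvariant.integral_semigroup {hX : IsTimeHomogeneousMarkov P ℱ X} {μ : Measure E}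
    (hμ : IsInvariant hX μ) (t : ℝ≥0) {F : E → ℝ} (hF : Measurable F) (hi : Integrable F μ) :
    ∫ x, semigroup P X t F x ∂μ = ∫ x, F x ∂μ := by
  have h := (hμ t).def
  rw [← h] at hi
  conv_rhs => rw [← h]
  rw [integral_bind_kernel _ _ hi]
  simp_rw [semigroup_eq_integral_transitionKernel hX t hF]

lemma hasGrowth_zero_of_bounded {F : E → ℝ} {M : ℝ} (h : ∀ x, |F x| ≤ M) : HasGrowth 0 M F :=
  fun x => by simpa using h x

/-- Here `β ≤ r - 1` enters: `(β + 1) γ₁ ≤ β + 1 ≤ r`, so for bounded functions the weight is within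
the available moments. -/
lemma Contraction.exponent_le (hK : Contraction P X r γ₁ β L₂ ρ) :
    β * γ₁ + r' * 0 + γ₁ ≤ r := by
  obtain ⟨hβ, hβr⟩ := hK.beta_mem
  obtain ⟨hγ0, hγ1⟩ := hK.exponent_mem
  nlinarith

lemma integral_map_eq_semigroup (hX : IsTimeHomogeneousMarkov P ℱ X) (t : ℝ≥0) (x : E)
    {F : E → ℝ} (hF : Measurable F) : ∫ y, F y ∂(P.map (X t x)) = semigroup P X t F x :=
  (semigroup_eq_integral_transitionKernel hX t hF x).symm

/-- The laws of the process at two large times, with different initial points, are close. -/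
lemma exists_semigroup_add_sub_le (hX : IsTimeHomogeneousMarkov P ℱ X)
    (hM : MomentBound P X r r' L₁) (hK : Contraction P X r γ₁ β L₂ ρ) :
    ∃ C, 0 ≤ C ∧ ∀ (c M : ℝ) (F : E → ℝ), 0 ≤ c → IsLocHolder γ₁ 0 c F → (∀ x, |F x| ≤ M) →
      ∀ s t : ℝ≥0, |semigroup P X (s + t) F 0 - semigroup P X t F 0| ≤ C * c * ρ t ^ γ₁ := by
  obtain ⟨C, hC, h⟩ := exists_semigroup_integral_sub_le hX hM hK
  obtain ⟨C₁, hC₁, hg⟩ := hM.exists_growth_le hX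
  have hβ := hK.beta_mem.1
  obtain ⟨hγ0, hγ1⟩ := hK.exponent_mem
  have hr' := hM.one_le
  have hr := hM.two_le
  set b := β * γ₁ + r' * 0 + γ₁ with hb
  have hb0 : 0 ≤ b := by positivity
  have hbr : b ≤ r := hK.exponent_le
  refine ⟨C * C₁, by positivity, fun c M F hc hF hFM s t => ?_⟩
  have hFm : Measurable F := (hF.continuous hγ0 le_rfl).measurable
  have hVm : Measurable fun x : E => (1 + ‖x‖) ^ b := by fun_prop
  have hVg : HasGrowth b 1 fun x : E => (1 + ‖x‖) ^ b := fun x => by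
    rw [abs_of_nonneg (by positivity), one_mul]
  obtain ⟨iV, bV⟩ := hg b 1 _ hb0 hbr hVm hVg s 0
  have iV' : Integrable (fun x : E => (1 + ‖x‖) ^ b) (P.map (X s 0)) :=
    (integrable_map_measure hVm.aestronglyMeasurable (hX.measurable s 0).aemeasurable).2 iV
  have : IsProbabilityMeasure (P.map (X s 0)) :=
    Measure.isProbabilityMeasure_map (hX.measurable s 0).aemeasurable
  -- The comparison measure is the law of `X_s^0`; by Chapman–Kolmogorov, integrating `P_t F`
  -- against it gives `P_{s+t} F (0)`.
  have key := h 0 c F le_rfl (by linarith) (by linarith) hc hF t (P.map (X s 0)) iV' 0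
  rw [integral_map_eq_semigroup hX s 0 (measurable_semigroup hX t hFm),
    ← semigroup_add hX hM le_rfl (by simpa using by linarith) hFm
      (hasGrowth_zero_of_bounded hFM)] at key
  refine key.trans ?_
  have hV : ∫ x : E, (1 + ‖x‖) ^ b ∂(P.map (X s 0)) ≤ C₁ := by
    rw [integral_map (hX.measurable s 0).aemeasurable hVm.aestronglyMeasurable]
    refine le_trans (integral_mono iV iV.abs fun ω => le_abs_self _) (bV.trans ?_)
    simp
  have hρ := hK.rate_rpow_nonneg t
  simp only [norm_zero, add_zero, Real.one_rpow, mul_one]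
  calc C * c * ρ t ^ γ₁ * ∫ x : E, (1 + ‖x‖) ^ b ∂(P.map (X s 0))
      ≤ C * c * ρ t ^ γ₁ * C₁ := by gcongr
    _ = _ := by ring

lemma Contraction.exists_seq (hK : Contraction P X r γ₁ β L₂ ρ) :
    ∃ t : ℕ → ℝ≥0, (∀ n : ℕ, (n : ℝ≥0) ≤ t n) ∧ Tendsto (fun n => ρ (t n) ^ γ₁) atTop (𝓝 0) := by
  choose t ht ht' using fun n : ℕ =>
    hK.exists_rate_le (n : ℝ≥0) (ε := 1 / ((n : ℝ) + 1)) (by positivity)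
  exact ⟨t, ht, squeeze_zero (fun n => hK.rate_rpow_nonneg _) ht'
    tendsto_one_div_add_atTop_nhds_zero_nat⟩

/-- A single time `t N` with small rate serves as reference. Since `t k ≥ k`, every index beyond `n₀
≥ t N` gives a later time, whose law is within `ε / 2` of the reference law. -/
lemma lipschitzCauchy_map (hX : IsTimeHomogeneousMarkov P ℱ X)
    (hM : MomentBound P X r r' L₁) (hK : Contraction P X r γ₁ β L₂ ρ) {t : ℕ → ℝ≥0}
    (ht : ∀ n : ℕ, (n : ℝ≥0) ≤ t n) (hρ : Tendsto (fun n => ρ (t n) ^ γ₁) atTop (𝓝 0)) :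
    LipschitzCauchy fun n => P.map (X (t n) (0 : E)) := by
  obtain ⟨C, hC, h⟩ := exists_semigroup_add_sub_le hX hM hK
  obtain ⟨hγ0, hγ1⟩ := hK.exponent_mem
  intro Λ ε hε
  have h1 : Tendsto (fun n => C * (Λ + 2 * 1) * ρ (t n) ^ γ₁) atTop (𝓝 0) := by
    simpa using hρ.const_mul (C * (Λ + 2 * 1))
  obtain ⟨N, hN⟩ := (h1.eventually_lt_const (half_pos hε)).exists
  obtain ⟨n₀, hn₀⟩ := exists_nat_ge (t N)
  refine ⟨n₀, fun n hn F hF hF1 => ?_⟩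
  have hc : (0 : ℝ) ≤ Λ + 2 * 1 := by positivity
  have hH := isLocHolder_of_lipschitz hF hF1 hγ0 hγ1
  have key : ∀ k ≥ n₀, |semigroup P X (t k) F 0 - semigroup P X (t N) F 0| ≤ ε / 2 :=
    fun k hk => by
      have hk' : t N ≤ t k := hn₀.trans ((Nat.cast_le.2 hk).trans (ht k))
      have := h _ 1 F hc hH hF1 (t k - t N) (t N)
      rw [tsub_add_cancel_of_le hk'] at this
      exact this.trans hN.le
  have hm := hF.continuous.measurable
  rw [integral_map_eq_semigroup hX _ _ hm, integral_map_eq_semigroup hX _ _ hm]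
  have e1 := abs_le.1 (key n hn)
  have e2 := abs_le.1 (key n₀ le_rfl)
  rw [abs_le]
  constructor <;> linarith [e1.1, e1.2, e2.1, e2.2]

/-- Existence of an invariant probability measure with a finite moment of order `r`. -/
lemma exists_isInvariant (hX : IsTimeHomogeneousMarkov P ℱ X)
    (hM : MomentBound P X r r' L₁) (hK : Contraction P X r γ₁ β L₂ ρ) :
    ∃ μ : Measure E, IsProbabilityMeasure μ ∧ IsInvariant hX μ ∧
      Integrable (fun x => ‖x‖ ^ r) μ := by
  obtain ⟨t, ht, hρ⟩ := hK.exists_seq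
  obtain ⟨C, hC, h⟩ := exists_semigroup_add_sub_le hX hM hK
  obtain ⟨C₀, hC₀, hH⟩ := exists_semigroup_isLocHolder hX hM hK
  obtain ⟨hγ0, hγ1⟩ := hK.exponent_mem
  have hβ := hK.beta_mem.1
  have hr := hM.two_le
  have hr' := hM.one_le
  have hL := hM.pos
  have : ∀ n, IsProbabilityMeasure (P.map (X (t n) (0 : E))) := fun n =>
    Measure.isProbabilityMeasure_map (hX.measurable _ _).aemeasurable
  obtain ⟨ν, hν⟩ := (lipschitzCauchy_map hX hM hK ht hρ).exists_tendsto_hyperfilter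
  replace hν := ProbabilityMeasure.tendsto_iff_forall_integral_tendsto.1 hν
  have hlim : ∀ (F : E → ℝ) (M : ℝ), Continuous F → (∀ x, |F x| ≤ M) →
      Tendsto (fun n => semigroup P X (t n) F 0) (hyperfilter ℕ : Filter ℕ)
        (𝓝 (∫ x, F x ∂(ν : Measure E))) := fun F M hF hFM => by
    have := hν (BoundedContinuousFunction.ofNormedAddCommGroup F hF M hFM)
    refine this.congr fun n => ?_
    exact integral_map_eq_semigroup hX _ _ hF.measurable
  have hρ' : Tendsto (fun n => ρ (t n) ^ γ₁) (hyperfilter ℕ : Filter ℕ) (𝓝 0) :=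
    hρ.mono_left Nat.hyperfilter_le_atTop
  refine ⟨ν, inferInstance, fun s => ?_, ?_⟩
  · refine eq_of_forall_lipschitz_integral_eq ?_
    rintro F ⟨M, hFM⟩ ⟨Λ, hL⟩
    have hM0 : 0 ≤ M := (abs_nonneg _).trans (hFM 0)
    have hc : 0 ≤ Λ + 2 * M := by positivity
    have hF := isLocHolder_of_lipschitz hL hFM hγ0 hγ1
    have hFm := hL.continuous.measurable
    have hPs : Continuous (semigroup P X s F) :=
      (hH 0 _ F le_rfl (by linarith) (by linarith) hc hF s).continuous hγ0 (by positivity)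
    have hPb : ∀ x, |semigroup P X s F x| ≤ M := fun x => by
      rw [← Real.norm_eq_abs]
      refine (norm_integral_le_of_norm_le_const (ae_of_all _ fun ω => hFM _)).trans ?_
      simp
    have l1 := hlim _ M hPs hPb
    have l2 := hlim F M hL.continuous hFM
    -- Delaying by `s` does not change the limit, whereas writing the delayed value as `P_{t_n}(P_s
    -- F)(0)` identifies it with `ν(P_s F)`; hence `ν(P_s F) = ν(F)`.
    have l3 : Tendsto (fun n => semigroup P X (s + t n) F 0 - semigroup P X (t n) F 0)
        (hyperfilter ℕ : Filter ℕ) (𝓝 0) := by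
      refine squeeze_zero_norm (fun n => h _ M F hc hF hFM s (t n)) ?_
      simpa using hρ'.const_mul (C * (Λ + 2 * M))
    have l4 := l3.add l2
    simp only [sub_add_cancel, zero_add] at l4
    have l5 : Tendsto (fun n => semigroup P X (s + t n) F 0) (hyperfilter ℕ : Filter ℕ)
        (𝓝 (∫ x, semigroup P X s F x ∂(ν : Measure E))) := by
      refine l1.congr fun n => ?_
      rw [add_comm s, semigroup_add hX hM le_rfl (by simpa using by linarith) hFm
        (hasGrowth_zero_of_bounded hFM)]
    have hi : Integrable F ((ν : Measure E).bind (transitionKernel hX s)) :=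
      Integrable.of_bound hFm.aestronglyMeasurable M (ae_of_all _ hFM)
    rw [integral_bind_kernel _ _ hi]
    simp_rw [← semigroup_eq_integral_transitionKernel hX s hFm]
    exact tendsto_nhds_unique l5 l4
  · have hmeas : Measurable fun x : E => ‖x‖ ^ r := by fun_prop
    refine (integrable_and_integral_le_of_lintegral_le (A := 2 * L₁) hmeas.aestronglyMeasurable
      (fun x => by positivity) (by positivity) ?_).1
    -- The moment function is unbounded, so weak convergence is applied to its truncations; monotone
    -- convergence then removes the truncation.
    have hmono : Tendsto (fun n : ℕ => ∫⁻ x : E, ENNReal.ofReal (min n (‖x‖ ^ r)) ∂(ν : Measure E))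
        atTop (𝓝 (∫⁻ x : E, ENNReal.ofReal (‖x‖ ^ r) ∂(ν : Measure E))) := by
      refine lintegral_tendsto_of_tendsto_of_monotone (fun n => ?_) (ae_of_all _ fun x => ?_)
        (ae_of_all _ fun x => ?_)
      · exact ((measurable_const.min hmeas).ennreal_ofReal).aemeasurable
      · intro n k hnk
        have : (n : ℝ) ≤ k := by exact_mod_cast hnk
        exact ENNReal.ofReal_le_ofReal (min_le_min_right _ this)
      · refine tendsto_const_nhds.congr' ?_
        obtain ⟨N, hN⟩ := exists_nat_ge (‖x‖ ^ r)
        filter_upwards [eventually_ge_atTop N] with n hn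
        have : (N : ℝ) ≤ n := by exact_mod_cast hn
        rw [min_eq_right (hN.trans this)]
    refine le_of_tendsto' hmono fun n => ?_
    have hcont : Continuous fun x : E => min (n : ℝ) (‖x‖ ^ r) :=
      continuous_const.min (continuous_norm.rpow_const fun _ => Or.inr (by linarith))
    have hnn : ∀ x : E, 0 ≤ min (n : ℝ) (‖x‖ ^ r) := fun x =>
      le_min n.cast_nonneg (by positivity)
    have hbd : ∀ x : E, |min (n : ℝ) (‖x‖ ^ r)| ≤ n := fun x => by
      rw [abs_of_nonneg (hnn x)]; exact min_le_left _ _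
    have hi : Integrable (fun x : E => min (n : ℝ) (‖x‖ ^ r)) (ν : Measure E) :=
      Integrable.of_bound hcont.aestronglyMeasurable n (ae_of_all _ hbd)
    rw [← ofReal_integral_eq_lintegral_ofReal hi (ae_of_all _ hnn)]
    refine ENNReal.ofReal_le_ofReal (le_of_tendsto' (hlim _ n hcont hbd) fun k => ?_)
    obtain ⟨i1, b1⟩ := hM.integrable_and_le hX (t k) 0
    have hi' : Integrable (fun ω => min (n : ℝ) (‖X (t k) 0 ω‖ ^ r)) P :=
      Integrable.of_bound (hcont.measurable.comp (hX.measurable _ _)).aestronglyMeasurable n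
        (ae_of_all _ fun ω => hbd _)
    calc semigroup P X (t k) (fun x => min (n : ℝ) (‖x‖ ^ r)) 0
        ≤ ∫ ω, ‖X (t k) 0 ω‖ ^ r ∂P := integral_mono hi' i1 fun ω => min_le_right _ _
      _ ≤ L₁ * (1 + ‖(0 : E)‖ ^ (r' * r)) := b1
      _ ≤ 2 * L₁ := by
        rw [norm_zero, Real.zero_rpow (by nlinarith)]; linarith

lemma integrable_weight_rpow {μ : Measure E} [IsProbabilityMeasure μ]
    (h : Integrable (fun x => ‖x‖ ^ r) μ) {s : ℝ} (hs : s ≤ r) (hr : 0 ≤ r) :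
    Integrable (fun x : E => (1 + ‖x‖) ^ s) μ := by
  have hi : Integrable (fun x : E => 3 ^ r * (1 + ‖x‖ ^ r + (0 : ℝ) ^ r)) μ :=
    (((integrable_const 1).add h).add (integrable_const _)).const_mul _
  have hm : Measurable fun x : E => (1 + ‖x‖) ^ s := by fun_prop
  refine hi.mono' hm.aestronglyMeasurable (ae_of_all _ fun x => ?_)
  have hx := norm_nonneg x
  rw [Real.norm_of_nonneg (by positivity)]
  have h1 := one_add_add_rpow_le hx (le_refl (0 : ℝ)) hr
  rw [add_zero] at h1
  exact (Real.rpow_le_rpow_of_exponent_le (by linarith) hs).trans h1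

lemma HasGrowth.integrable {μ : Measure E} {F : E → ℝ} {s c : ℝ} (hg : HasGrowth s c F)
    (hF : Measurable F) (hi : Integrable (fun x : E => (1 + ‖x‖) ^ s) μ) : Integrable F μ :=
  (hi.const_mul c).mono' hF.aestronglyMeasurable (ae_of_all _ hg)

/-- Convergence to equilibrium of `P_t F`, with the integrable rate `ρ ^ γ₁`. -/
lemma exists_semigroup_sub_integral_le (hX : IsTimeHomogeneousMarkov P ℱ X)
    (hM : MomentBound P X r r' L₁) (hK : Contraction P X r γ₁ β L₂ ρ) {μ : Measure E}
    [IsProbabilityMeasure μ] (hμ : IsInvariant hX μ) (hμr : Integrable (fun x => ‖x‖ ^ r) μ) :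
    ∃ C, 0 ≤ C ∧ ∀ (m c : ℝ) (F : E → ℝ), 0 ≤ m → 2 * m ≤ r → m + γ₁ ≤ r →
      β * γ₁ + r' * m + γ₁ ≤ r → 0 ≤ c → IsLocHolder γ₁ m c F → ∀ (t : ℝ≥0) (y : E),
      |semigroup P X t F y - ∫ x, F x ∂μ| ≤
        C * c * ρ t ^ γ₁ * (1 + ‖y‖) ^ (β * γ₁ + r' * m + γ₁) := by
  obtain ⟨C, hC, h⟩ := exists_semigroup_integral_sub_le hX hM hK
  have hr := hM.two_le
  obtain ⟨hγ0, hγ1⟩ := hK.exponent_mem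
  have hI : ∀ s ≤ r, Integrable (fun x : E => (1 + ‖x‖) ^ s) μ := fun s hs =>
    integrable_weight_rpow hμr hs (by linarith)
  set B := ∫ x : E, (1 + ‖x‖) ^ r ∂μ with hB
  have hB0 : 0 ≤ B := integral_nonneg fun x => by positivity
  refine ⟨C * B, by positivity, fun m c F hm hmr hmr' hbr hc hF t y => ?_⟩
  have hFm : Measurable F := (hF.continuous hγ0 hm).measurable
  have hFi : Integrable F μ := (hF.hasGrowth hγ0.le hm hc).integrable hFm (hI _ hmr')
  have key := h m c F hm hmr hmr' hc hF t μ (hI _ hbr) y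
  -- Invariance replaces the `μ`-average of `P_t F` by `μ(F)`.
  rw [hμ.integral_semigroup t hFm hFi, abs_sub_comm] at key
  refine key.trans ?_
  have hρ := hK.rate_rpow_nonneg t
  have : ∫ x : E, (1 + ‖x‖) ^ (β * γ₁ + r' * m + γ₁) ∂μ ≤ B :=
    integral_mono (hI _ hbr) (hI _ le_rfl) fun x =>
      Real.rpow_le_rpow_of_exponent_le (by linarith [norm_nonneg x]) hbr
  calc C * c * ρ t ^ γ₁ * (1 + ‖y‖) ^ (β * γ₁ + r' * m + γ₁) *
        ∫ x : E, (1 + ‖x‖) ^ (β * γ₁ + r' * m + γ₁) ∂μ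
      ≤ C * c * ρ t ^ γ₁ * (1 + ‖y‖) ^ (β * γ₁ + r' * m + γ₁) * B := by gcongr
    _ = _ := by ring

/-- For bounded Lipschitz `F`, `P_{t_n} F → μ(F)` pointwise and boundedly, so `ν(F) = ν(P_{t_n} F) →
μ(F)`. Only `μ` needs moments: the competing measure `ν` is handled by bounded convergence. -/
lemma IsInvariant.unique (hX : IsTimeHomogeneousMarkov P ℱ X)
    (hM : MomentBound P X r r' L₁) (hK : Contraction P X r γ₁ β L₂ ρ) {μ ν : Measure E}
    [IsProbabilityMeasure μ] (hμ : IsInvariant hX μ) (hμr : Integrable (fun x => ‖x‖ ^ r) μ)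
    [IsProbabilityMeasure ν] (hν : IsInvariant hX ν) : ν = μ := by
  obtain ⟨t, ht, hρ⟩ := hK.exists_seq
  obtain ⟨C, hC, h⟩ := exists_semigroup_sub_integral_le hX hM hK hμ hμr
  obtain ⟨hγ0, hγ1⟩ := hK.exponent_mem
  have hr := hM.two_le
  refine eq_of_forall_lipschitz_integral_eq ?_
  rintro F ⟨M, hFM⟩ ⟨Λ, hL⟩
  have hM0 : 0 ≤ M := (abs_nonneg _).trans (hFM 0)
  have hc : 0 ≤ Λ + 2 * M := by positivity
  have hF := isLocHolder_of_lipschitz hL hFM hγ0 hγ1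
  have hFm := hL.continuous.measurable
  have hPb : ∀ t x, |semigroup P X t F x| ≤ M := fun t x => by
    rw [← Real.norm_eq_abs]
    refine (norm_integral_le_of_norm_le_const (ae_of_all _ fun ω => hFM _)).trans ?_
    simp
  have hFi : Integrable F ν := Integrable.of_bound hFm.aestronglyMeasurable M (ae_of_all _ hFM)
  have hlim : Tendsto (fun n => ∫ x, semigroup P X (t n) F x ∂ν) atTop
      (𝓝 (∫ _, (∫ x, F x ∂μ) ∂ν)) := by
    refine tendsto_integral_of_dominated_convergence (fun _ => M)
      (fun n => (measurable_semigroup hX _ hFm).aestronglyMeasurable) (integrable_const _)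
      (fun n => ae_of_all _ (hPb _)) (ae_of_all _ fun y => ?_)
    rw [tendsto_iff_norm_sub_tendsto_zero]
    refine squeeze_zero (fun _ => norm_nonneg _) (fun n => h 0 _ F le_rfl (by linarith)
      (by linarith) hK.exponent_le hc hF (t n) y) ?_
    simpa using (hρ.const_mul (C * (Λ + 2 * M))).mul_const
      ((1 + ‖y‖) ^ (β * γ₁ + r' * 0 + γ₁))
  simp only [hν.integral_semigroup _ hFm hFi, integral_const, probReal_univ, one_smul] at hlim
  exact tendsto_nhds_unique tendsto_const_nhds hlim

end Invariant

end MarkovLimit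

namespace MarkovLimit

/-- A pair of processes such that `G_t + ∫₀ᵗ f_u du` is a martingale with asymptotically linear
quadratic variation `v t`, with uniformly bounded fourth moments. -/
structure ApproxMartingale {Ω : Type*} {mΩ : MeasurableSpace Ω} (P : Measure Ω)
    (ℱ : Filtration ℝ≥0 mΩ) (f G : ℝ → Ω → ℝ) (v B : ℝ) (a : ℝ → ℝ) : Prop where
  measurable_left : Measurable (Function.uncurry f)
  measurable_right : Measurable (Function.uncurry G)
  adapted_left : ∀ t, Measurable[ℱ t.toNNReal] (f t)
  adapted_right : ∀ t, Measurable[ℱ t.toNNReal] (G t)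
  moment_left : ∀ t, Integrable (fun ω => f t ω ^ 4) P ∧ ∫ ω, f t ω ^ 4 ∂P ≤ B
  moment_right : ∀ t, Integrable (fun ω => G t ω ^ 4) P ∧ ∫ ω, G t ω ^ 4 ∂P ≤ B
  martingale : ∀ s e, 0 ≤ s → s ≤ e → ∀ Y : Ω → ℝ, AEStronglyMeasurable[ℱ s.toNNReal] Y P →
    MemLp Y 2 P → ∫ ω, Y ω * G e ω ∂P + ∫ u in s..e, ∫ ω, Y ω * f u ω ∂P = ∫ ω, Y ω * G s ω ∂P
  rate_integrable : IntegrableOn a (Ioi 0)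
  rate_nonneg : ∀ t, 0 ≤ t → 0 ≤ a t
  variation : ∀ s u, 0 ≤ s → s ≤ u → ∀ Y : Ω → ℝ, AEStronglyMeasurable[ℱ s.toNNReal] Y P →
    (∀ ω, |Y ω| ≤ 1) →
    |∫ ω, Y ω * (2 * (f u ω * G u ω)) ∂P - v * ∫ ω, Y ω ∂P| ≤ a (u - s)

/-! ### The corrector and its moment conditions. -/

section Corrector

variable {E Ω : Type*} [NormedAddCommGroup E] [CompleteSpace E] [MeasurableSpace E] [BorelSpace E]
  [TopologicalSpace.SeparableSpace E] [mΩ : MeasurableSpace Ω] {P : Measure Ω}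
  [IsProbabilityMeasure P] {ℱ : Filtration ℝ≥0 mΩ} {X : ℝ≥0 → E → Ω → E}
  {r r' L₁ γ₁ β L₂ : ℝ} {ρ : ℝ → ℝ} {μ : Measure E} {m c : ℝ} {f : E → ℝ}

lemma measurable_process_real (hX : IsTimeHomogeneousMarkov P ℱ X) (x : E) :
    Measurable fun q : ℝ × Ω => X q.1.toNNReal x q.2 :=
  (hX.measurable_process x).comp
    ((measurable_real_toNNReal.comp measurable_fst).prodMk measurable_snd)

lemma measurable_semigroup_time (hX : IsTimeHomogeneousMarkov P ℱ X) (hf : Measurable f) (x : E) :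
    StronglyMeasurable fun t : ℝ => semigroup P X t.toNNReal f x :=
  (hf.comp (measurable_process_real hX x)).stronglyMeasurable.integral_prod_right'

lemma Contraction.rate_integrableOn (hK : Contraction P X r γ₁ β L₂ ρ) :
    IntegrableOn (fun t : ℝ => ρ t.toNNReal ^ γ₁) (Ioi 0) :=
  hK.rate_integrable.congr_fun (fun t ht => by
    simp only [Real.coe_toNNReal t (mem_Ioi.1 ht).le]) measurableSet_Ioi

lemma HasGrowth.pow_four {s : ℝ} (h : HasGrowth s c f) :
    HasGrowth (4 * s) (c ^ 4) (fun x => f x ^ 4) := fun x => by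
  rw [abs_pow, mul_comm 4 s, Real.rpow_mul (by positivity)]
  calc |f x| ^ 4 ≤ (c * (1 + ‖x‖) ^ s) ^ 4 := by gcongr; exact h x
    _ = _ := by rw [mul_pow]; norm_cast

/-- Exponent conditions under which the corrector of a function with local Hölder order `m` has
moments of order four. -/
structure ExponentCondition (r r' γ₁ β m : ℝ) : Prop where
  nonneg : 0 ≤ m
  le : 4 * r' * (β * γ₁ + r' * m + γ₁) ≤ r

/-- The corrector has growth of order `q = β γ₁ + r' m + γ₁`. Fourth moments along the process need
`4 q ≤ r`, and the stronger `4 r' q ≤ r` leaves room for conditioning once more. -/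
lemma ExponentCondition.bounds (he : ExponentCondition r r' γ₁ β m)
    (hM : MomentBound P X r r' L₁) (hK : Contraction P X r γ₁ β L₂ ρ) :
    m + γ₁ ≤ β * γ₁ + r' * m + γ₁ ∧ 4 * (β * γ₁ + r' * m + γ₁) ≤ r ∧
      4 * (r' * (β * γ₁ + r' * m + γ₁)) ≤ r ∧ 0 < γ₁ ∧ 0 ≤ β * γ₁ + r' * m ∧
      β * γ₁ + r' * m + γ₁ ≤ r' * (β * γ₁ + r' * m + γ₁) := by
  obtain ⟨hγ0, hγ1⟩ := hK.exponent_mem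
  have hβ := hK.beta_mem.1
  have hr' := hM.one_le
  have hm := he.nonneg
  have h1 : m ≤ r' * m := by nlinarith
  have h2 : 0 ≤ β * γ₁ := by positivity
  have h3 : 0 ≤ β * γ₁ + r' * m + γ₁ := by positivity
  have h4 : β * γ₁ + r' * m + γ₁ ≤ r' * (β * γ₁ + r' * m + γ₁) := by nlinarith
  have h5 := he.le
  refine ⟨by linarith, by linarith, by linarith, hγ0, by positivity, h4⟩

variable [IsProbabilityMeasure μ]

lemma exists_corrector_integrand_le (hX : IsTimeHomogeneousMarkov P ℱ X)
    (hM : MomentBound P X r r' L₁) (hK : Contraction P X r γ₁ β L₂ ρ) (hμ : IsInvariant hX μ)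
    (hμr : Integrable (fun x => ‖x‖ ^ r) μ) (he : ExponentCondition r r' γ₁ β m)
    (hc : 0 ≤ c) (hf : IsLocHolder γ₁ m c f) :
    ∃ C, 0 ≤ C ∧ ∀ (t : ℝ) (y : E), |semigroup P X t.toNNReal f y - ∫ x, f x ∂μ| ≤
      C * (1 + ‖y‖) ^ (β * γ₁ + r' * m + γ₁) * ρ t.toNNReal ^ γ₁ := by
  obtain ⟨C, hC, h⟩ := exists_semigroup_sub_integral_le hX hM hK hμ hμr
  obtain ⟨h1, h2, h3, h4, h5, h6⟩ := he.bounds hM hK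
  have hm := he.nonneg
  refine ⟨C * c, by positivity, fun t y => (h m c f hm (by linarith) (by linarith) (by linarith)
    hc hf t.toNNReal y).trans (le_of_eq (by ring))⟩

lemma integrableOn_semigroup_sub (hX : IsTimeHomogeneousMarkov P ℱ X)
    (hM : MomentBound P X r r' L₁) (hK : Contraction P X r γ₁ β L₂ ρ) (hμ : IsInvariant hX μ)
    (hμr : Integrable (fun x => ‖x‖ ^ r) μ) (he : ExponentCondition r r' γ₁ β m)
    (hc : 0 ≤ c) (hf : IsLocHolder γ₁ m c f)
    (y : E) :
    IntegrableOn (fun t : ℝ => semigroup P X t.toNNReal f y - ∫ x, f x ∂μ) (Ioi 0) := by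
  obtain ⟨C, hC, h⟩ := exists_corrector_integrand_le hX hM hK hμ hμr he hc hf
  have hfm : Measurable f := (hf.continuous hK.exponent_mem.1 he.nonneg).measurable
  exact (hK.rate_integrableOn.const_mul _).mono'
    ((measurable_semigroup_time hX hfm y).aestronglyMeasurable.sub
      aestronglyMeasurable_const) (ae_of_all _ fun t => h t y)

/-- The corrector is locally Hölder continuous. -/
lemma exists_corrector_isLocHolder (hX : IsTimeHomogeneousMarkov P ℱ X)
    (hM : MomentBound P X r r' L₁) (hK : Contraction P X r γ₁ β L₂ ρ) (hμ : IsInvariant hX μ)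
    (hμr : Integrable (fun x => ‖x‖ ^ r) μ) (he : ExponentCondition r r' γ₁ β m)
    (hc : 0 ≤ c) (hf : IsLocHolder γ₁ m c f) :
    ∃ C, 0 ≤ C ∧ IsLocHolder γ₁ (β * γ₁ + r' * m) C (corrector P X μ f) := by
  obtain ⟨C, hC, h⟩ := exists_semigroup_isLocHolder hX hM hK
  obtain ⟨h1, h2, h3, h4, h5, h6⟩ := he.bounds hM hK
  have hm := he.nonneg
  have hR : 0 ≤ ∫ t : ℝ in Ioi 0, ρ t.toNNReal ^ γ₁ :=
    integral_nonneg fun t => hK.rate_rpow_nonneg _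
  refine ⟨C * c * ∫ t : ℝ in Ioi 0, ρ t.toNNReal ^ γ₁, by positivity, fun x y => ?_⟩
  have ix := integrableOn_semigroup_sub hX hM hK hμ hμr he hc hf x
  have iy := integrableOn_semigroup_sub hX hM hK hμ hμr he hc hf y
  rw [corrector, corrector, ← integral_sub ix iy, ← Real.norm_eq_abs]
  calc ‖∫ t in Ioi (0 : ℝ), (semigroup P X t.toNNReal f x - ∫ y, f y ∂μ -
          (semigroup P X t.toNNReal f y - ∫ y, f y ∂μ))‖
      ≤ ∫ t : ℝ in Ioi 0, (C * c * ‖x - y‖ ^ γ₁ * (1 + ‖x‖ + ‖y‖) ^ (β * γ₁ + r' * m)) *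
          ρ t.toNNReal ^ γ₁ := by
        refine norm_integral_le_of_norm_le (hK.rate_integrableOn.const_mul _)
          (ae_of_all _ fun t => ?_)
        rw [Real.norm_eq_abs, sub_sub_sub_cancel_right]
        refine (h m c f hm (by linarith) (by linarith) hc hf t.toNNReal x y).trans (le_of_eq ?_)
        ring
    _ = _ := by rw [integral_const_mul]; ring

lemma semigroup_sub_const (hX : IsTimeHomogeneousMarkov P ℱ X)
    (hM : MomentBound P X r r' L₁) (hK : Contraction P X r γ₁ β L₂ ρ) (hc : 0 ≤ c)
    (hm : 0 ≤ m) (hmr : m + γ₁ ≤ r) (hf : IsLocHolder γ₁ m c f)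
    (t : ℝ≥0) (b : ℝ) (y : E) :
    semigroup P X t (fun x => f x - b) y = semigroup P X t f y - b := by
  obtain ⟨C₁, hC₁, hg⟩ := hM.exists_growth_le hX
  have hγ := hK.exponent_mem.1
  have hfm : Measurable f := (hf.continuous hγ hm).measurable
  have hfi := (hg _ _ f (by positivity) hmr hfm (hf.hasGrowth hγ.le hm hc) t y).1
  rw [semigroup, integral_sub hfi (integrable_const _)]
  simp [semigroup]

/-- The corrector, tested against a random variable depending on the past. -/
lemma integral_mul_corrector (hX : IsTimeHomogeneousMarkov P ℱ X)
    (hM : MomentBound P X r r' L₁) (hK : Contraction P X r γ₁ β L₂ ρ) (hμ : IsInvariant hX μ)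
    (hμr : Integrable (fun x => ‖x‖ ^ r) μ) (he : ExponentCondition r r' γ₁ β m)
    (hc : 0 ≤ c) (hf : IsLocHolder γ₁ m c f) (x : E) (s : ℝ≥0) {Y : Ω → ℝ}
    (hY : AEStronglyMeasurable[ℱ s] Y P) (hY2 : MemLp Y 2 P) :
    IntegrableOn (fun u : ℝ => ∫ ω, Y ω * (f (X (s + u.toNNReal) x ω) - ∫ y, f y ∂μ) ∂P) (Ioi 0) ∧
    ∫ ω, Y ω * corrector P X μ f (X s x ω) ∂P =
      ∫ u in Ioi (0 : ℝ), ∫ ω, Y ω * (f (X (s + u.toNNReal) x ω) - ∫ y, f y ∂μ) ∂P := by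
  obtain ⟨C, hC, h⟩ := exists_corrector_integrand_le hX hM hK hμ hμr he hc hf
  obtain ⟨C₁, hC₁, hg⟩ := hM.exists_growth_le hX
  obtain ⟨C₂, hC₂, hH⟩ := exists_semigroup_isLocHolder hX hM hK
  obtain ⟨h1, h2, h3, h4, h5, h6⟩ := he.bounds hM hK
  have hm := he.nonneg
  have hγ := hK.exponent_mem.1
  have hr := hM.two_le
  have hr' := hM.one_le
  set q := β * γ₁ + r' * m + γ₁ with hq
  have hq0 : 0 ≤ q := by positivity
  set b := ∫ y, f y ∂μ with hb
  have hfm : Measurable f := (hf.continuous hγ hm).measurable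
  have hF : IsLocHolder γ₁ m c (fun y => f y - b) := hf.sub_const b
  have hFm : Measurable (fun y => f y - b) := hfm.sub_const b
  have hFg := hF.hasGrowth hγ.le hm hc
  have hY0 : AEStronglyMeasurable Y P := hY.mono (ℱ.le s)
  have memL2 : ∀ (t : ℝ≥0) (φ : E → ℝ) (c' s' : ℝ), Measurable φ → 0 ≤ s' → 2 * s' ≤ r →
      HasGrowth s' c' φ → MemLp (fun ω => φ (X t x ω)) 2 P := fun t φ c' s' hφ hs' hs'r hφg => by
    refine (memLp_two_iff_integrable_sq
      (hφ.comp (hX.measurable t x)).aestronglyMeasurable).2 ?_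
    have hφ2 : HasGrowth (s' + s') (c' * c') (fun y => φ y * φ y) := hφg.mul hφg
    have := (hg _ _ _ (by positivity) (by linarith) (hφ.mul hφ) hφ2 t x).1
    exact this.congr (ae_of_all _ fun ω => (sq _).symm)
  -- Joint measurability in space and time comes from the Carathéodory property: continuity in `y`,
  -- measurability in `t`.
  have hcontP : ∀ t : ℝ, Continuous fun y => semigroup P X t.toNNReal f y := fun t =>
    (hH m c f hm (by linarith) (by linarith) hc hf t.toNNReal).continuous hγ h5
  have hjoint : StronglyMeasurable (Function.uncurry fun (y : E) (t : ℝ) =>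
      semigroup P X t.toNNReal f y) :=
    stronglyMeasurable_uncurry_of_continuous_of_stronglyMeasurable hcontP
      fun y => measurable_semigroup_time hX hfm y
  have hjoint' : Measurable fun z : Ω × ℝ => semigroup P X z.2.toNNReal f (X s x z.1) - b :=
    (hjoint.measurable.comp
      (((hX.measurable s x).comp measurable_fst).prodMk measurable_snd)).sub_const b
  have hV2 : MemLp (fun ω => (1 + ‖X s x ω‖) ^ q) 2 P :=
    memL2 s (fun y => (1 + ‖y‖) ^ q) 1 q (by fun_prop) hq0 (by linarith) fun y => by
      rw [abs_of_nonneg (by positivity), one_mul]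
  have hint : Integrable (fun z : Ω × ℝ => Y z.1 * (semigroup P X z.2.toNNReal f (X s x z.1) - b))
      (P.prod (volume.restrict (Ioi 0))) := by
    -- The convergence estimate separates into a product of two square-integrable random variables
    -- and the integrable rate, which justifies Fubini.
    have hdom : Integrable (fun z : Ω × ℝ =>
        (Y z.1 * (C * (1 + ‖X s x z.1‖) ^ q)) * ρ z.2.toNNReal ^ γ₁)
        (P.prod (volume.restrict (Ioi 0))) :=
      Integrable.mul_prod (hY2.integrable_mul (hV2.const_mul C)) hK.rate_integrableOn
    refine hdom.mono (hY0.comp_fst.mul hjoint'.aestronglyMeasurable) (ae_of_all _ fun z => ?_)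
    have hρ := hK.rate_rpow_nonneg z.2.toNNReal
    rw [norm_mul, mul_assoc, norm_mul]
    gcongr
    rw [Real.norm_eq_abs, Real.norm_of_nonneg (by positivity)]
    exact h z.2 _
  have hinner : ∀ t : ℝ, ∫ ω, Y ω * (semigroup P X t.toNNReal f (X s x ω) - b) ∂P =
      ∫ ω, Y ω * (f (X (s + t.toNNReal) x ω) - b) ∂P := fun t => by
    have hY2' : Integrable (fun ω => Y ω * (f (X (s + t.toNNReal) x ω) - b)) P :=
      hY2.integrable_mul (memL2 (s + t.toNNReal) _ _ _ hFm (by positivity) (by linarith) hFg)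
    have := integral_mul_comp_eq hX hM (by positivity) (by nlinarith) hFm hFg x s t.toNNReal hY
      hY2'
    rw [this]
    refine integral_congr_ae (ae_of_all _ fun ω => ?_)
    simp only
    rw [semigroup_sub_const hX hM hK hc hm (by linarith) hf]
  constructor
  · refine hint.integral_prod_right.congr (ae_of_all _ fun t => hinner t)
  · calc ∫ ω, Y ω * corrector P X μ f (X s x ω) ∂P
        = ∫ ω, (∫ t in Ioi (0 : ℝ), Y ω * (semigroup P X t.toNNReal f (X s x ω) - b)) ∂P := by
          refine integral_congr_ae (ae_of_all _ fun ω => ?_)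
          simp only [corrector]
          rw [integral_const_mul]
      _ = ∫ t in Ioi (0 : ℝ), ∫ ω, Y ω * (semigroup P X t.toNNReal f (X s x ω) - b) ∂P :=
          integral_integral_swap hint
      _ = _ := by simp_rw [hinner]

end Corrector

end MarkovLimit

namespace MarkovLimit

lemma setIntegral_Ioi_comp_add_left (g : ℝ → ℝ) (L : ℝ) :
    ∫ u in Ioi 0, g (L + u) = ∫ u in Ioi L, g u := by
  have h := (measurePreserving_add_left volume L).setIntegral_preimage_emb
    (measurableEmbedding_addLeft L) g (Ioi L)
  simpa using h

/-! ### The martingale identity and its quadratic variation. -/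

section Corrector

variable {E Ω : Type*} [NormedAddCommGroup E] [CompleteSpace E] [MeasurableSpace E] [BorelSpace E]
  [TopologicalSpace.SeparableSpace E] [mΩ : MeasurableSpace Ω] {P : Measure Ω}
  [IsProbabilityMeasure P] {ℱ : Filtration ℝ≥0 mΩ} {X : ℝ≥0 → E → Ω → E}
  {r r' L₁ γ₁ β L₂ : ℝ} {ρ : ℝ → ℝ} {μ : Measure E} [IsProbabilityMeasure μ] {m c : ℝ} {f : E → ℝ}

/-- For `Y` known at time `s`, the Markov property turns the mean of `Y` times the corrector at time
`s` into the integral over `(s, ∞)` of the means of `Y (f(X_u) - μ(f))`. The same formula holds at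
time `e`, and the two tails differ by the integral over `[s, e]`. -/
lemma integral_mul_corrector_add (hX : IsTimeHomogeneousMarkov P ℱ X)
    (hM : MomentBound P X r r' L₁) (hK : Contraction P X r γ₁ β L₂ ρ) (hμ : IsInvariant hX μ)
    (hμr : Integrable (fun x => ‖x‖ ^ r) μ) (he : ExponentCondition r r' γ₁ β m)
    (hc : 0 ≤ c) (hf : IsLocHolder γ₁ m c f) (x : E) {s e : ℝ} (hs : 0 ≤ s) (hse : s ≤ e)
    {Y : Ω → ℝ} (hY : AEStronglyMeasurable[ℱ s.toNNReal] Y P) (hY2 : MemLp Y 2 P) :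
    ∫ ω, Y ω * corrector P X μ f (X e.toNNReal x ω) ∂P +
      ∫ u in s..e, ∫ ω, Y ω * (f (X u.toNNReal x ω) - ∫ y, f y ∂μ) ∂P =
    ∫ ω, Y ω * corrector P X μ f (X s.toNNReal x ω) ∂P := by
  set b := ∫ y, f y ∂μ
  set φ : ℝ → ℝ := fun u => ∫ ω, Y ω * (f (X u.toNNReal x ω) - b) ∂P with hφ
  have hYe : AEStronglyMeasurable[ℱ e.toNNReal] Y P :=
    hY.mono (ℱ.mono (Real.toNNReal_le_toNNReal hse))
  obtain ⟨is, hs1⟩ := integral_mul_corrector hX hM hK hμ hμr he hc hf x s.toNNReal hY hY2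
  obtain ⟨-, he1⟩ := integral_mul_corrector hX hM hK hμ hμr he hc hf x e.toNNReal hYe hY2
  have shift : ∀ a : ℝ, 0 ≤ a → EqOn (fun u : ℝ => ∫ ω, Y ω *
      (f (X (a.toNNReal + u.toNNReal) x ω) - b) ∂P) (fun u => φ (a + u)) (Ioi 0) :=
    fun a ha u hu => by
      simp only [hφ]
      rw [Real.toNNReal_add ha (mem_Ioi.1 hu).le]
  rw [hs1, he1, setIntegral_congr_fun measurableSet_Ioi (shift s hs),
    setIntegral_congr_fun measurableSet_Ioi (shift e (hs.trans hse))]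
  have is' : IntegrableOn (fun u => φ (s + u)) (Ioi 0) :=
    is.congr_fun (shift s hs) measurableSet_Ioi
  have h1 : ∫ u in Ioi 0, φ (e + u) = ∫ u in Ioi (e - s), φ (s + u) := by
    rw [← setIntegral_Ioi_comp_add_left (fun u => φ (s + u)) (e - s)]
    refine integral_congr_ae (ae_of_all _ fun u => ?_)
    simp only
    congr 1
    ring
  have h2 : ∫ u in s..e, φ u = ∫ u in (0 : ℝ)..(e - s), φ (s + u) := by
    rw [intervalIntegral.integral_comp_add_left φ s]
    simp
  rw [h1, h2, ← intervalIntegral.integral_Ioi_sub_Ioi is' (by linarith : (0 : ℝ) ≤ e - s)]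
  ring

/-- The drift `K = 2 (f - μ(f)) g` of the squared martingale is itself locally Hölder and has `μ(K)
= v²`. Conditioning at time `s` replaces `K(X_u)` by `P_{u-s} K(X_s)`, to which convergence to
equilibrium applies. -/
lemma exists_integral_mul_variation_le (hX : IsTimeHomogeneousMarkov P ℱ X)
    (hM : MomentBound P X r r' L₁) (hK : Contraction P X r γ₁ β L₂ ρ) (hμ : IsInvariant hX μ)
    (hμr : Integrable (fun x => ‖x‖ ^ r) μ) (he : ExponentCondition r r' γ₁ β m)
    (hc : 0 ≤ c) (hf : IsLocHolder γ₁ m c f) (x : E) :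
    ∃ C, 0 ≤ C ∧ ∀ s u : ℝ, 0 ≤ s → s ≤ u → ∀ Y : Ω → ℝ,
      AEStronglyMeasurable[ℱ s.toNNReal] Y P → (∀ ω, |Y ω| ≤ 1) →
      |∫ ω, Y ω * (2 * ((f (X u.toNNReal x ω) - ∫ y, f y ∂μ) *
        corrector P X μ f (X u.toNNReal x ω))) ∂P - asymptoticVariance P X μ f * ∫ ω, Y ω ∂P| ≤
      C * ρ (u - s).toNNReal ^ γ₁ := by
  obtain ⟨Cg, hCg, hg⟩ := exists_corrector_isLocHolder hX hM hK hμ hμr he hc hf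
  obtain ⟨C, hC, hconv⟩ := exists_semigroup_sub_integral_le hX hM hK hμ hμr
  obtain ⟨C₁, hC₁, hgr⟩ := hM.exists_growth_le hX
  obtain ⟨h1, h2, h3, h4, h5, h6⟩ := he.bounds hM hK
  have hm := he.nonneg
  have hr := hM.two_le
  have hr' := hM.one_le
  have hβ := hK.beta_mem.1
  set q := β * γ₁ + r' * m + γ₁ with hq
  set b := ∫ y, f y ∂μ with hb
  set K : E → ℝ := fun y => 2 * ((f y - b) * corrector P X μ f y) with hKdef
  set m₂ := m + (β * γ₁ + r' * m) + γ₁ with hm₂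
  have hm₂q : m₂ + γ₁ ≤ 2 * q := by linarith
  have hm₂0 : 0 ≤ m₂ := by positivity
  obtain ⟨cK, hcK, hKH⟩ : ∃ cK, 0 ≤ cK ∧ IsLocHolder γ₁ m₂ cK K :=
    ⟨_, by positivity, ((hf.sub_const b).mul hg h4.le hm h5 hc hCg).const_mul 2⟩
  have hKm : Measurable K := (hKH.continuous h4 hm₂0).measurable
  have hKg := hKH.hasGrowth h4.le hm₂0 hcK
  have hv : asymptoticVariance P X μ f = ∫ y, K y ∂μ := by
    simp only [asymptoticVariance, hKdef]
    rw [integral_const_mul]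
  have hr1 : r' * (m₂ + γ₁) ≤ r := by nlinarith
  -- The order after a second application of the semigroup estimate, now to `K`. Since `m₂ ≤ 2 q`,
  -- it is at most `2 r' q + q`, which the exponent condition allows.
  set b₂ := β * γ₁ + r' * m₂ + γ₁ with hb₂
  have hb₂0 : 0 ≤ b₂ := by positivity
  have hb₂r : b₂ ≤ r := by
    have : r' * m₂ ≤ r' * (2 * q) := by gcongr; linarith
    have : 0 ≤ r' * m := by positivity
    linarith
  have hVm : Measurable fun y : E => (1 + ‖y‖) ^ b₂ := by fun_prop
  have hVg : HasGrowth b₂ 1 fun y : E => (1 + ‖y‖) ^ b₂ := fun y => by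
    rw [abs_of_nonneg (by positivity), one_mul]
  refine ⟨C * cK * (C₁ * 1 * (1 + ‖x‖) ^ (r' * b₂)), by positivity, fun s u hs hsu Y hY hY1 => ?_⟩
  set t := (u - s).toNNReal with ht
  have hut : u.toNNReal = s.toNNReal + t := by
    rw [ht, ← Real.toNNReal_add hs (by linarith)]; congr 1; ring
  have hY0 : AEStronglyMeasurable Y P := hY.mono (ℱ.le _)
  have hYi : Integrable Y P := Integrable.of_bound hY0 1 (ae_of_all _ hY1)
  have iK := (hgr _ _ K (by positivity) (by linarith) hKm hKg (s.toNNReal + t) x).1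
  have hYK : Integrable (fun ω => Y ω * K (X (s.toNNReal + t) x ω)) P :=
    iK.bdd_mul hY0 (ae_of_all _ hY1)
  have hPg : ∀ y, |semigroup P X t K y - ∫ y, K y ∂μ| ≤ C * cK * ρ t ^ γ₁ * (1 + ‖y‖) ^ b₂ :=
    hconv m₂ cK K hm₂0 (by linarith) (by linarith) hb₂r hcK hKH t
  obtain ⟨iV, bV⟩ := hgr _ _ _ hb₂0 hb₂r hVm hVg s.toNNReal x
  have hPm : Measurable fun ω => semigroup P X t K (X s.toNNReal x ω) :=
    (measurable_semigroup hX t hKm).comp (hX.measurable _ x)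
  have hρ := hK.rate_rpow_nonneg t
  have iD : Integrable (fun ω => semigroup P X t K (X s.toNNReal x ω) - ∫ y, K y ∂μ) P :=
    (iV.const_mul (C * cK * ρ t ^ γ₁)).mono' (hPm.sub_const _).aestronglyMeasurable
      (ae_of_all _ fun ω => hPg _)
  have iP : Integrable (fun ω => semigroup P X t K (X s.toNNReal x ω)) P :=
    (iD.add (integrable_const (∫ y, K y ∂μ))).congr (ae_of_all _ fun ω => sub_add_cancel _ _)
  have e1 : ∫ ω, Y ω * K (X u.toNNReal x ω) ∂P - (∫ y, K y ∂μ) * ∫ ω, Y ω ∂P =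
      ∫ ω, Y ω * (semigroup P X t K (X s.toNNReal x ω) - ∫ y, K y ∂μ) ∂P := by
    rw [hut, integral_mul_comp_eq hX hM (by positivity) hr1 hKm hKg x s.toNNReal t hY hYK]
    simp_rw [mul_sub]
    rw [integral_sub (iP.bdd_mul hY0 (ae_of_all _ hY1)) (hYi.mul_const _), integral_mul_const,
      mul_comm (∫ y, K y ∂μ)]
  rw [hv]
  change |∫ ω, Y ω * K (X u.toNNReal x ω) ∂P - (∫ y, K y ∂μ) * ∫ ω, Y ω ∂P| ≤ _
  rw [e1, ← Real.norm_eq_abs]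
  calc ‖∫ ω, Y ω * (semigroup P X t K (X s.toNNReal x ω) - ∫ y, K y ∂μ) ∂P‖
      ≤ ∫ ω, C * cK * ρ t ^ γ₁ * (1 + ‖X s.toNNReal x ω‖) ^ b₂ ∂P := by
        refine norm_integral_le_of_norm_le (iV.const_mul _) (ae_of_all _ fun ω => ?_)
        rw [norm_mul]
        calc ‖Y ω‖ * ‖semigroup P X t K (X s.toNNReal x ω) - ∫ y, K y ∂μ‖
            ≤ 1 * (C * cK * ρ t ^ γ₁ * (1 + ‖X s.toNNReal x ω‖) ^ b₂) := by
              gcongr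
              · exact hY1 ω
              · exact hPg _
          _ = _ := one_mul _
    _ = C * cK * ρ t ^ γ₁ * ∫ ω, (1 + ‖X s.toNNReal x ω‖) ^ b₂ ∂P := integral_const_mul _ _
    _ ≤ C * cK * ρ t ^ γ₁ * (C₁ * 1 * (1 + ‖x‖) ^ (r' * b₂)) := by
        gcongr
        exact le_trans (integral_mono iV iV.abs fun ω => le_abs_self _) bV
    _ = _ := by ring

/-- Along the process, the centred function and its corrector form an approximate martingale. -/
lemma exists_approxMartingale (hX : IsTimeHomogeneousMarkov P ℱ X)
    (hM : MomentBound P X r r' L₁) (hK : Contraction P X r γ₁ β L₂ ρ) (hμ : IsInvariant hX μ)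
    (hμr : Integrable (fun x => ‖x‖ ^ r) μ) (he : ExponentCondition r r' γ₁ β m)
    (hc : 0 ≤ c) (hf : IsLocHolder γ₁ m c f) (x : E) :
    ∃ (B : ℝ) (a : ℝ → ℝ), ApproxMartingale P ℱ
      (fun t ω => f (X t.toNNReal x ω) - ∫ y, f y ∂μ)
      (fun t ω => corrector P X μ f (X t.toNNReal x ω)) (asymptoticVariance P X μ f) B a := by
  obtain ⟨Cg, hCg, hg⟩ := exists_corrector_isLocHolder hX hM hK hμ hμr he hc hf
  obtain ⟨C, hC, hvar⟩ := exists_integral_mul_variation_le hX hM hK hμ hμr he hc hf x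
  obtain ⟨C₁, hC₁, hgr⟩ := hM.exists_growth_le hX
  obtain ⟨h1, h2, h3, h4, h5, h6⟩ := he.bounds hM hK
  have hm := he.nonneg
  set b := ∫ y, f y ∂μ with hb
  have hF := hf.sub_const b
  have hFm : Measurable fun y => f y - b := (hF.continuous h4 hm).measurable
  have hgm : Measurable (corrector P X μ f) := (hg.continuous h4 h5).measurable
  have mom : ∀ (φ : E → ℝ) (s' c' : ℝ), Measurable φ → 0 ≤ s' → 4 * s' ≤ r → HasGrowth s' c' φ →
      ∀ t : ℝ, Integrable (fun ω => φ (X t.toNNReal x ω) ^ 4) P ∧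
        ∫ ω, φ (X t.toNNReal x ω) ^ 4 ∂P ≤ C₁ * c' ^ 4 * (1 + ‖x‖) ^ (r' * (4 * s')) :=
    fun φ s' c' hφ hs' hs'r hφg t => by
      obtain ⟨i, bd⟩ := hgr _ _ _ (by positivity) hs'r (hφ.pow_const 4) hφg.pow_four t.toNNReal x
      exact ⟨i, le_trans (integral_mono i i.abs fun ω => le_abs_self _) bd⟩
  obtain ⟨Bf, mf⟩ : ∃ B, ∀ t : ℝ, Integrable (fun ω => (f (X t.toNNReal x ω) - b) ^ 4) P ∧
      ∫ ω, (f (X t.toNNReal x ω) - b) ^ 4 ∂P ≤ B :=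
    ⟨_, mom _ _ _ hFm (by positivity) (by linarith) (hF.hasGrowth h4.le hm hc)⟩
  obtain ⟨Bg, mg⟩ : ∃ B, ∀ t : ℝ,
      Integrable (fun ω => corrector P X μ f (X t.toNNReal x ω) ^ 4) P ∧
      ∫ ω, corrector P X μ f (X t.toNNReal x ω) ^ 4 ∂P ≤ B :=
    ⟨_, mom _ _ _ hgm (by positivity) (by linarith) (hg.hasGrowth h4.le h5 hCg)⟩
  refine ⟨max Bf Bg, fun t => C * ρ t.toNNReal ^ γ₁, ?_⟩
  exact
    { measurable_left := hFm.comp (measurable_process_real hX x)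
      measurable_right := hgm.comp (measurable_process_real hX x)
      adapted_left := fun t => hFm.comp (hX.adapted x _)
      adapted_right := fun t => hgm.comp (hX.adapted x _)
      moment_left := fun t => ⟨(mf t).1, (mf t).2.trans (le_max_left _ _)⟩
      moment_right := fun t => ⟨(mg t).1, (mg t).2.trans (le_max_right _ _)⟩
      martingale := fun s e hs hse Y hY hY2 =>
        integral_mul_corrector_add hX hM hK hμ hμr he hc hf x hs hse hY hY2
      rate_integrable := hK.rate_integrableOn.const_mul C
      rate_nonneg := fun t _ => mul_nonneg hC (hK.rate_rpow_nonneg _)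
      variation := fun s u hs hsu Y hY hY1 => hvar s u hs hsu Y hY hY1 }

end Corrector

end MarkovLimit

namespace MarkovLimit

/-! ### Moments and measurability of path integrals. -/

section PathIntegrals

/-- Jensen's inequality for the fourth power of an integral over a bounded interval. -/
lemma pow_four_intervalIntegral_le {h : ℝ → ℝ} {s e : ℝ} (hse : s ≤ e)
    (hi : IntegrableOn h (Ioc s e)) (hi4 : IntegrableOn (fun u => h u ^ 4) (Ioc s e)) :
    (∫ u in s..e, h u) ^ 4 ≤ (e - s) ^ 3 * ∫ u in s..e, h u ^ 4 := by
  rcases hse.eq_or_lt with rfl | hlt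
  · simp
  have hL : 0 < e - s := sub_pos.2 hlt
  have h0 : (volume : Measure ℝ) (Ioc s e) ≠ 0 := by simp [hlt]
  have hJ := (Even.convexOn_pow (𝕜 := ℝ) (n := 4) (by decide)).map_set_average_le
    (f := h) (μ := volume) (t := Ioc s e) (by fun_prop) isClosed_univ h0 (by simp)
    (ae_of_all _ fun _ => mem_univ _) hi hi4
  rw [setAverage_eq, setAverage_eq] at hJ
  simp only [measureReal_def, Real.volume_Ioc, ENNReal.toReal_ofReal hL.le, smul_eq_mul] at hJ
  rw [intervalIntegral.integral_of_le hse, intervalIntegral.integral_of_le hse]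
  rw [mul_pow, inv_pow, inv_mul_le_iff₀ (by positivity)] at hJ
  refine hJ.trans (le_of_eq ?_)
  rw [← mul_assoc]
  congr 1
  field_simp

/-- The square of an integral as an iterated integral. -/
lemma sq_intervalIntegral_eq {h : ℝ → ℝ} {s e : ℝ} (hse : s ≤ e)
    (hi : IntegrableOn h (Ioc s e)) :
    (∫ u in s..e, h u) ^ 2 = ∫ t in s..e, 2 * (h t * ∫ u in t..e, h u) := by
  set μ : Measure ℝ := volume.restrict (Ioc s e) with hμ
  have hprod : Integrable (fun z : ℝ × ℝ => h z.1 * h z.2) (μ.prod μ) := Integrable.mul_prod hi hi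
  -- The square splits along its diagonal into two triangles. They contribute equally by symmetry;
  -- the diagonal goes with the complement and is negligible.
  have hA : MeasurableSet {z : ℝ × ℝ | z.1 < z.2} := measurableSet_lt measurable_fst measurable_snd
  have iA := hprod.indicator hA
  have iAc := hprod.indicator hA.compl
  have inner1 : ∀ t ∈ Ioc s e, ∫ u, {z : ℝ × ℝ | z.1 < z.2}.indicator
      (fun z => h z.1 * h z.2) (t, u) ∂μ = h t * ∫ u in t..e, h u := fun t ht => by
    have e1 : ∀ u, {z : ℝ × ℝ | z.1 < z.2}.indicator (fun z => h z.1 * h z.2) (t, u) =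
        (Ioi t).indicator (fun u => h t * h u) u := fun u => by
      by_cases hu : t < u <;> simp [hu]
    simp_rw [e1]
    rw [integral_indicator measurableSet_Ioi, integral_const_mul, hμ,
      Measure.restrict_restrict measurableSet_Ioi, intervalIntegral.integral_of_le ht.2]
    congr 3
    ext u
    simp only [mem_inter_iff, mem_Ioi, mem_Ioc]
    exact ⟨fun hu => ⟨hu.1, hu.2.2⟩, fun hu => ⟨hu.1, ht.1.trans hu.1, hu.2⟩⟩
  have inner2 : ∀ t ∈ Ioc s e, ∫ u, {z : ℝ × ℝ | z.1 < z.2}ᶜ.indicator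
      (fun z => h z.1 * h z.2) (u, t) ∂μ = h t * ∫ u in t..e, h u := fun t ht => by
    have e1 : ∀ u, {z : ℝ × ℝ | z.1 < z.2}ᶜ.indicator (fun z => h z.1 * h z.2) (u, t) =
        (Ici t).indicator (fun u => h t * h u) u := fun u => by
      by_cases hu : t ≤ u
      · simp [hu, mul_comm]
      · simp [hu]
    simp_rw [e1]
    rw [integral_indicator measurableSet_Ici, integral_const_mul, hμ,
      Measure.restrict_restrict measurableSet_Ici, intervalIntegral.integral_of_le ht.2]
    congr 1
    have : Ici t ∩ Ioc s e = Icc t e := by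
      ext u
      simp only [mem_inter_iff, mem_Ici, mem_Ioc, mem_Icc]
      exact ⟨fun hu => ⟨hu.1, hu.2.2⟩, fun hu => ⟨hu.1, ht.1.trans_le hu.1, hu.2⟩⟩
    rw [this, integral_Icc_eq_integral_Ioc]
  have hsum : (∫ u, h u ∂μ) ^ 2 =
      ∫ z, {z : ℝ × ℝ | z.1 < z.2}.indicator (fun z => h z.1 * h z.2) z ∂(μ.prod μ) +
      ∫ z, {z : ℝ × ℝ | z.1 < z.2}ᶜ.indicator (fun z => h z.1 * h z.2) z ∂(μ.prod μ) := by
    rw [integral_indicator hA, integral_indicator hA.compl, integral_add_compl hA hprod,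
      integral_prod_mul, sq]
  have hW1 : ∫ z, {z : ℝ × ℝ | z.1 < z.2}.indicator (fun z => h z.1 * h z.2) z ∂(μ.prod μ) =
      ∫ t, h t * (∫ u in t..e, h u) ∂μ := by
    rw [integral_prod _ iA]
    exact setIntegral_congr_fun measurableSet_Ioc inner1
  have hW2 : ∫ z, {z : ℝ × ℝ | z.1 < z.2}ᶜ.indicator (fun z => h z.1 * h z.2) z ∂(μ.prod μ) =
      ∫ t, h t * (∫ u in t..e, h u) ∂μ := by
    rw [integral_prod_symm _ iAc]
    exact setIntegral_congr_fun measurableSet_Ioc inner2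
  rw [intervalIntegral.integral_of_le hse, intervalIntegral.integral_of_le hse,
    integral_const_mul, hsum, hW1, hW2]
  ring

variable {Ω : Type*} {mΩ : MeasurableSpace Ω} {P : Measure Ω} [IsProbabilityMeasure P]

lemma integrable_prod_of_integral_norm_le {H : ℝ → Ω → ℝ} (hH : Measurable (Function.uncurry H))
    {s e C : ℝ} (hi : ∀ t ∈ Ioc s e, Integrable (H t) P)
    (hC : ∀ t ∈ Ioc s e, ∫ ω, ‖H t ω‖ ∂P ≤ C) :
    Integrable (Function.uncurry H) ((volume.restrict (Ioc s e)).prod P) := by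
  rw [integrable_prod_iff hH.aestronglyMeasurable]
  refine ⟨(ae_restrict_mem measurableSet_Ioc).mono fun t ht => hi t ht, ?_⟩
  refine Integrable.of_bound (hH.norm.stronglyMeasurable.integral_prod_right').aestronglyMeasurable
    C ((ae_restrict_mem measurableSet_Ioc).mono fun t ht => ?_)
  rw [Real.norm_of_nonneg (integral_nonneg fun ω => norm_nonneg _)]
  exact hC t ht

lemma sq_le_one_add_pow_four (x : ℝ) : x ^ 2 ≤ 1 + x ^ 4 := by
  nlinarith [sq_nonneg (x ^ 2 - 1), sq_nonneg (x ^ 2)]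

lemma abs_le_one_add_pow_four (x : ℝ) : |x| ≤ 1 + x ^ 4 := by
  rw [abs_le]
  constructor <;> nlinarith [sq_nonneg (x ^ 2 - 1), sq_nonneg (x - 1), sq_nonneg (x + 1),
    sq_nonneg (x ^ 2)]

lemma memLp_two_of_pow_four {Z : Ω → ℝ} (hZ : AEStronglyMeasurable Z P)
    (h4 : Integrable (fun ω => Z ω ^ 4) P) : MemLp Z 2 P := by
  refine (memLp_two_iff_integrable_sq hZ).2 ?_
  refine ((integrable_const 1).add h4).mono' (hZ.pow 2) (ae_of_all _ fun ω => ?_)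
  rw [Real.norm_of_nonneg (sq_nonneg _)]
  exact sq_le_one_add_pow_four _

lemma integral_sq_le_of_pow_four {Z : Ω → ℝ} (hZ : AEStronglyMeasurable Z P)
    (h4 : Integrable (fun ω => Z ω ^ 4) P) {B : ℝ} (hB : ∫ ω, Z ω ^ 4 ∂P ≤ B) :
    ∫ ω, Z ω ^ 2 ∂P ≤ 1 + B := by
  calc ∫ ω, Z ω ^ 2 ∂P ≤ ∫ ω, (1 + Z ω ^ 4) ∂P :=
        integral_mono (memLp_two_of_pow_four hZ h4).integrable_sq
          ((integrable_const 1).add h4) fun ω => sq_le_one_add_pow_four _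
    _ ≤ 1 + B := by
        rw [integral_add (integrable_const 1) h4]
        simpa using hB

lemma MemLp.bdd_mul_two {Y Z : Ω → ℝ} (hZ : MemLp Z 2 P) (hY : AEStronglyMeasurable Y P)
    (hY1 : ∀ ω, |Y ω| ≤ 1) : MemLp (fun ω => Y ω * Z ω) 2 P :=
  hZ.mono (hY.mul hZ.1) (ae_of_all _ fun ω => by
    rw [norm_mul]
    calc ‖Y ω‖ * ‖Z ω‖ ≤ 1 * ‖Z ω‖ := by gcongr; exact hY1 ω
      _ = _ := one_mul _)

lemma integrable_prod_pow_four {f : ℝ → Ω → ℝ} {B : ℝ} (hf : Measurable (Function.uncurry f))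
    (hB : ∀ t, Integrable (fun ω => f t ω ^ 4) P ∧ ∫ ω, f t ω ^ 4 ∂P ≤ B) (s e : ℝ) :
    Integrable (fun z : ℝ × Ω => f z.1 z.2 ^ 4) ((volume.restrict (Ioc s e)).prod P) :=
  integrable_prod_of_integral_norm_le (H := fun t ω => f t ω ^ 4) (C := B)
    (hf.pow_const 4) (fun t _ => (hB t).1) fun t _ =>
      (integral_congr_ae (ae_of_all _ fun ω => Real.norm_of_nonneg (by positivity))).trans_le
        (hB t).2

lemma integrable_prod_of_pow_four {f : ℝ → Ω → ℝ} {B : ℝ} (hf : Measurable (Function.uncurry f))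
    (hB : ∀ t, Integrable (fun ω => f t ω ^ 4) P ∧ ∫ ω, f t ω ^ 4 ∂P ≤ B) (s e : ℝ) :
    Integrable (fun z : ℝ × Ω => f z.1 z.2) ((volume.restrict (Ioc s e)).prod P) :=
  ((integrable_const 1).add (integrable_prod_pow_four hf hB s e)).mono'
    hf.aestronglyMeasurable (ae_of_all _ fun _ => abs_le_one_add_pow_four _)

lemma measurable_intervalIntegral {f : ℝ → Ω → ℝ} (hf : Measurable (Function.uncurry f))
    (s e : ℝ) : Measurable fun ω => ∫ u in s..e, f u ω := by
  simp only [intervalIntegral]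
  exact (hf.stronglyMeasurable.integral_prod_left).measurable.sub
    (hf.stronglyMeasurable.integral_prod_left).measurable

/-- Fourth moments of path integrals. -/
lemma intervalIntegral_pow_four_le {f : ℝ → Ω → ℝ} {B : ℝ} (hf : Measurable (Function.uncurry f))
    (hB : ∀ t, Integrable (fun ω => f t ω ^ 4) P ∧ ∫ ω, f t ω ^ 4 ∂P ≤ B) {s e : ℝ}
    (hse : s ≤ e) :
    Integrable (fun ω => (∫ u in s..e, f u ω) ^ 4) P ∧
      ∫ ω, (∫ u in s..e, f u ω) ^ 4 ∂P ≤ B * (e - s) ^ 4 := by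
  have hL : 0 ≤ e - s := sub_nonneg.2 hse
  have i4 := integrable_prod_pow_four hf hB s e
  have ii : Integrable (fun ω => (e - s) ^ 3 * ∫ u in s..e, f u ω ^ 4) P := by
    refine Integrable.const_mul ?_ _
    simp_rw [intervalIntegral.integral_of_le hse]
    exact i4.integral_prod_right
  have hle : ∀ᵐ ω ∂P, (∫ u in s..e, f u ω) ^ 4 ≤ (e - s) ^ 3 * ∫ u in s..e, f u ω ^ 4 := by
    filter_upwards [i4.prod_left_ae,
      (integrable_prod_of_pow_four hf hB s e).prod_left_ae] with ω h4 h1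
    exact pow_four_intervalIntegral_le hse h1 h4
  have i1 : Integrable (fun ω => (∫ u in s..e, f u ω) ^ 4) P := by
    refine ii.mono' ((measurable_intervalIntegral hf s e).pow_const 4).aestronglyMeasurable ?_
    filter_upwards [hle] with ω hω
    rwa [Real.norm_of_nonneg (by positivity)]
  refine ⟨i1, (integral_mono_ae i1 ii hle).trans ?_⟩
  rw [integral_const_mul]
  simp_rw [intervalIntegral.integral_of_le hse]
  rw [← integral_integral_swap (f := fun u ω => f u ω ^ 4) i4]
  have hb : ∫ u in Ioc s e, ∫ ω, f u ω ^ 4 ∂P ≤ ∫ u in Ioc s e, B :=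
    integral_mono i4.integral_prod_left (integrable_const _) fun u => (hB u).2
  simp only [integral_const, measureReal_restrict_apply_univ, Real.volume_real_Ioc_of_le hse,
    smul_eq_mul] at hb
  calc (e - s) ^ 3 * ∫ u in Ioc s e, ∫ ω, f u ω ^ 4 ∂P ≤ (e - s) ^ 3 * ((e - s) * B) := by
        gcongr
    _ = _ := by ring

end PathIntegrals

/-! ### Increments of the approximating martingale. -/

namespace ApproxMartingale

variable {Ω : Type*} {mΩ : MeasurableSpace Ω} {P : Measure Ω} [IsProbabilityMeasure P]
  {ℱ : Filtration ℝ≥0 mΩ} {f G : ℝ → Ω → ℝ} {v B : ℝ} {a : ℝ → ℝ}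

section
variable (h : ApproxMartingale P ℱ f G v B a)
include h

lemma aesm_left (t : ℝ) : AEStronglyMeasurable (f t) P :=
  ((h.adapted_left t).mono (ℱ.le _) le_rfl).aestronglyMeasurable

lemma aesm_right (t : ℝ) : AEStronglyMeasurable (G t) P :=
  ((h.adapted_right t).mono (ℱ.le _) le_rfl).aestronglyMeasurable

lemma bound_nonneg : 0 ≤ B :=
  (integral_nonneg fun ω => by positivity).trans (h.moment_left 0).2

lemma memLp_left (t : ℝ) : MemLp (f t) 2 P :=
  memLp_two_of_pow_four (h.aesm_left t) (h.moment_left t).1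

lemma memLp_right (t : ℝ) : MemLp (G t) 2 P :=
  memLp_two_of_pow_four (h.aesm_right t) (h.moment_right t).1

lemma integrable_left_sq (s e : ℝ) :
    Integrable (fun z : ℝ × Ω => f z.1 z.2 ^ 2) ((volume.restrict (Ioc s e)).prod P) :=
  ((integrable_const 1).add (integrable_prod_pow_four h.measurable_left h.moment_left s e)).mono'
    (h.measurable_left.pow_const 2).aestronglyMeasurable (ae_of_all _ fun _ => by
      rw [Real.norm_of_nonneg (sq_nonneg _)]
      exact sq_le_one_add_pow_four _)

lemma integrable_mul_left {Z : Ω → ℝ} (hZ : MemLp Z 2 P) (s e : ℝ) :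
    Integrable (fun z : ℝ × Ω => Z z.2 * f z.1 z.2) ((volume.restrict (Ioc s e)).prod P) := by
  have h1 : Integrable (fun z : ℝ × Ω => Z z.2 ^ 2) ((volume.restrict (Ioc s e)).prod P) :=
    hZ.integrable_sq.comp_snd _
  refine (h1.add (h.integrable_left_sq s e)).mono'
    (hZ.1.comp_snd.mul h.measurable_left.aestronglyMeasurable) (ae_of_all _ fun z => ?_)
  rw [norm_mul]
  exact mul_le_of_sq_le (by rw [Real.norm_eq_abs, sq_abs]) (by
    rw [Real.norm_eq_abs, sq_abs])

lemma measurable_integral (s e : ℝ) : Measurable fun ω => ∫ u in s..e, f u ω :=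
  measurable_intervalIntegral h.measurable_left s e

lemma integral_pow_four {s e : ℝ} (hse : s ≤ e) :
    Integrable (fun ω => (∫ u in s..e, f u ω) ^ 4) P ∧
      ∫ ω, (∫ u in s..e, f u ω) ^ 4 ∂P ≤ B * (e - s) ^ 4 :=
  intervalIntegral_pow_four_le h.measurable_left h.moment_left hse

lemma memLp_integral {s e : ℝ} (hse : s ≤ e) : MemLp (fun ω => ∫ u in s..e, f u ω) 2 P :=
  memLp_two_of_pow_four (h.measurable_integral s e).aestronglyMeasurable
    (h.integral_pow_four hse).1

lemma integral_mul_integral {s e : ℝ} (hse : s ≤ e) {Z : Ω → ℝ} (hZ : MemLp Z 2 P) :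
    ∫ ω, Z ω * (∫ u in s..e, f u ω) ∂P = ∫ u in s..e, ∫ ω, Z ω * f u ω ∂P := by
  simp_rw [intervalIntegral.integral_of_le hse, ← integral_const_mul]
  exact (integral_integral_swap (f := fun u ω => Z ω * f u ω) (h.integrable_mul_left hZ s e)).symm

/-- The integral of an adapted, jointly measurable process is measurable with respect to the past,
up to a null set. -/
lemma aesm_integral {s e : ℝ} (hse : s ≤ e) :
    AEStronglyMeasurable[ℱ e.toNNReal] (fun ω => ∫ u in s..e, f u ω) P := by
  set I : Ω → ℝ := fun ω => ∫ u in s..e, f u ω with hI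
  have hI2 : MemLp I 2 P := h.memLp_integral hse
  set J : Ω → ℝ := P[I | ℱ e.toNNReal] with hJ
  have hJ2 : MemLp J 2 P := hI2.condExp one_le_two
  have hJm : AEStronglyMeasurable[ℱ e.toNNReal] J P :=
    stronglyMeasurable_condExp.aestronglyMeasurable
  -- No progressive measurability is assumed. The residual `I - J` is orthogonal to every
  -- square-integrable variable known at time `e`, in particular to each `f u` with `u ≤ e`, hence
  -- to their integral `I`. It is also orthogonal to `J`, so it vanishes.
  have horth : ∀ W : Ω → ℝ, AEStronglyMeasurable[ℱ e.toNNReal] W P → MemLp W 2 P →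
      ∫ ω, W ω * (I ω - J ω) ∂P = 0 := fun W hW hW2 => by
    have iI : Integrable (fun ω => W ω * I ω) P := hW2.integrable_mul hI2
    have iJ : Integrable (fun ω => W ω * J ω) P := hW2.integrable_mul hJ2
    simp_rw [mul_sub]
    rw [integral_sub iI iJ, sub_eq_zero, ← integral_condExp (ℱ.le e.toNNReal)]
    exact integral_congr_ae (condExp_mul_of_aestronglyMeasurable_left hW iI
      (hI2.integrable one_le_two))
  have hZ2 : MemLp (fun ω => I ω - J ω) 2 P := hI2.sub hJ2
  have hzero : ∫ ω, (I ω - J ω) ^ 2 ∂P = 0 := by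
    have e1 : ∫ ω, (I ω - J ω) * I ω ∂P = 0 := by
      rw [h.integral_mul_integral hse hZ2, intervalIntegral.integral_of_le hse]
      refine setIntegral_eq_zero_of_forall_eq_zero fun u hu => ?_
      have := horth (f u) (((h.adapted_left u).mono
        (ℱ.mono (Real.toNNReal_le_toNNReal hu.2)) le_rfl).stronglyMeasurable.aestronglyMeasurable)
        (h.memLp_left u)
      simpa only [mul_comm] using this
    have e2 := horth J hJm hJ2
    have iI : Integrable (fun ω => (I ω - J ω) * I ω) P := hZ2.integrable_mul hI2
    have iJ : Integrable (fun ω => J ω * (I ω - J ω)) P := hJ2.integrable_mul hZ2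
    calc ∫ ω, (I ω - J ω) ^ 2 ∂P = ∫ ω, ((I ω - J ω) * I ω - J ω * (I ω - J ω)) ∂P := by
          congr 1; ext ω; ring
      _ = 0 := by rw [integral_sub iI iJ, e1, e2, sub_zero]
  have hae : I =ᵐ[P] J := by
    filter_upwards [(integral_eq_zero_iff_of_nonneg (fun ω => sq_nonneg _)
      hZ2.integrable_sq).1 hzero] with ω hω
    exact sub_eq_zero.1 (pow_eq_zero_iff two_ne_zero |>.1 hω)
  exact hJm.congr hae.symm

end

/-- The increment over `[s, e]` of the approximating martingale. -/
noncomputable def increment (f G : ℝ → Ω → ℝ) (s e : ℝ) (ω : Ω) : ℝ :=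
  G e ω - G s ω + ∫ u in s..e, f u ω

section
variable (h : ApproxMartingale P ℱ f G v B a)
include h

lemma aesm_increment {s e : ℝ} (hse : s ≤ e) :
    AEStronglyMeasurable[ℱ e.toNNReal] (increment f G s e) P :=
  (((h.adapted_right e).stronglyMeasurable.aestronglyMeasurable).sub
    (((h.adapted_right s).mono (ℱ.mono (Real.toNNReal_le_toNNReal hse))
      le_rfl).stronglyMeasurable.aestronglyMeasurable)).add (h.aesm_integral hse)

lemma measurable_increment (s e : ℝ) : Measurable (increment f G s e) :=
  (((h.adapted_right e).mono (ℱ.le _) le_rfl).sub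
    ((h.adapted_right s).mono (ℱ.le _) le_rfl)).add (h.measurable_integral s e)

lemma increment_pow_four {s e : ℝ} (hse : s ≤ e) :
    Integrable (fun ω => increment f G s e ω ^ 4) P ∧
      ∫ ω, increment f G s e ω ^ 4 ∂P ≤ 81 * B * (1 + (e - s)) ^ 4 := by
  have hB := h.bound_nonneg
  have hL : 0 ≤ e - s := sub_nonneg.2 hse
  obtain ⟨i1, b1⟩ := h.moment_right e
  obtain ⟨i2, b2⟩ := h.moment_right s
  obtain ⟨i3, b3⟩ := h.integral_pow_four hse
  have hle : ∀ ω, increment f G s e ω ^ 4 ≤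
      27 * (G e ω ^ 4 + G s ω ^ 4 + (∫ u in s..e, f u ω) ^ 4) := fun ω => by
    -- The constant is `3 ^ 3`, from applying the three-term square inequality twice; the three
    -- moments then give `81 * B`.
    have key : ∀ x y z : ℝ, (x - y + z) ^ 4 ≤ 27 * (x ^ 4 + y ^ 4 + z ^ 4) := fun x y z => by
      have h1 : (x - y + z) ^ 2 ≤ 3 * (x ^ 2 + y ^ 2 + z ^ 2) := by
        nlinarith [sq_nonneg (x + y), sq_nonneg (x - z), sq_nonneg (y + z)]
      have h2 : ((x - y + z) ^ 2) ^ 2 ≤ (3 * (x ^ 2 + y ^ 2 + z ^ 2)) ^ 2 := by gcongr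
      nlinarith [sq_nonneg (x ^ 2 - y ^ 2), sq_nonneg (x ^ 2 - z ^ 2), sq_nonneg (y ^ 2 - z ^ 2)]
    exact key _ _ _
  have i12 : Integrable (fun ω => G e ω ^ 4 + G s ω ^ 4) P := i1.add i2
  have ii : Integrable (fun ω => 27 * (G e ω ^ 4 + G s ω ^ 4 + (∫ u in s..e, f u ω) ^ 4)) P :=
    (i12.add i3).const_mul _
  have i : Integrable (fun ω => increment f G s e ω ^ 4) P :=
    ii.mono' ((h.measurable_increment s e).pow_const 4).aestronglyMeasurable
      (ae_of_all _ fun ω => by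
        rw [Real.norm_of_nonneg (by positivity)]; exact hle ω)
  refine ⟨i, (integral_mono i ii hle).trans ?_⟩
  rw [integral_const_mul, integral_add i12 i3, integral_add i1 i2]
  have hp : (1 : ℝ) ≤ (1 + (e - s)) ^ 4 := one_le_pow₀ (by linarith)
  have hp2 : (e - s) ^ 4 ≤ (1 + (e - s)) ^ 4 := by gcongr; linarith
  have b3' : ∫ ω, (∫ u in s..e, f u ω) ^ 4 ∂P ≤ B * (1 + (e - s)) ^ 4 :=
    b3.trans (by gcongr)
  nlinarith

lemma memLp_increment {s e : ℝ} (hse : s ≤ e) : MemLp (increment f G s e) 2 P :=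
  memLp_two_of_pow_four (h.measurable_increment s e).aestronglyMeasurable
    (h.increment_pow_four hse).1

lemma integral_mul_add {s e : ℝ} (hs : 0 ≤ s) (hse : s ≤ e) {Y : Ω → ℝ}
    (hY : AEStronglyMeasurable[ℱ s.toNNReal] Y P) (hY2 : MemLp Y 2 P) :
    ∫ ω, Y ω * (G e ω + ∫ u in s..e, f u ω) ∂P = ∫ ω, Y ω * G s ω ∂P := by
  have i1 : Integrable (fun ω => Y ω * G e ω) P := hY2.integrable_mul (h.memLp_right e)
  have i2 : Integrable (fun ω => Y ω * (∫ u in s..e, f u ω)) P :=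
    hY2.integrable_mul (h.memLp_integral hse)
  simp_rw [mul_add]
  rw [integral_add i1 i2, h.integral_mul_integral hse hY2, h.martingale s e hs hse Y hY hY2]

lemma integral_mul_increment {s e : ℝ} (hs : 0 ≤ s) (hse : s ≤ e) {Y : Ω → ℝ}
    (hY : AEStronglyMeasurable[ℱ s.toNNReal] Y P) (hY2 : MemLp Y 2 P) :
    ∫ ω, Y ω * increment f G s e ω ∂P = 0 := by
  have i1 : Integrable (fun ω => Y ω * (G e ω + ∫ u in s..e, f u ω)) P :=
    hY2.integrable_mul ((h.memLp_right e).add (h.memLp_integral hse))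
  have i2 : Integrable (fun ω => Y ω * G s ω) P := hY2.integrable_mul (h.memLp_right s)
  calc ∫ ω, Y ω * increment f G s e ω ∂P
      = ∫ ω, (Y ω * (G e ω + ∫ u in s..e, f u ω) - Y ω * G s ω) ∂P := by
        congr 1; ext ω; simp only [increment]; ring
    _ = 0 := by rw [integral_sub i1 i2, h.integral_mul_add hs hse hY hY2, sub_self]

end

end ApproxMartingale

end MarkovLimit

namespace MarkovLimit

lemma measurable_setIntegral_Ioc {Ω : Type*} {mΩ : MeasurableSpace Ω} {f : ℝ → Ω → ℝ}
    (hf : Measurable (Function.uncurry f)) (e : ℝ) :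
    Measurable fun z : ℝ × Ω => ∫ u in Ioc z.1 e, f u z.2 := by
  set A : Set ((ℝ × Ω) × ℝ) := {w | w.1.1 < w.2 ∧ w.2 ≤ e} with hA
  have hAm : MeasurableSet A :=
    (measurableSet_lt measurable_fst.fst measurable_snd).inter
      (measurableSet_le measurable_snd measurable_const)
  have hm : Measurable (A.indicator fun w : (ℝ × Ω) × ℝ => f w.2 w.1.2) :=
    (hf.comp (measurable_snd.prodMk measurable_fst.snd)).indicator hAm
  have : (fun z : ℝ × Ω => ∫ u in Ioc z.1 e, f u z.2) =
      fun z => ∫ u, A.indicator (fun w : (ℝ × Ω) × ℝ => f w.2 w.1.2) (z, u) := by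
    ext z
    rw [← integral_indicator measurableSet_Ioc]
    rfl
  rw [this]
  exact (hm.stronglyMeasurable.integral_prod_right').measurable

/-! ### Conditional second moments of the increments. -/

namespace ApproxMartingale

variable {Ω : Type*} {mΩ : MeasurableSpace Ω} {P : Measure Ω} [IsProbabilityMeasure P]
  {ℱ : Filtration ℝ≥0 mΩ} {f G : ℝ → Ω → ℝ} {v B : ℝ} {a : ℝ → ℝ}
  (h : ApproxMartingale P ℱ f G v B a)
include h

/-- Provides the Fubini hypothesis for expanding the square of `G_e` plus the path integral as a
time integral. -/
lemma integrable_mul_tail {s e : ℝ} {Y : Ω → ℝ} (hY : AEStronglyMeasurable Y P)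
    (hY1 : ∀ ω, |Y ω| ≤ 1) :
    Integrable (fun z : ℝ × Ω => Y z.2 * (2 * (f z.1 z.2 * (G e z.2 + ∫ u in Ioc z.1 e, f u z.2))))
      ((volume.restrict (Ioc s e)).prod P) := by
  have hB := h.bound_nonneg
  have hGe : Measurable (G e) := (h.adapted_right e).mono (ℱ.le _) le_rfl
  have hm : Measurable fun z : ℝ × Ω => 2 * (f z.1 z.2 * (G e z.2 + ∫ u in Ioc z.1 e, f u z.2)) :=
    (h.measurable_left.mul ((hGe.comp measurable_snd).add
      (measurable_setIntegral_Ioc h.measurable_left e))).const_mul 2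
  have hQ : ∀ t ∈ Ioc s e, MemLp (fun ω => G e ω + ∫ u in Ioc t e, f u ω) 2 P := fun t ht => by
    have := h.memLp_integral ht.2
    simp_rw [intervalIntegral.integral_of_le ht.2] at this
    exact (h.memLp_right e).add this
  have hi : ∀ t ∈ Ioc s e, Integrable
      (fun ω => 2 * (f t ω * (G e ω + ∫ u in Ioc t e, f u ω))) P := fun t ht =>
    ((h.memLp_left t).integrable_mul (hQ t ht)).const_mul 2
  have hbound : ∀ t ∈ Ioc s e,
      ∫ ω, ‖2 * (f t ω * (G e ω + ∫ u in Ioc t e, f u ω))‖ ∂P ≤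
        (1 + B) + (2 * (1 + B) + 2 * (1 + B * (e - s) ^ 4)) := fun t ht => by
    have hI := h.integral_pow_four ht.2
    have hI2 := h.memLp_integral ht.2
    have hIm := (h.measurable_integral t e).aestronglyMeasurable (μ := P)
    simp_rw [intervalIntegral.integral_of_le ht.2] at hI hI2 hIm
    have b1 := integral_sq_le_of_pow_four (h.aesm_left t) (h.moment_left t).1 (h.moment_left t).2
    have b2 := integral_sq_le_of_pow_four (h.aesm_right e) (h.moment_right e).1
      (h.moment_right e).2
    have b3 := integral_sq_le_of_pow_four hIm hI.1 hI.2
    have j1 := (h.memLp_left t).integrable_sq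
    have j2 : Integrable (fun ω => 2 * G e ω ^ 2) P := (h.memLp_right e).integrable_sq.const_mul 2
    have j3 : Integrable (fun ω => 2 * (∫ u in Ioc t e, f u ω) ^ 2) P :=
      hI2.integrable_sq.const_mul 2
    have j23 : Integrable (fun ω => 2 * G e ω ^ 2 + 2 * (∫ u in Ioc t e, f u ω) ^ 2) P := j2.add j3
    calc ∫ ω, ‖2 * (f t ω * (G e ω + ∫ u in Ioc t e, f u ω))‖ ∂P
        ≤ ∫ ω, (f t ω ^ 2 + (2 * G e ω ^ 2 + 2 * (∫ u in Ioc t e, f u ω) ^ 2)) ∂P := by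
          refine integral_mono (hi t ht).norm (j1.add j23) fun ω => ?_
          dsimp only
          rw [Real.norm_eq_abs, abs_le]
          constructor <;> nlinarith [sq_nonneg (f t ω - (G e ω + ∫ u in Ioc t e, f u ω)),
            sq_nonneg (f t ω + (G e ω + ∫ u in Ioc t e, f u ω)),
            sq_nonneg (G e ω - ∫ u in Ioc t e, f u ω)]
      _ = ∫ ω, f t ω ^ 2 ∂P + (2 * ∫ ω, G e ω ^ 2 ∂P +
            2 * ∫ ω, (∫ u in Ioc t e, f u ω) ^ 2 ∂P) := by
          rw [integral_add j1 j23, integral_add j2 j3, integral_const_mul, integral_const_mul]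
      _ ≤ _ := by
          have : B * (e - t) ^ 4 ≤ B * (e - s) ^ 4 := by
            have := ht.1.le
            have := sub_nonneg.2 ht.2
            gcongr
          gcongr
          exact b3.trans (by gcongr)
  have hint := integrable_prod_of_integral_norm_le
    (H := fun t ω => 2 * (f t ω * (G e ω + ∫ u in Ioc t e, f u ω))) hm hi hbound
  exact hint.bdd_mul (c := 1) hY.comp_snd (ae_of_all _ fun z => hY1 z.2)

/-- The conditional second moment of the increments, in integrated form. -/
lemma integral_mul_increment_sq_eq {s e : ℝ} (hs : 0 ≤ s) (hse : s ≤ e) {Y : Ω → ℝ}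
    (hY : AEStronglyMeasurable[ℱ s.toNNReal] Y P) (hY1 : ∀ ω, |Y ω| ≤ 1) :
    IntegrableOn (fun t => ∫ ω, Y ω * (2 * (f t ω * G t ω)) ∂P) (Ioc s e) ∧
    ∫ ω, Y ω * increment f G s e ω ^ 2 ∂P = ∫ ω, Y ω * G e ω ^ 2 ∂P - ∫ ω, Y ω * G s ω ^ 2 ∂P +
      ∫ t in Ioc s e, ∫ ω, Y ω * (2 * (f t ω * G t ω)) ∂P := by
  have hYm : AEStronglyMeasurable Y P := hY.mono (ℱ.le _)
  have hint := h.integrable_mul_tail (s := s) (e := e) hYm hY1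
  -- Given the past of `t`, the martingale identity allows the future part `G_e + ∫_t^e f` to be
  -- replaced by `G_t`.
  have hinner : ∀ t ∈ Ioc s e,
      ∫ ω, Y ω * (2 * (f t ω * (G e ω + ∫ u in Ioc t e, f u ω))) ∂P =
      ∫ ω, Y ω * (2 * (f t ω * G t ω)) ∂P := fun t ht => by
    have hYt : AEStronglyMeasurable[ℱ t.toNNReal] (fun ω => Y ω * f t ω) P :=
      (hY.mono (ℱ.mono (Real.toNNReal_le_toNNReal ht.1.le))).mul
        (h.adapted_left t).stronglyMeasurable.aestronglyMeasurable
    have key := h.integral_mul_add (hs.trans ht.1.le) ht.2 hYt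
      (MemLp.bdd_mul_two (h.memLp_left t) hYm hY1)
    simp_rw [intervalIntegral.integral_of_le ht.2] at key
    calc ∫ ω, Y ω * (2 * (f t ω * (G e ω + ∫ u in Ioc t e, f u ω))) ∂P
        = 2 * ∫ ω, Y ω * f t ω * (G e ω + ∫ u in Ioc t e, f u ω) ∂P := by
          rw [← integral_const_mul]; congr 1; ext ω; ring
      _ = 2 * ∫ ω, Y ω * f t ω * G t ω ∂P := by rw [key]
      _ = _ := by rw [← integral_const_mul]; congr 1; ext ω; ring
  have hleft : IntegrableOn (fun t => ∫ ω, Y ω * (2 * (f t ω * G t ω)) ∂P) (Ioc s e) := by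
    have := hint.integral_prod_left
    exact (integrable_congr
      ((ae_restrict_mem measurableSet_Ioc).mono fun t ht => hinner t ht)).1 this
  refine ⟨hleft, ?_⟩
  have hae : ∀ᵐ ω ∂P, Y ω * (G e ω + ∫ u in s..e, f u ω) ^ 2 = Y ω * G e ω ^ 2 +
      ∫ t in Ioc s e, Y ω * (2 * (f t ω * (G e ω + ∫ u in Ioc t e, f u ω))) := by
    filter_upwards [(integrable_prod_of_pow_four h.measurable_left h.moment_left s e).prod_left_ae,
      (h.integrable_mul_tail (s := s) (e := e) (Y := fun _ => 1) aestronglyMeasurable_const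
        fun _ => by simp).prod_left_ae] with ω h1 h2
    simp only [one_mul] at h2
    have e1 : ∀ t ∈ Ioc s e, 2 * (f t ω * (G e ω + ∫ u in Ioc t e, f u ω)) - 2 * G e ω * f t ω =
        2 * (f t ω * ∫ u in t..e, f u ω) := fun t ht => by
      rw [intervalIntegral.integral_of_le ht.2]; ring
    have e2 := setIntegral_congr_fun (μ := volume) measurableSet_Ioc e1
    rw [integral_sub h2 (h1.const_mul _), integral_const_mul,
      ← intervalIntegral.integral_of_le hse (f := fun t => 2 * (f t ω * ∫ u in t..e, f u ω)),
      ← sq_intervalIntegral_eq hse h1] at e2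
    rw [integral_const_mul (Y ω), integral_const_mul 2, sub_eq_iff_eq_add.1 e2, integral_const_mul,
      ← intervalIntegral.integral_of_le hse]
    ring
  have iGe : Integrable (fun ω => Y ω * G e ω ^ 2) P :=
    (h.memLp_right e).integrable_sq.bdd_mul (c := 1) hYm (ae_of_all _ hY1)
  have iGs : Integrable (fun ω => Y ω * G s ω ^ 2) P :=
    (h.memLp_right s).integrable_sq.bdd_mul (c := 1) hYm (ae_of_all _ hY1)
  have iQ : Integrable (fun ω => Y ω * (G e ω + ∫ u in s..e, f u ω) ^ 2) P :=
    ((h.memLp_right e).add (h.memLp_integral hse)).integrable_sq.bdd_mul (c := 1) hYm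
      (ae_of_all _ hY1)
  have hYG : MemLp (fun ω => Y ω * G s ω) 2 P := MemLp.bdd_mul_two (h.memLp_right s) hYm hY1
  -- With `Q = G_s + N`, where `N` is the increment, `N² = Q² - G_s² - 2 G_s N`, and the cross term
  -- has mean zero by the martingale property.
  have hcross := h.integral_mul_increment hs hse (Y := fun ω => Y ω * G s ω)
    (hY.mul (h.adapted_right s).stronglyMeasurable.aestronglyMeasurable) hYG
  have iN : Integrable (fun ω => 2 * (Y ω * G s ω * increment f G s e ω)) P :=
    (hYG.integrable_mul (h.memLp_increment hse)).const_mul 2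
  have iQG : Integrable (fun ω => Y ω * (G e ω + ∫ u in s..e, f u ω) ^ 2 - Y ω * G s ω ^ 2) P :=
    iQ.sub iGs
  have hQ : ∫ ω, Y ω * (G e ω + ∫ u in s..e, f u ω) ^ 2 ∂P = ∫ ω, Y ω * G e ω ^ 2 ∂P +
      ∫ t in Ioc s e, ∫ ω, Y ω * (2 * (f t ω * G t ω)) ∂P := by
    rw [integral_congr_ae hae, integral_add iGe hint.integral_prod_right,
      ← integral_integral_swap (f := fun t ω =>
        Y ω * (2 * (f t ω * (G e ω + ∫ u in Ioc t e, f u ω)))) hint,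
      setIntegral_congr_fun measurableSet_Ioc hinner]
  calc ∫ ω, Y ω * increment f G s e ω ^ 2 ∂P
      = ∫ ω, (Y ω * (G e ω + ∫ u in s..e, f u ω) ^ 2 - Y ω * G s ω ^ 2 -
          2 * (Y ω * G s ω * increment f G s e ω)) ∂P := by
        congr 1; ext ω; simp only [increment]; ring
    _ = _ := by
        rw [integral_sub iQG iN, integral_const_mul, hcross, integral_sub iQ iGs, hQ]
        ring

lemma abs_integral_mul_right_sq_le {Y : Ω → ℝ} (hY1 : ∀ ω, |Y ω| ≤ 1) (t : ℝ) :
    |∫ ω, Y ω * G t ω ^ 2 ∂P| ≤ 1 + B := by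
  refine le_trans ?_ (integral_sq_le_of_pow_four (h.aesm_right t) (h.moment_right t).1
    (h.moment_right t).2)
  rw [← Real.norm_eq_abs]
  refine norm_integral_le_of_norm_le (h.memLp_right t).integrable_sq (ae_of_all _ fun ω => ?_)
  rw [norm_mul, Real.norm_of_nonneg (sq_nonneg (G t ω))]
  exact mul_le_of_le_one_left (sq_nonneg _) (hY1 ω)

/-- The increments have conditional second moment close to `v (e - s)`. -/
lemma abs_integral_mul_increment_sq_sub_le {s e : ℝ} (hs : 0 ≤ s) (hse : s ≤ e) {Y : Ω → ℝ}
    (hY : AEStronglyMeasurable[ℱ s.toNNReal] Y P) (hY1 : ∀ ω, |Y ω| ≤ 1) :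
    |∫ ω, Y ω * increment f G s e ω ^ 2 ∂P - (e - s) * v * ∫ ω, Y ω ∂P| ≤
      2 * (1 + B) + ∫ t in Ioi 0, a t := by
  have hYm : AEStronglyMeasurable Y P := hY.mono (ℱ.le _)
  obtain ⟨hi, heq⟩ := h.integral_mul_increment_sq_eq hs hse hY hY1
  have ha : IntervalIntegrable (fun t => a (t - s)) volume s e := by
    have h0 : IntervalIntegrable a volume 0 (e - s) :=
      (intervalIntegrable_iff_integrableOn_Ioc_of_le (sub_nonneg.2 hse)).2
        (h.rate_integrable.mono_set Ioc_subset_Ioi_self)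
    simpa using h0.comp_sub_right s
  have hv : |∫ t in Ioc s e, (∫ ω, Y ω * (2 * (f t ω * G t ω)) ∂P - v * ∫ ω, Y ω ∂P)| ≤
      ∫ t in Ioi 0, a t := by
    calc |∫ t in Ioc s e, (∫ ω, Y ω * (2 * (f t ω * G t ω)) ∂P - v * ∫ ω, Y ω ∂P)|
        ≤ ∫ t in Ioc s e, a (t - s) := by
          rw [← Real.norm_eq_abs]
          exact norm_integral_le_of_norm_le
            ((intervalIntegrable_iff_integrableOn_Ioc_of_le hse).1 ha)
            ((ae_restrict_mem measurableSet_Ioc).mono fun t ht =>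
              h.variation s t hs ht.1.le Y hY hY1)
      _ = ∫ t in Ioc 0 (e - s), a t := by
          rw [← intervalIntegral.integral_of_le hse, intervalIntegral.integral_comp_sub_right a,
            sub_self, intervalIntegral.integral_of_le (sub_nonneg.2 hse)]
      _ ≤ ∫ t in Ioi 0, a t :=
          setIntegral_mono_set h.rate_integrable ((ae_restrict_mem measurableSet_Ioi).mono
            fun t ht => h.rate_nonneg _ (mem_Ioi.1 ht).le) Ioc_subset_Ioi_self.eventuallyLE
  rw [integral_sub hi (integrable_const _), integral_const, measureReal_restrict_apply_univ,
    Real.volume_real_Ioc_of_le hse, smul_eq_mul] at hv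
  have h1 := h.abs_integral_mul_right_sq_le hY1 e
  have h2 := h.abs_integral_mul_right_sq_le hY1 s
  rw [heq]
  rw [abs_le] at *
  constructor <;> nlinarith

lemma rate_integral_nonneg : 0 ≤ ∫ t in Ioi 0, a t :=
  setIntegral_nonneg measurableSet_Ioi fun t ht => h.rate_nonneg t (mem_Ioi.1 ht).le

/-- Second moments of increments over length `L` are nonnegative and at most `L v + C`. If `v` were
negative, the length `(C + 1) / (-v)` would make this bound `-1`. -/
lemma variance_nonneg : 0 ≤ v := by
  by_contra! hv
  set C := 2 * (1 + B) + ∫ t in Ioi 0, a t with hC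
  have hC0 : 0 ≤ C := by
    have := h.rate_integral_nonneg
    have := h.bound_nonneg
    positivity
  have hL : 0 ≤ (C + 1) / (-v) := div_nonneg (by linarith) (by linarith)
  have key := h.abs_integral_mul_increment_sq_sub_le le_rfl hL (Y := fun _ => 1)
    aestronglyMeasurable_const (fun _ => by simp)
  have h0 : 0 ≤ ∫ ω, 1 * increment f G 0 ((C + 1) / (-v)) ω ^ 2 ∂P :=
    integral_nonneg fun ω => by positivity
  have e1 : ((C + 1) / (-v) - 0) * v * ∫ _, (1 : ℝ) ∂P = -(C + 1) := by
    have : v ≠ 0 := hv.ne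
    simp only [sub_zero, integral_const, probReal_univ, smul_eq_mul, mul_one]
    field_simp
  rw [e1, abs_le] at key
  linarith [key.2]

/-- Linear growth of the variance of the path integrals. -/
lemma integral_sq_integral_le {T : ℝ} (hT : 0 ≤ T) :
    ∫ ω, (∫ u in (0 : ℝ)..T, f u ω) ^ 2 ∂P ≤
      3 * (4 * (1 + B) + (∫ t in Ioi 0, a t) + v * T) := by
  have key := h.abs_integral_mul_increment_sq_sub_le le_rfl hT (Y := fun _ => 1)
    aestronglyMeasurable_const (fun _ => by simp)
  simp only [one_mul, integral_const, probReal_univ, smul_eq_mul, mul_one, sub_zero]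
    at key
  have b1 := integral_sq_le_of_pow_four (h.aesm_right T) (h.moment_right T).1 (h.moment_right T).2
  have b2 := integral_sq_le_of_pow_four (h.aesm_right 0) (h.moment_right 0).1 (h.moment_right 0).2
  have j0 := (h.memLp_increment hT).integrable_sq
  have j1 := (h.memLp_right T).integrable_sq
  have j2 := (h.memLp_right 0).integrable_sq
  have j01 : Integrable (fun ω => increment f G 0 T ω ^ 2 + G T ω ^ 2) P := j0.add j1
  have j : Integrable (fun ω => 3 * (increment f G 0 T ω ^ 2 + G T ω ^ 2 + G 0 ω ^ 2)) P :=
    (j01.add j2).const_mul 3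
  calc ∫ ω, (∫ u in (0 : ℝ)..T, f u ω) ^ 2 ∂P
      ≤ ∫ ω, 3 * (increment f G 0 T ω ^ 2 + G T ω ^ 2 + G 0 ω ^ 2) ∂P := by
        refine integral_mono (h.memLp_integral hT).integrable_sq j fun ω => ?_
        -- The path integral is the martingale up to boundary terms whose second moments do not grow
        -- with `T`.
        have e1 : (∫ u in (0 : ℝ)..T, f u ω) = increment f G 0 T ω - G T ω + G 0 ω := by
          simp only [increment]; ring
        dsimp only
        rw [e1]
        nlinarith [sq_nonneg (increment f G 0 T ω + G T ω), sq_nonneg (increment f G 0 T ω - G 0 ω),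
          sq_nonneg (G T ω + G 0 ω)]
    _ = 3 * (∫ ω, increment f G 0 T ω ^ 2 ∂P + ∫ ω, G T ω ^ 2 ∂P + ∫ ω, G 0 ω ^ 2 ∂P) := by
        rw [integral_const_mul, integral_add j01 j2, integral_add j0 j1]
    _ ≤ _ := by
        have := (abs_le.1 key).2
        linarith

end ApproxMartingale
end MarkovLimit

/-! ### The strong law of large numbers. -/

namespace MarkovLimit

variable {Ω : Type*} {mΩ : MeasurableSpace Ω} {P : Measure Ω}

/-- Summable means make the random series almost surely finite, so its terms vanish; this plays the
part of Borel–Cantelli. -/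
lemma ae_tendsto_zero_of_summable_integral {Z : ℕ → Ω → ℝ} (hZ : ∀ n ω, 0 ≤ Z n ω)
    (hi : ∀ n, Integrable (Z n) P) {b : ℕ → ℝ} (hb : Summable b) (hle : ∀ n, ∫ ω, Z n ω ∂P ≤ b n) :
    ∀ᵐ ω ∂P, Tendsto (fun n => Z n ω) atTop (𝓝 0) := by
  have hsum : Summable fun n => ∫ ω, Z n ω ∂P :=
    hb.of_nonneg_of_le (fun n => integral_nonneg (hZ n)) hle
  have hm : ∀ n, AEMeasurable (fun ω => ENNReal.ofReal (Z n ω)) P := fun n =>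
    (hi n).1.aemeasurable.ennreal_ofReal
  have hfin : ∫⁻ ω, ∑' n, ENNReal.ofReal (Z n ω) ∂P ≠ ∞ := by
    rw [lintegral_tsum hm]
    simp_rw [← fun n => ofReal_integral_eq_lintegral_ofReal (hi n) (ae_of_all _ (hZ n))]
    exact hsum.tsum_ofReal_ne_top
  filter_upwards [ae_lt_top' (AEMeasurable.tsum hm) hfin] with ω hω
  have := ENNReal.tendsto_atTop_zero_of_tsum_ne_top hω.ne
  have h2 := (ENNReal.tendsto_toReal ENNReal.zero_ne_top).comp this
  simpa [Function.comp_def, ENNReal.toReal_ofReal (hZ _ _)] using h2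

/-- Time averages along squares control all the time averages. -/
lemma tendsto_average_of_squares {g : ℝ → ℝ}
    (hg : ∀ T, 0 ≤ T → IntervalIntegrable g volume 0 T)
    (h1 : Tendsto (fun n : ℕ => (∫ u in (0 : ℝ)..(n : ℝ) ^ 2, g u) / (n : ℝ) ^ 2) atTop (𝓝 0))
    (h2 : Tendsto (fun n : ℕ => (∫ u in ((n : ℝ) ^ 2)..((n : ℝ) + 1) ^ 2, |g u|) / (n : ℝ) ^ 2)
      atTop (𝓝 0)) :
    Tendsto (fun T : ℝ => (1 / T) * ∫ u in (0 : ℝ)..T, g u) atTop (𝓝 0) := by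
  have hfl : Tendsto (fun T : ℝ => ⌊√T⌋₊) atTop atTop :=
    tendsto_nat_floor_atTop.comp Real.tendsto_sqrt_atTop
  have hlim := (h1.abs.add h2).comp hfl
  rw [abs_zero, add_zero] at hlim
  refine squeeze_zero_norm' ?_ hlim
  filter_upwards [eventually_ge_atTop 1] with T hT
  have hT0 : 0 ≤ T := by linarith
  set n := ⌊√T⌋₊ with hn
  have hn1 : 1 ≤ n := (Nat.one_le_floor_iff _).2 (Real.one_le_sqrt.2 hT)
  have hn1' : (1 : ℝ) ≤ n := by exact_mod_cast hn1
  have hnT : (n : ℝ) ^ 2 ≤ T := by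
    rw [← Real.sq_sqrt hT0]
    have := Nat.floor_le (Real.sqrt_nonneg T)
    gcongr
  have hTn : T ≤ ((n : ℝ) + 1) ^ 2 := by
    conv_lhs => rw [← Real.sq_sqrt hT0]
    have := (Nat.lt_floor_add_one (√T)).le
    gcongr
  have hi : ∀ x y, 0 ≤ x → 0 ≤ y → IntervalIntegrable g volume x y := fun x y hx hy =>
    (hg x hx).symm.trans (hg y hy)
  have hn2 : (0 : ℝ) ≤ (n : ℝ) ^ 2 := by positivity
  have hadd := intervalIntegral.integral_add_adjacent_intervals (hg _ hn2) (hi _ _ hn2 hT0)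
  have hle : |∫ u in ((n : ℝ) ^ 2)..T, g u| ≤ ∫ u in ((n : ℝ) ^ 2)..((n : ℝ) + 1) ^ 2, |g u| := by
    refine (intervalIntegral.abs_integral_le_integral_abs hnT).trans ?_
    exact intervalIntegral.integral_mono_interval le_rfl hnT hTn (ae_of_all _ fun u => abs_nonneg _)
      (hi _ _ hn2 (by positivity)).abs
  simp only [Function.comp_apply, ← hn]
  rw [← hadd, norm_mul, Real.norm_of_nonneg (by positivity), abs_div, abs_of_nonneg hn2, ← add_div,
    one_div, inv_mul_eq_div, Real.norm_eq_abs]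
  have hsum := (abs_add_le (∫ u in (0 : ℝ)..(n : ℝ) ^ 2, g u) _).trans (add_le_add le_rfl hle)
  exact div_le_div₀ ((abs_nonneg _).trans hsum) hsum (by positivity) hnT

namespace ApproxMartingale

variable [IsProbabilityMeasure P]
  {ℱ : Filtration ℝ≥0 mΩ} {f G : ℝ → Ω → ℝ} {v B : ℝ} {a : ℝ → ℝ}
  (h : ApproxMartingale P ℱ f G v B a)
include h

lemma ae_intervalIntegrable :
    ∀ᵐ ω ∂P, ∀ T : ℝ, 0 ≤ T → IntervalIntegrable (fun u => f u ω) volume 0 T := by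
  have : ∀ n : ℕ, ∀ᵐ ω ∂P, IntegrableOn (fun u => f u ω) (Ioc (0 : ℝ) n) := fun n =>
    (integrable_prod_of_pow_four h.measurable_left h.moment_left 0 n).prod_left_ae
  filter_upwards [ae_all_iff.2 this] with ω hω T hT
  obtain ⟨n, hn⟩ := exists_nat_ge T
  exact (intervalIntegrable_iff_integrableOn_Ioc_of_le hT).2
    ((hω n).mono_set (Ioc_subset_Ioc_right hn))

/-- Strong law of large numbers. -/
theorem ae_tendsto_average :
    ∀ᵐ ω ∂P, Tendsto (fun T : ℝ => (1 / T) * ∫ u in (0 : ℝ)..T, f u ω) atTop (𝓝 0) := by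
  have hB := h.bound_nonneg
  have hv := h.variance_nonneg
  have ha := h.rate_integral_nonneg
  set D := 3 * (4 * (1 + B) + (∫ t in Ioi 0, a t) + v) with hD
  -- The second moment at time `n²` is of order `n²`; division by `n⁴` leaves the summable `n⁻²`.
  have hlim1 : ∀ᵐ ω ∂P, Tendsto
      (fun n : ℕ => ((∫ u in (0 : ℝ)..(n : ℝ) ^ 2, f u ω) / (n : ℝ) ^ 2) ^ 2) atTop (𝓝 0) := by
    refine ae_tendsto_zero_of_summable_integral (fun n ω => sq_nonneg _) (fun n => ?_)
      ((Real.summable_one_div_nat_pow.2 one_lt_two).mul_left D) fun n => ?_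
    · simp_rw [div_pow]
      exact (h.memLp_integral (sq_nonneg _)).integrable_sq.div_const _
    · simp_rw [div_pow]
      rw [integral_div]
      rcases Nat.eq_zero_or_pos n with rfl | hn
      · simp
      have hn1 : (1 : ℝ) ≤ (n : ℝ) ^ 2 := one_le_pow₀ (by exact_mod_cast hn)
      rw [mul_one_div, div_le_div_iff₀ (by positivity) (by positivity)]
      have hs := h.integral_sq_integral_le (sq_nonneg (n : ℝ))
      calc (∫ ω, (∫ u in (0 : ℝ)..(n : ℝ) ^ 2, f u ω) ^ 2 ∂P) * (n : ℝ) ^ 2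
          ≤ (D * (n : ℝ) ^ 2) * (n : ℝ) ^ 2 := by
            gcongr
            refine hs.trans ?_
            rw [hD]
            nlinarith
        _ = _ := by ring
  -- The gap between consecutive squares is at most `3 n` for `n ≥ 1`, so the fourth moment is at
  -- most `B (3 n)⁴`. After division by `n⁸` the bound `81 B n⁻²` is more than enough.
  have hlim2 : ∀ᵐ ω ∂P, Tendsto (fun n : ℕ =>
      ((∫ u in ((n : ℝ) ^ 2)..((n : ℝ) + 1) ^ 2, |f u ω|) / (n : ℝ) ^ 2) ^ 4) atTop (𝓝 0) := by
    refine ae_tendsto_zero_of_summable_integral (fun n ω => by positivity) (fun n => ?_)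
      ((Real.summable_one_div_nat_pow.2 one_lt_two).mul_left (B * 81)) fun n => ?_
    all_goals
      have hle : (n : ℝ) ^ 2 ≤ ((n : ℝ) + 1) ^ 2 := by gcongr; linarith
      have key := intervalIntegral_pow_four_le (P := P) (f := fun u ω => |f u ω|)
        (measurable_norm.comp h.measurable_left) (B := B)
        (fun t => by simpa only [Even.pow_abs (show Even 4 by decide)] using h.moment_left t) hle
      simp_rw [div_pow]
    · exact key.1.div_const _
    · rw [integral_div]
      rcases Nat.eq_zero_or_pos n with rfl | hn
      · simp
      have hn1 : (1 : ℝ) ≤ n := by exact_mod_cast hn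
      rw [mul_one_div, div_le_div_iff₀ (by positivity) (by positivity)]
      have h3 : ((n : ℝ) + 1) ^ 2 - (n : ℝ) ^ 2 ≤ 3 * n := by nlinarith
      calc _ ≤ (B * (((n : ℝ) + 1) ^ 2 - (n : ℝ) ^ 2) ^ 4) * (n : ℝ) ^ 2 := by
            gcongr
            exact key.2
        _ ≤ (B * (3 * n) ^ 4) * (n : ℝ) ^ 2 := by
            have := sub_nonneg.2 hle
            gcongr
        _ = B * 81 * (n : ℝ) ^ 6 := by ring
        _ ≤ B * 81 * (n : ℝ) ^ 8 := by
            gcongr; norm_num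
        _ = _ := by ring
  filter_upwards [h.ae_intervalIntegrable, hlim1, hlim2] with ω hω h1 h2
  have root : ∀ {k : ℕ} (_ : k ≠ 0) {w : ℕ → ℝ}, Tendsto (fun n => w n ^ k) atTop (𝓝 0) →
      Tendsto w atTop (𝓝 0) := fun {k} hk w hw => by
    rw [tendsto_zero_iff_norm_tendsto_zero] at hw ⊢
    simp_rw [norm_pow] at hw
    have := hw.rpow_const (p := 1 / (k : ℝ)) (Or.inr (by positivity))
    simp_rw [one_div, Real.pow_rpow_inv_natCast (norm_nonneg _) hk] at this
    rwa [Real.zero_rpow (by positivity)] at this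
  exact tendsto_average_of_squares hω (root two_ne_zero h1) (root four_ne_zero h2)

end ApproxMartingale
end MarkovLimit

namespace MarkovLimit

/-! ### One step of the characteristic function. -/

section Exponential

/-- Taylor's formula for `|y| ≤ 1` and the triangle inequality beyond. The bound is global, so no
truncation of the increments is needed. -/
lemma norm_exp_mul_I_sub_le (y : ℝ) :
    ‖Complex.exp (y * Complex.I) - 1 - y * Complex.I + y ^ 2 / 2‖ ≤ 4 * |y| ^ 3 := by
  rcases le_or_gt |y| 1 with hy | hy
  · have hn : ‖(y : ℂ) * Complex.I‖ = |y| := by simp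
    have := Complex.exp_bound (x := y * Complex.I) (by rw [hn]; exact hy) (n := 3) (by norm_num)
    rw [hn] at this
    simp only [Finset.sum_range_succ, Finset.sum_range_zero, pow_zero, pow_one, mul_pow,
      Complex.I_sq, Nat.factorial, Nat.cast_one, Nat.succ_eq_add_one] at this
    refine le_trans (le_of_eq ?_) (this.trans ?_)
    · congr 1
      push_cast
      ring
    · norm_num
      nlinarith [pow_nonneg (abs_nonneg y) 3]
  · have e1 : ‖Complex.exp (y * Complex.I)‖ = 1 := Complex.norm_exp_ofReal_mul_I y
    have e2 : ‖(y : ℂ) * Complex.I‖ = |y| := by simp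
    have e3 : ‖(y : ℂ) ^ 2 / 2‖ = |y| ^ 2 / 2 := by simp
    calc ‖Complex.exp (y * Complex.I) - 1 - y * Complex.I + y ^ 2 / 2‖
        ≤ ‖Complex.exp (y * Complex.I)‖ + ‖(1 : ℂ)‖ + ‖(y : ℂ) * Complex.I‖ + ‖(y : ℂ) ^ 2 / 2‖ :=
          (norm_add_le _ _).trans (by
            gcongr
            exact (norm_sub_le _ _).trans (by gcongr; exact norm_sub_le _ _))
      _ = 2 + |y| + |y| ^ 2 / 2 := by rw [e1, e2, e3, norm_one]; ring
      _ ≤ 4 * |y| ^ 3 := by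
          have h2 : 1 ≤ |y| ^ 2 := one_le_pow₀ hy.le
          nlinarith

lemma abs_exp_neg_sub_le {x : ℝ} (hx : 0 ≤ x) : |Real.exp (-x) - (1 - x)| ≤ x ^ 2 := by
  rw [abs_of_nonneg (by linarith [Real.add_one_le_exp (-x)])]
  rcases le_or_gt x 1 with h1 | h1
  · have := Real.abs_exp_sub_one_sub_id_le (x := -x) (by rwa [abs_neg, abs_of_nonneg hx])
    have := (abs_le.1 this).2
    nlinarith
  · have : Real.exp (-x) ≤ 1 := Real.exp_le_one_iff.2 (by linarith)
    nlinarith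

/-- Since `q ≤ 1`, earlier errors are not amplified and the total grows only linearly in the number
of steps. -/
lemma norm_sub_pow_le {u : ℕ → ℂ} {q δ : ℝ} (h0 : u 0 = 1) (hq0 : 0 ≤ q) (hq1 : q ≤ 1) {K : ℕ}
    (h : ∀ k < K, ‖u (k + 1) - q * u k‖ ≤ δ) : ‖u K - (q : ℂ) ^ K‖ ≤ K * δ := by
  induction K with
  | zero => simp [h0]
  | succ K ih =>
    have ih' := ih fun k hk => h k (hk.trans (Nat.lt_succ_self K))
    have hqn : ‖(q : ℂ)‖ ≤ 1 := by simpa [abs_of_nonneg hq0] using hq1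
    calc ‖u (K + 1) - (q : ℂ) ^ (K + 1)‖
        = ‖(u (K + 1) - q * u K) + q * (u K - (q : ℂ) ^ K)‖ := by congr 1; ring
      _ ≤ δ + 1 * (K * δ) := by
          refine (norm_add_le _ _).trans (add_le_add (h K (Nat.lt_succ_self K)) ?_)
          rw [norm_mul]
          gcongr
      _ = _ := by push_cast; ring

end Exponential

variable {Ω : Type*} {mΩ : MeasurableSpace Ω} {P : Measure Ω} [IsProbabilityMeasure P]

lemma integrable_exp_mul_I {M : Ω → ℝ} (hM : AEStronglyMeasurable M P) {W : Ω → ℂ}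
    (hW : Integrable W P) : Integrable (fun ω => Complex.exp (M ω * Complex.I) * W ω) P :=
  hW.bdd_mul (c := 1) ((Complex.continuous_exp.comp
    (Complex.continuous_ofReal.mul continuous_const)).comp_aestronglyMeasurable hM)
    (ae_of_all _ fun _ => (Complex.norm_exp_ofReal_mul_I _).le)

/-- The conditional moment hypotheses are stated for real test functions, so the exponential is
split into cosine and sine. -/
lemma integral_exp_mul_I_mul {M Z : Ω → ℝ} (hM : AEStronglyMeasurable M P)
    (hZ : Integrable Z P) :
    ∫ ω, Complex.exp (M ω * Complex.I) * Z ω ∂P =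
      (∫ ω, Real.cos (M ω) * Z ω ∂P : ℝ) + (∫ ω, Real.sin (M ω) * Z ω ∂P : ℝ) * Complex.I := by
  have i1 : Integrable (fun ω => Real.cos (M ω) * Z ω) P :=
    hZ.bdd_mul (c := 1) (Real.continuous_cos.comp_aestronglyMeasurable hM)
      (ae_of_all _ fun ω => Real.abs_cos_le_one _)
  have i2 : Integrable (fun ω => Real.sin (M ω) * Z ω) P :=
    hZ.bdd_mul (c := 1) (Real.continuous_sin.comp_aestronglyMeasurable hM)
      (ae_of_all _ fun ω => Real.abs_sin_le_one _)
  rw [← integral_complex_ofReal, ← integral_complex_ofReal, ← integral_mul_const,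
    ← integral_add i1.ofReal (i2.ofReal.mul_const _)]
  congr 1
  ext ω
  rw [Complex.exp_mul_I]
  push_cast
  ring

/-- One step of the characteristic function of a sum whose second summand `N` is conditionally
centred with conditional variance close to `w`. -/
lemma norm_charFun_step_le {M N : Ω → ℝ} (hM : AEStronglyMeasurable M P)
    (hN : AEStronglyMeasurable N P) (hN4 : Integrable (fun ω => N ω ^ 4) P) {w C D : ℝ}
    (hw : 0 ≤ w) (hD : ∫ ω, N ω ^ 4 ∂P ≤ D) (ζ : ℝ)
    (h1 : ∀ g : ℝ → ℝ, Continuous g → (∀ y, |g y| ≤ 1) → ∫ ω, g (M ω) * N ω ∂P = 0)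
    (h2 : ∀ g : ℝ → ℝ, Continuous g → (∀ y, |g y| ≤ 1) →
      |∫ ω, g (M ω) * N ω ^ 2 ∂P - w * ∫ ω, g (M ω) ∂P| ≤ C) :
    ‖∫ ω, Complex.exp ((ζ * (M ω + N ω) : ℝ) * Complex.I) ∂P -
      (Real.exp (-(ζ ^ 2 * w / 2)) : ℝ) * ∫ ω, Complex.exp ((ζ * M ω : ℝ) * Complex.I) ∂P‖ ≤
      4 * |ζ| ^ 3 * (1 + D) + ζ ^ 2 * C + (ζ ^ 2 * w / 2) ^ 2 := by
  have hζM : AEStronglyMeasurable (fun ω => ζ * M ω) P := hM.const_mul ζ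
  have hN2 := memLp_two_of_pow_four hN hN4
  have iN := hN2.integrable one_le_two
  have iNsq := hN2.integrable_sq
  have e1 : ∫ ω, Complex.exp ((ζ * M ω : ℝ) * Complex.I) * N ω ∂P = 0 := by
    rw [integral_exp_mul_I_mul hζM iN,
      h1 (fun y => Real.cos (ζ * y)) (by fun_prop) fun y => Real.abs_cos_le_one _,
      h1 (fun y => Real.sin (ζ * y)) (by fun_prop) fun y => Real.abs_sin_le_one _]
    simp
  have e2 : ‖∫ ω, Complex.exp ((ζ * M ω : ℝ) * Complex.I) * (N ω ^ 2 : ℝ) ∂P -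
      w * ∫ ω, Complex.exp ((ζ * M ω : ℝ) * Complex.I) ∂P‖ ≤ 2 * C := by
    have hone : ∫ ω, Complex.exp ((ζ * M ω : ℝ) * Complex.I) ∂P =
        ∫ ω, Complex.exp ((ζ * M ω : ℝ) * Complex.I) * ((1 : ℝ) : ℂ) ∂P := by simp
    rw [hone, integral_exp_mul_I_mul hζM iNsq,
      integral_exp_mul_I_mul hζM (integrable_const (1 : ℝ))]
    simp only [mul_one]
    have c1 := h2 (fun y => Real.cos (ζ * y)) (by fun_prop) fun y => Real.abs_cos_le_one _
    have c2 := h2 (fun y => Real.sin (ζ * y)) (by fun_prop) fun y => Real.abs_sin_le_one _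
    set A := ∫ ω, Real.cos (ζ * M ω) * N ω ^ 2 ∂P
    set A' := ∫ ω, Real.cos (ζ * M ω) ∂P
    set B := ∫ ω, Real.sin (ζ * M ω) * N ω ^ 2 ∂P
    set B' := ∫ ω, Real.sin (ζ * M ω) ∂P
    calc ‖(A : ℂ) + B * Complex.I - w * (A' + B' * Complex.I)‖
        = ‖((A - w * A' : ℝ) : ℂ) + (B - w * B' : ℝ) * Complex.I‖ := by
          congr 1; push_cast; ring
      _ ≤ |A - w * A'| + |B - w * B'| := by
          refine (norm_add_le _ _).trans (le_of_eq ?_)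
          rw [norm_mul, Complex.norm_I, mul_one, Complex.norm_real, Complex.norm_real]
          rfl
      _ ≤ 2 * C := by linarith
  set Ψ : Ω → ℂ := fun ω => Complex.exp ((ζ * M ω : ℝ) * Complex.I) with hΨ
  -- The second-order Taylor remainder in `N`. The linear term drops out by centring, the quadratic
  -- one gives `1 - ζ² w / 2` up to `C`, and this factor is then exchanged for the exponential.
  set R : Ω → ℂ := fun ω => Complex.exp ((ζ * N ω : ℝ) * Complex.I) - 1 -
    (ζ * N ω : ℝ) * Complex.I + ((ζ * N ω : ℝ) : ℂ) ^ 2 / 2 with hR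
  have iΨ : Integrable Ψ P := by
    simpa [hΨ] using integrable_exp_mul_I hζM (integrable_const (1 : ℂ))
  have iΨN : Integrable (fun ω => Ψ ω * N ω) P := integrable_exp_mul_I hζM iN.ofReal
  have iΨN2 : Integrable (fun ω => Ψ ω * (N ω ^ 2 : ℝ)) P := integrable_exp_mul_I hζM iNsq.ofReal
  have iexpN : Integrable (fun ω => Complex.exp ((ζ * N ω : ℝ) * Complex.I)) P := by
    simpa using integrable_exp_mul_I (hN.const_mul ζ) (integrable_const (1 : ℂ))
  have iΨe : Integrable (fun ω => Complex.exp ((ζ * (M ω + N ω) : ℝ) * Complex.I)) P := by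
    simpa using integrable_exp_mul_I ((hM.add hN).const_mul ζ) (integrable_const (1 : ℂ))
  have hΨR : ∀ ω, Ψ ω * R ω = Complex.exp ((ζ * (M ω + N ω) : ℝ) * Complex.I) - Ψ ω -
      ζ * Complex.I * (Ψ ω * N ω) + ζ ^ 2 / 2 * (Ψ ω * (N ω ^ 2 : ℝ)) := fun ω => by
    have : Complex.exp ((ζ * (M ω + N ω) : ℝ) * Complex.I) =
        Ψ ω * Complex.exp ((ζ * N ω : ℝ) * Complex.I) := by
      rw [hΨ, ← Complex.exp_add]; push_cast; ring_nf
    rw [this, hR]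
    push_cast
    ring
  have e3 : ∫ ω, Ψ ω * R ω ∂P = ∫ ω, Complex.exp ((ζ * (M ω + N ω) : ℝ) * Complex.I) ∂P -
      ∫ ω, Ψ ω ∂P + ζ ^ 2 / 2 * ∫ ω, Ψ ω * (N ω ^ 2 : ℝ) ∂P := by
    simp_rw [hΨR]
    have j1 : Integrable (fun ω => Complex.exp ((ζ * (M ω + N ω) : ℝ) * Complex.I) - Ψ ω) P :=
      iΨe.sub iΨ
    have j2 : Integrable (fun ω => Complex.exp ((ζ * (M ω + N ω) : ℝ) * Complex.I) - Ψ ω -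
      ζ * Complex.I * (Ψ ω * N ω)) P := j1.sub (iΨN.const_mul _)
    rw [integral_add j2 (iΨN2.const_mul _), integral_sub j1 (iΨN.const_mul _),
      integral_sub iΨe iΨ, integral_const_mul, integral_const_mul, e1, mul_zero, sub_zero]
  have e4 : ‖∫ ω, Ψ ω * R ω ∂P‖ ≤ 4 * |ζ| ^ 3 * (1 + D) := by
    have ib : Integrable (fun ω => 4 * |ζ| ^ 3 * (1 + N ω ^ 4)) P :=
      ((integrable_const 1).add hN4).const_mul _
    refine (norm_integral_le_of_norm_le ib (ae_of_all _ fun ω => ?_)).trans ?_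
    · rw [norm_mul, hΨ, Complex.norm_exp_ofReal_mul_I, one_mul]
      refine (norm_exp_mul_I_sub_le _).trans ?_
      rw [abs_mul, mul_pow, ← mul_assoc]
      gcongr
      have : N ω ^ 4 = |N ω| ^ 4 := by rw [Even.pow_abs (by decide)]
      rw [this]
      nlinarith [sq_nonneg (|N ω| ^ 2 - |N ω|), sq_nonneg (|N ω| ^ 2 - 1), sq_nonneg (|N ω| - 1),
        abs_nonneg (N ω), sq_nonneg (|N ω|)]
    · rw [integral_const_mul, integral_add (integrable_const 1) hN4]
      simp only [integral_const, probReal_univ, smul_eq_mul, mul_one]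
      gcongr
  have e5 : ‖∫ ω, Ψ ω ∂P‖ ≤ 1 := by
    refine (norm_integral_le_of_norm_le_const (C := 1) (ae_of_all _ fun ω => ?_)).trans (by simp)
    rw [hΨ, Complex.norm_exp_ofReal_mul_I]
  set x := ζ ^ 2 * w / 2 with hx
  have hx0 : 0 ≤ x := by positivity
  calc ‖∫ ω, Complex.exp ((ζ * (M ω + N ω) : ℝ) * Complex.I) ∂P -
        (Real.exp (-x) : ℝ) * ∫ ω, Ψ ω ∂P‖
      = ‖∫ ω, Ψ ω * R ω ∂P - ζ ^ 2 / 2 * (∫ ω, Ψ ω * (N ω ^ 2 : ℝ) ∂P - w * ∫ ω, Ψ ω ∂P) -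
          (Real.exp (-x) - (1 - x) : ℝ) * ∫ ω, Ψ ω ∂P‖ := by
        rw [e3, hx]
        congr 1
        push_cast
        ring
    _ ≤ 4 * |ζ| ^ 3 * (1 + D) + ζ ^ 2 / 2 * (2 * C) + x ^ 2 * 1 := by
        refine (norm_sub_le _ _).trans (add_le_add ((norm_sub_le _ _).trans (add_le_add e4 ?_)) ?_)
        · rw [norm_mul]
          have : ‖(ζ : ℂ) ^ 2 / 2‖ = ζ ^ 2 / 2 := by simp
          rw [this]
          gcongr
        · rw [norm_mul, Complex.norm_real]
          gcongr
          exact abs_exp_neg_sub_le hx0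
    _ = _ := by ring

end MarkovLimit

namespace MarkovLimit

lemma norm_exp_mul_I_sub_exp_mul_I_le (x y : ℝ) :
    ‖Complex.exp (x * Complex.I) - Complex.exp (y * Complex.I)‖ ≤ |x - y| := by
  have : Complex.exp (x * Complex.I) - Complex.exp (y * Complex.I) =
      Complex.exp (y * Complex.I) * (Complex.exp (Complex.I * (x - y : ℝ)) - 1) := by
    rw [mul_sub, ← Complex.exp_add]
    push_cast
    ring_nf
  rw [this, norm_mul, Complex.norm_exp_ofReal_mul_I, one_mul]
  exact Real.norm_exp_I_mul_ofReal_sub_one_le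

variable {Ω : Type*} {mΩ : MeasurableSpace Ω} {P : Measure Ω} [IsProbabilityMeasure P]

/-! ### The central limit theorem by blocks. -/

namespace ApproxMartingale

variable {ℱ : Filtration ℝ≥0 mΩ} {f G : ℝ → Ω → ℝ} {v B : ℝ} {a : ℝ → ℝ}
  (h : ApproxMartingale P ℱ f G v B a)
include h

lemma increment_add {s e : ℝ} (hs : 0 ≤ s) (hse : s ≤ e) :
    ∀ᵐ ω ∂P, increment f G 0 e ω = increment f G 0 s ω + increment f G s e ω := by
  filter_upwards [h.ae_intervalIntegrable] with ω hω
  have := intervalIntegral.integral_add_adjacent_intervals (hω s hs)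
    ((hω s hs).symm.trans (hω e (hs.trans hse)))
  simp only [increment]
  rw [← this]
  ring

lemma norm_charFun_increment_step_le {s e : ℝ} (hs : 0 ≤ s) (hse : s ≤ e) (ζ : ℝ) :
    ‖∫ ω, Complex.exp ((ζ * increment f G 0 e ω : ℝ) * Complex.I) ∂P -
      (Real.exp (-(ζ ^ 2 * ((e - s) * v) / 2)) : ℝ) *
        ∫ ω, Complex.exp ((ζ * increment f G 0 s ω : ℝ) * Complex.I) ∂P‖ ≤
      4 * |ζ| ^ 3 * (1 + 81 * B * (1 + (e - s)) ^ 4) +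
        ζ ^ 2 * (2 * (1 + B) + ∫ t in Ioi 0, a t) + (ζ ^ 2 * ((e - s) * v) / 2) ^ 2 := by
  have hM := h.aesm_increment hs
  have hY : ∀ g : ℝ → ℝ, Continuous g →
      AEStronglyMeasurable[ℱ s.toNNReal] (fun ω => g (increment f G 0 s ω)) P :=
    fun g hg => hg.comp_aestronglyMeasurable hM
  have hN4 := h.increment_pow_four hse
  have key := norm_charFun_step_le (h.measurable_increment 0 s).aestronglyMeasurable
    (h.measurable_increment s e).aestronglyMeasurable hN4.1
    (mul_nonneg (sub_nonneg.2 hse) h.variance_nonneg) hN4.2 ζ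
    (fun g hg hg1 => h.integral_mul_increment hs hse (hY g hg)
      (MemLp.of_bound ((hY g hg).mono (ℱ.le _)) 1 (ae_of_all _ fun ω => hg1 _)))
    (fun g hg hg1 => h.abs_integral_mul_increment_sq_sub_le hs hse (hY g hg) fun ω => hg1 _)
  have hcongr : ∫ ω, Complex.exp ((ζ * increment f G 0 e ω : ℝ) * Complex.I) ∂P =
      ∫ ω, Complex.exp ((ζ * (increment f G 0 s ω + increment f G s e ω) : ℝ) * Complex.I) ∂P :=
    integral_congr_ae ((h.increment_add hs hse).mono fun ω hω => by dsimp only; rw [hω])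
  rw [hcongr]
  exact key

/-- `K` equal blocks: each step multiplies by the same Gaussian factor, whose `K`-th power is the
target. -/
lemma norm_charFun_increment_sub_le {T : ℝ} (hT : 0 ≤ T) {K : ℕ} (hK : 0 < K) (ζ : ℝ) :
    ‖∫ ω, Complex.exp ((ζ * increment f G 0 T ω : ℝ) * Complex.I) ∂P -
      (Real.exp (-(ζ ^ 2 * (T * v) / 2)) : ℝ)‖ ≤
      K * (4 * |ζ| ^ 3 * (1 + 81 * B * (1 + T / K) ^ 4) +
        ζ ^ 2 * (2 * (1 + B) + ∫ t in Ioi 0, a t) + (ζ ^ 2 * (T / K * v) / 2) ^ 2) := by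
  have hv := h.variance_nonneg
  have hK' : (0 : ℝ) < K := by exact_mod_cast hK
  have hL : 0 ≤ T / K := by positivity
  have hdiff : ∀ k : ℕ, ((k + 1 : ℕ) : ℝ) * (T / K) - k * (T / K) = T / K := fun k => by
    push_cast; ring
  have key := norm_sub_pow_le (K := K)
    (u := fun k : ℕ => ∫ ω, Complex.exp ((ζ * increment f G 0 (k * (T / K)) ω : ℝ) * Complex.I) ∂P)
    (q := Real.exp (-(ζ ^ 2 * (T / K * v) / 2)))
    (δ := 4 * |ζ| ^ 3 * (1 + 81 * B * (1 + T / K) ^ 4) +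
        ζ ^ 2 * (2 * (1 + B) + ∫ t in Ioi 0, a t) + (ζ ^ 2 * (T / K * v) / 2) ^ 2)
    (by simp [increment]) (Real.exp_nonneg _)
    (Real.exp_le_one_iff.2 (neg_nonpos.2 (by positivity))) fun k _ => by
      have hs : 0 ≤ (k : ℝ) * (T / K) := by positivity
      have hse : (k : ℝ) * (T / K) ≤ ((k + 1 : ℕ) : ℝ) * (T / K) := by
        rw [← sub_nonneg, hdiff]; exact hL
      have := h.norm_charFun_increment_step_le hs hse ζ
      rwa [hdiff] at this
  have hpow : Real.exp (-(ζ ^ 2 * (T / K * v) / 2)) ^ K = Real.exp (-(ζ ^ 2 * (T * v) / 2)) := by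
    rw [← Real.exp_nat_mul]
    congr 1
    field_simp
  rw [← Complex.ofReal_pow, hpow, mul_div_cancel₀ T hK'.ne'] at key
  exact key

lemma norm_charFun_integral_sub_le (T ζ : ℝ) :
    ‖∫ ω, Complex.exp ((ζ * ∫ u in (0 : ℝ)..T, f u ω : ℝ) * Complex.I) ∂P -
      ∫ ω, Complex.exp ((ζ * increment f G 0 T ω : ℝ) * Complex.I) ∂P‖ ≤
      |ζ| * (2 * (1 + B)) := by
  have hexp : ∀ {M : Ω → ℝ}, AEStronglyMeasurable M P →
      Integrable (fun ω => Complex.exp ((M ω : ℂ) * Complex.I)) P := fun hM => by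
    simpa using integrable_exp_mul_I hM (integrable_const (1 : ℂ))
  have i1 := hexp ((h.measurable_integral 0 T).aestronglyMeasurable.const_mul ζ)
  have i2 := hexp ((h.measurable_increment 0 T).aestronglyMeasurable.const_mul ζ)
  have hG := fun t => h.moment_right t
  have iG : Integrable (fun ω => |ζ| * (1 + G T ω ^ 4 + (1 + G 0 ω ^ 4))) P :=
    (((integrable_const 1).add (hG T).1).add ((integrable_const 1).add (hG 0).1)).const_mul _
  rw [← integral_sub i1 i2]
  refine (norm_integral_le_of_norm_le iG (ae_of_all _ fun ω => ?_)).trans ?_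
  · refine (norm_exp_mul_I_sub_exp_mul_I_le _ _).trans ?_
    rw [← mul_sub, abs_mul]
    gcongr
    have e1 : (∫ u in (0 : ℝ)..T, f u ω) - increment f G 0 T ω = G 0 ω - G T ω := by
      simp only [increment]; ring
    rw [e1]
    have := abs_le_one_add_pow_four (G T ω)
    have := abs_le_one_add_pow_four (G 0 ω)
    have := abs_sub (G 0 ω) (G T ω)
    linarith
  · have j1 : Integrable (fun ω => 1 + G T ω ^ 4) P := (integrable_const 1).add (hG T).1
    have j2 : Integrable (fun ω => 1 + G 0 ω ^ 4) P := (integrable_const 1).add (hG 0).1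
    rw [integral_const_mul, integral_add j1 j2, integral_add (integrable_const 1) (hG T).1,
      integral_add (integrable_const 1) (hG 0).1]
    simp only [integral_const, probReal_univ, smul_eq_mul, mul_one]
    have := (hG T).2
    have := (hG 0).2
    gcongr
    linarith

/-- With `T = w⁸`, frequency `ζ = θ / √T` and blocks of length `L`, the accumulated errors are of
order `L³ / √T` from the Taylor remainder, `1 / L` from the conditional variance and `L / T` from
the exponential. Length about `w = T^(1/8)` makes the first two of order `1 / w`, with integer
powers throughout. -/
lemma exists_norm_charFun_average_sub_le (θ : ℝ) :
    ∃ D, ∀ w : ℝ, 1 ≤ w →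
      ‖∫ ω, Complex.exp ((θ / w ^ 4 * ∫ u in (0 : ℝ)..w ^ 8, f u ω : ℝ) * Complex.I) ∂P -
        (Real.exp (-(θ ^ 2 * v / 2)) : ℝ)‖ ≤ D / w := by
  have hB := h.bound_nonneg
  have hv := h.variance_nonneg
  set C := 2 * (1 + B) + ∫ t in Ioi 0, a t with hC
  have hC0 : 0 ≤ C := by
    have := h.rate_integral_nonneg
    positivity
  refine ⟨|θ| * (2 * (1 + B)) + 2 * (4 * |θ| ^ 3 * (1 + 1296 * B) + θ ^ 2 * C +
    (θ ^ 2 * v / 2) ^ 2), fun w hw => ?_⟩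
  have hw0 : 0 < w := by linarith
  set ζ := θ / w ^ 4 with hζ
  set K := ⌈w ^ 7⌉₊ with hK
  have hK1 : w ^ 7 ≤ K := Nat.le_ceil _
  have hw7 : 1 ≤ w ^ 7 := one_le_pow₀ hw
  have hK2 : (K : ℝ) ≤ 2 * w ^ 7 := by
    have := (Nat.ceil_lt_add_one (show 0 ≤ w ^ 7 by positivity)).le
    linarith
  have hK0 : 0 < K := Nat.ceil_pos.2 (by positivity)
  have hKr : (0 : ℝ) < K := by exact_mod_cast hK0
  have hL : w ^ 8 / K ≤ w := by
    rw [div_le_iff₀ hKr]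
    calc w ^ 8 = w * w ^ 7 := by ring
      _ ≤ w * K := by gcongr
  have hL0 : 0 ≤ w ^ 8 / K := by positivity
  have b1 := h.norm_charFun_integral_sub_le (w ^ 8) ζ
  have b2 := h.norm_charFun_increment_sub_le (show 0 ≤ w ^ 8 by positivity) hK0 ζ
  have hζabs : |ζ| = |θ| / w ^ 4 := by rw [hζ, abs_div, abs_of_pos (by positivity : 0 < w ^ 4)]
  have hexp : ζ ^ 2 * (w ^ 8 * v) / 2 = θ ^ 2 * v / 2 := by rw [hζ]; field_simp
  rw [hexp, ← hC] at b2
  have c1 : 4 * |ζ| ^ 3 * (1 + 81 * B * (1 + w ^ 8 / K) ^ 4) ≤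
      4 * |θ| ^ 3 * (1 + 1296 * B) / w ^ 8 := by
    have e1 : (1 + w ^ 8 / K) ^ 4 ≤ (2 * w) ^ 4 := by gcongr; linarith
    -- Here `1296 = 81 * 2 ^ 4`, because `1 + L ≤ 2 * w`.
    have e2 : 1 + 81 * B * (1 + w ^ 8 / K) ^ 4 ≤ (1 + 1296 * B) * w ^ 4 := by
      have : 1 ≤ w ^ 4 := one_le_pow₀ hw
      calc 1 + 81 * B * (1 + w ^ 8 / K) ^ 4 ≤ 1 * w ^ 4 + 81 * B * (2 * w) ^ 4 := by
            gcongr; linarith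
        _ = _ := by ring
    calc 4 * |ζ| ^ 3 * (1 + 81 * B * (1 + w ^ 8 / K) ^ 4)
        ≤ 4 * |ζ| ^ 3 * ((1 + 1296 * B) * w ^ 4) := by gcongr
      _ = _ := by rw [hζabs]; field_simp
  have c2 : ζ ^ 2 * C = θ ^ 2 * C / w ^ 8 := by rw [hζ]; field_simp
  have c3 : (ζ ^ 2 * (w ^ 8 / K * v) / 2) ^ 2 ≤ (θ ^ 2 * v / 2) ^ 2 / w ^ 8 := by
    calc (ζ ^ 2 * (w ^ 8 / K * v) / 2) ^ 2 ≤ (ζ ^ 2 * (w * v) / 2) ^ 2 := by gcongr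
      _ = (θ ^ 2 * v / 2) ^ 2 / w ^ 14 := by rw [hζ]; field_simp
      _ ≤ _ := by gcongr; norm_num
  have c4 : |ζ| * (2 * (1 + B)) ≤ |θ| * (2 * (1 + B)) / w := by
    rw [hζabs, div_mul_eq_mul_div]
    gcongr
    exact le_self_pow₀ hw (by norm_num)
  calc ‖∫ ω, Complex.exp ((ζ * ∫ u in (0 : ℝ)..w ^ 8, f u ω : ℝ) * Complex.I) ∂P -
        (Real.exp (-(θ ^ 2 * v / 2)) : ℝ)‖
      ≤ |ζ| * (2 * (1 + B)) + K * (4 * |ζ| ^ 3 * (1 + 81 * B * (1 + w ^ 8 / K) ^ 4) +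
        ζ ^ 2 * C + (ζ ^ 2 * (w ^ 8 / K * v) / 2) ^ 2) :=
        (norm_sub_le_norm_sub_add_norm_sub _ _ _).trans (add_le_add b1 b2)
    _ ≤ |θ| * (2 * (1 + B)) / w + 2 * w ^ 7 * (4 * |θ| ^ 3 * (1 + 1296 * B) / w ^ 8 +
          θ ^ 2 * C / w ^ 8 + (θ ^ 2 * v / 2) ^ 2 / w ^ 8) := by
        rw [c2]
        gcongr
    _ = _ := by field_simp

/-- Central limit theorem. -/
theorem tendstoInDistribution :
    TendstoInDistribution
      (fun (T : ℝ) (ω : Ω) => (1 / Real.sqrt T) * ∫ t in (0 : ℝ)..T, f t ω)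
      atTop (id : ℝ → ℝ) (fun _ => P) (gaussianReal 0 v.toNNReal) := by
  have hm : ∀ T : ℝ, AEMeasurable (fun ω => (1 / Real.sqrt T) * ∫ t in (0 : ℝ)..T, f t ω) P :=
    fun T => ((h.measurable_integral 0 T).const_mul _).aemeasurable
  -- Passing to sequences of times makes Lévy's continuity theorem applicable.
  refine ⟨hm, aemeasurable_id, tendsto_of_seq_tendsto fun τ hτ => ?_⟩
  refine ProbabilityMeasure.tendsto_of_tendsto_charFun fun θ => ?_
  obtain ⟨D, hD⟩ := h.exists_norm_charFun_average_sub_le θ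
  have hlim : charFun ((gaussianReal 0 v.toNNReal).map id) θ =
      (Real.exp (-(θ ^ 2 * v / 2)) : ℝ) := by
    rw [Measure.map_id, charFun_gaussianReal, Real.coe_toNNReal _ h.variance_nonneg]
    push_cast
    ring_nf
  have hτ8 : Tendsto (fun n => τ n ^ (1 / 8 : ℝ)) atTop atTop :=
    (tendsto_rpow_atTop (by norm_num)).comp hτ
  have hzero : Tendsto (fun n => D / τ n ^ (1 / 8 : ℝ)) atTop (𝓝 0) := hτ8.const_div_atTop D
  refine tendsto_iff_norm_sub_tendsto_zero.2
    (squeeze_zero' (Eventually.of_forall fun n => norm_nonneg _) ?_ hzero)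
  filter_upwards [hτ8.eventually_ge_atTop 1, hτ.eventually_ge_atTop 0] with n hn hn0
  have hw8 : (τ n ^ (1 / 8 : ℝ)) ^ 8 = τ n := by
    rw [← Real.rpow_natCast, ← Real.rpow_mul hn0]; norm_num
  have hw4 : (τ n ^ (1 / 8 : ℝ)) ^ 4 = √(τ n) := by
    rw [← Real.rpow_natCast, ← Real.rpow_mul hn0, Real.sqrt_eq_rpow]; norm_num
  have key := hD _ hn
  rw [hw8, hw4] at key
  refine le_trans (le_of_eq ?_) key
  have hcf : charFun (P.map fun ω => (1 / Real.sqrt (τ n)) * ∫ t in (0 : ℝ)..τ n, f t ω) θ =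
      ∫ ω, Complex.exp ((θ / √(τ n) * ∫ u in (0 : ℝ)..τ n, f u ω : ℝ) * Complex.I) ∂P := by
    rw [charFun_apply_real, integral_map (hm _) (by fun_prop)]
    congr 1
    ext ω
    push_cast
    ring_nf
  congr 1
  exact congrArg₂ _ hcf hlim

end ApproxMartingale
end MarkovLimit

namespace MarkovLimit

/-! ### Test functions are locally Hölder. -/

section TestFunctions

variable {E : Type*} [NormedAddCommGroup E]

lemma quasiDist_pos {p γ : ℝ} {x y : E} (hxy : x ≠ y) : 0 < quasiDist p γ x y := by
  have h1 : 0 < ‖x - y‖ := norm_pos_iff.2 (sub_ne_zero.2 hxy)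
  have h2 : 0 < 1 + ‖x‖ ^ p + ‖y‖ ^ p := by positivity
  exact mul_pos (lt_min one_pos (Real.rpow_pos_of_pos h1 _)) (Real.sqrt_pos.2 h2)

/-- The cut-off at one permits lowering the Hölder exponent from `γ` to `γ₁`, the exponent for which
the rate is integrable; the square root halves the weight to order `p / 2`. -/
lemma quasiDist_le {p γ γ₁ : ℝ} (hp : 0 ≤ p) (hγ₁ : 0 ≤ γ₁) (hγ : γ₁ ≤ γ) (x y : E) :
    quasiDist p γ x y ≤ 3 * ‖x - y‖ ^ γ₁ * (1 + ‖x‖ + ‖y‖) ^ (p / 2) := by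
  have hx := norm_nonneg x
  have hy := norm_nonneg y
  have hd := norm_nonneg (x - y)
  have h1 : min 1 (‖x - y‖ ^ γ) ≤ ‖x - y‖ ^ γ₁ := by
    rcases le_total ‖x - y‖ 1 with h | h
    · exact (min_le_right _ _).trans (Real.rpow_le_rpow_of_exponent_ge_of_imp hd h hγ (by
        intro h0 h0'; linarith))
    · exact (min_le_left _ _).trans (Real.one_le_rpow h hγ₁)
  have h2 : √(1 + ‖x‖ ^ p + ‖y‖ ^ p) ≤ 3 * (1 + ‖x‖ + ‖y‖) ^ (p / 2) := by
    rw [Real.sqrt_le_left (by positivity), mul_pow, ← Real.rpow_mul_natCast (by positivity)]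
    have := one_add_rpow_add_rpow_le hx hy hp
    have h0 : 0 ≤ (1 + ‖x‖ + ‖y‖) ^ p := by positivity
    rw [show p / 2 * ((2 : ℕ) : ℝ) = p by push_cast; ring]
    linarith
  calc quasiDist p γ x y ≤ ‖x - y‖ ^ γ₁ * (3 * (1 + ‖x‖ + ‖y‖) ^ (p / 2)) := by
        unfold quasiDist
        gcongr
    _ = _ := by ring

lemma exists_isLocHolder_of_mem_testSpace {p γ γ₁ : ℝ} (hp : 0 ≤ p) (hγ₁ : 0 ≤ γ₁) (hγ : γ₁ ≤ γ)
    {f : E → ℝ} (hf : f ∈ testSpace E p γ) : ∃ c, 0 ≤ c ∧ IsLocHolder γ₁ (p / 2) c f := by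
  obtain ⟨-, hf⟩ := hf
  set S : ℝ≥0∞ := ⨆ (u₁ : E) (u₂ : E) (_ : u₁ ≠ u₂),
    ENNReal.ofReal (|f u₁ - f u₂| / quasiDist p γ u₁ u₂) with hS
  have hSfin : S ≠ ∞ := (lt_of_le_of_lt le_add_self hf).ne
  refine ⟨S.toReal * 3, by positivity, fun x y => ?_⟩
  rcases eq_or_ne x y with rfl | hxy
  · simp only [sub_self, abs_zero]
    positivity
  have h1 : ENNReal.ofReal (|f x - f y| / quasiDist p γ x y) ≤ S :=
    le_iSup_of_le x (le_iSup_of_le y (le_iSup_of_le hxy le_rfl))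
  have h2 : |f x - f y| / quasiDist p γ x y ≤ S.toReal :=
    (ENNReal.ofReal_le_iff_le_toReal hSfin).1 h1
  rw [div_le_iff₀ (quasiDist_pos hxy)] at h2
  refine h2.trans ?_
  rw [mul_assoc, mul_assoc]
  have := quasiDist_le hp hγ₁ hγ x y
  rw [mul_assoc] at this
  gcongr

end TestFunctions

end MarkovLimit

/-! ### Assembly of the main theorem. -/

theorem mainTheorem3
    {E : Type*} [NormedAddCommGroup E] [NormedSpace ℝ E] [CompleteSpace E]
    [TopologicalSpace.SeparableSpace E] [MeasurableSpace E] [BorelSpace E]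
    {Ω : Type*} [mΩ : MeasurableSpace Ω] (P : Measure Ω) [IsProbabilityMeasure P]
    (ℱ : Filtration ℝ≥0 mΩ) (X : ℝ≥0 → E → Ω → E)
    (hX : MarkovLimit.IsTimeHomogeneousMarkov P ℱ X)
    (r r' L₁ γ₁ β L₂ : ℝ) (ρ : ℝ → ℝ)
    (hmoment : MarkovLimit.MomentBound P X r r' L₁)
    (hcontr : MarkovLimit.Contraction P X r γ₁ β L₂ ρ)
    (γ p : ℝ) (hγ : γ ∈ Icc γ₁ 1) (hp : 1 ≤ p)
    (hpr : 2 * r' * (p * r' + (2 + 3 * β) * γ) ≤ r) :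
    ∃ μ : Measure E,
      IsProbabilityMeasure μ ∧ MarkovLimit.IsInvariant hX μ ∧
      (∀ ν : Measure E, IsProbabilityMeasure ν → MarkovLimit.IsInvariant hX ν → ν = μ) ∧
      ∀ f ∈ MarkovLimit.testSpace E p γ,
        -- all the integrals in the statement converge absolutely
        Integrable f μ ∧
        (∀ (u : E) (t : ℝ≥0), Integrable (fun ω => f (X t u ω)) P) ∧
        (∀ u : E, IntegrableOn
          (fun t : ℝ => MarkovLimit.semigroup P X t.toNNReal f u - ∫ y, f y ∂μ) (Ioi 0)) ∧
        Integrable (fun u => (f u - ∫ y, f y ∂μ) * MarkovLimit.corrector P X μ f u) μ ∧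
        0 ≤ MarkovLimit.asymptoticVariance P X μ f ∧
        ∀ x : E,
          (∀ᵐ ω ∂P, ∀ T : ℝ, 0 ≤ T →
            IntervalIntegrable (fun t : ℝ => f (X t.toNNReal x ω)) volume 0 T) ∧
          -- strong law of large numbers
          (∀ᵐ ω ∂P, Tendsto (fun T : ℝ => (1 / T) * ∫ t in (0 : ℝ)..T, f (X t.toNNReal x ω))
            atTop (𝓝 (∫ y, f y ∂μ))) ∧
          -- central limit theorem
          TendstoInDistribution
            (fun (T : ℝ) (ω : Ω) =>
              (1 / Real.sqrt T) * ∫ t in (0 : ℝ)..T, (f (X t.toNNReal x ω) - ∫ y, f y ∂μ))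
            atTop (id : ℝ → ℝ) (fun _ => P)
            (gaussianReal 0 (MarkovLimit.asymptoticVariance P X μ f).toNNReal) := by
  obtain ⟨μ, hμp, hμ, hμr⟩ := MarkovLimit.exists_isInvariant hX hmoment hcontr
  refine ⟨μ, hμp, hμ, fun ν hν hνi => hμ.unique hX hmoment hcontr hμr hνi, fun f hf => ?_⟩
  obtain ⟨hγ0, -⟩ := hcontr.exponent_mem
  have hβ := hcontr.beta_mem.1
  have hr' := hmoment.one_le
  have hr := hmoment.two_le
  obtain ⟨c, hc, hfH⟩ := MarkovLimit.exists_isLocHolder_of_mem_testSpace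
    (zero_le_one.trans hp) hγ0.le hγ.1 hf
  -- With `m = p / 2` the condition reads `2 r' (p r' + (2 + 2 β) γ₁) ≤ r`, which is weaker than the
  -- assumption since `γ₁ ≤ γ`.
  have he : MarkovLimit.ExponentCondition r r' γ₁ β (p / 2) := by
    refine ⟨by linarith, le_trans ?_ hpr⟩
    have h1 : (2 + 2 * β) * γ₁ ≤ (2 + 3 * β) * γ := by
      have := hγ.1
      gcongr
      norm_num
    calc 4 * r' * (β * γ₁ + r' * (p / 2) + γ₁) = 2 * r' * (p * r' + (2 + 2 * β) * γ₁) := by ring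
      _ ≤ _ := by gcongr
  obtain ⟨b1, b2, -, -, b5, -⟩ := he.bounds hmoment hcontr
  have hm := he.nonneg
  have hfm : Measurable f := hf.1.measurable
  have hfg := hfH.hasGrowth hγ0.le hm hc
  obtain ⟨C, hC, hCH⟩ :=
    MarkovLimit.exists_corrector_isLocHolder hX hmoment hcontr hμ hμr he hc hfH
  have hint : Integrable f μ :=
    hfg.integrable hfm (MarkovLimit.integrable_weight_rpow hμr (by linarith) (by linarith))
  have hfg' := (hfH.sub_const (∫ y, f y ∂μ)).hasGrowth hγ0.le hm hc
  obtain ⟨D, -, hD⟩ := hmoment.exists_growth_le hX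
  have main := fun x => MarkovLimit.exists_approxMartingale hX hmoment hcontr hμ hμr he hc hfH x
  refine ⟨hint, fun u t => (hD _ _ f (by linarith) (by linarith) hfm hfg t u).1,
    fun u => MarkovLimit.integrableOn_semigroup_sub hX hmoment hcontr hμ hμr he hc hfH u,
    (hfg'.mul (hCH.hasGrowth hγ0.le b5 hC)).integrable
      ((hfm.sub_const _).mul (hCH.continuous hγ0 b5).measurable)
      (MarkovLimit.integrable_weight_rpow hμr (by linarith) (by linarith)), ?_, fun x => ?_⟩
  -- The asymptotic variance does not depend on the starting point, so the origin serves.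
  · obtain ⟨B, a, h⟩ := main 0
    exact h.variance_nonneg
  · obtain ⟨B, a, h⟩ := main x
    have hii : ∀ᵐ ω ∂P, ∀ T : ℝ, 0 ≤ T →
        IntervalIntegrable (fun t : ℝ => f (X t.toNNReal x ω)) volume 0 T := by
      filter_upwards [h.ae_intervalIntegrable] with ω hω T hT
      simpa using (hω T hT).add (intervalIntegrable_const (c := ∫ y, f y ∂μ))
    refine ⟨hii, ?_, h.tendstoInDistribution⟩
    filter_upwards [h.ae_tendsto_average, hii] with ω hω hi
    have hlim := hω.add_const (∫ y, f y ∂μ)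
    rw [zero_add] at hlim
    refine hlim.congr' ?_
    filter_upwards [eventually_gt_atTop 0] with T hT
    rw [intervalIntegral.integral_sub (hi T hT.le) intervalIntegrable_const,
      intervalIntegral.integral_const, sub_zero, smul_eq_mul]
    field_simp
    ring
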